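/- Let $\Delta\subset(\mathbb R^n)^*$ be a reflexive polytope, i.e. an $n$-dimensional lattice polytope such that each facet $F$ of $\Delta$ lies on the hyperplane $\langle m,v_F\rangle=-1$, where $v_F\in\mathbb Z^n$ is the primitive inward conormal vector of $F$. Let $X=\operatorname{Proj}\bigoplus_{k\ge 0}\bigoplus_{m\in k\Delta\cap\mathbb Z^n}\mathbb C\,\chi^m t^k$ be the associated complex projective toric variety, let $D_F\subset X$ be the torus-invariant prime divisor of the facet $F$, and let $K_X=-\sum_F D_F$ be the canonical divisor, which is Cartier. Let $Y\subset X$ be an anticanonical hypersurface, i.e. any member of the linear system $|-K_X|$ (in particular, a generic one), and let $\mathcal L$ be the restriction to $Y$ of the line bundle $\mathcal O_X(-(n-1)K_X)$. Let $D^b(Y)$ be the bounded derived category of coherent sheaves on $Y$, and put $\mathrm{Ext}^r(\mathcal E,\mathcal F)=\mathrm{Hom}_{D^b(Y)}(\mathcal E,\mathcal F[r])$. If $\mathcal F$ is a nonzero object of $D^b(Y)$, then there exist integers $i_0=i_0(\mathcal F)$ and $r=r(\mathcal F)$ such that $\mathrm{Ext}^r(\mathcal L^{\otimes i},\mathcal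 F)\neq 0$ for every integer $i\le i_0$. -/

import Mathlib

open CategoryTheory Limits AlgebraicGeometry TopologicalSpace

noncomputable section

namespace ToricCY

/-! ### Sheaves of modules on a scheme -/

section Generalities

universe u v₁ u₁
variable {C : Type u₁} [Category.{v₁} C] {J : GrothendieckTopology C} {R : Sheaf J RingCat.{u}}
  [∀ X, HasSheafify (J.over X) AddCommGrpCat.{u}]
  [∀ X, (J.over X).WEqualsLocallyBijective AddCommGrpCat.{u}]

lemma isFiniteType_of_iso {M N : SheafOfModules.{u} R} (e : M ≅ N) (h : M.IsFiniteType) :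
    N.IsFiniteType := by
  obtain ⟨σ, hσ⟩ := h
  refine ⟨{ I := σ.I, X := σ.X, coversTop := σ.coversTop
            generators := fun i ↦ (σ.generators i).ofEpi (e.hom.over (σ.X i)) }, ⟨fun i ↦ ?_⟩⟩
  have := hσ.isFiniteType i
  dsimp
  infer_instance

variable [HasSheafify J AddCommGrpCat.{u}] [J.WEqualsLocallyBijective AddCommGrpCat.{u}]
  [HasBinaryProducts C]

lemma isFiniteType_of_isZero {M : SheafOfModules.{u} R} (h : IsZero M) : M.IsFiniteType := by
  let G : SheafOfModules.GeneratingSections M :=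
    { I := PEmpty, s := fun i ↦ i.elim, epi := h.epi _ }
  have hG : G.IsFiniteType := ⟨inferInstanceAs (Finite PEmpty)⟩
  exact ⟨G.localGeneratorsData, ⟨fun _ ↦ ⟨inferInstanceAs (Finite PEmpty)⟩⟩⟩

lemma isQuasicoherent_of_isZero {M : SheafOfModules.{u} R} (h : IsZero M) :
    M.IsQuasicoherent := by
  let G : SheafOfModules.GeneratingSections M :=
    { I := PEmpty, s := fun i ↦ i.elim, epi := h.epi _ }
  have h0 : IsZero (SheafOfModules.free (R := R) PEmpty.{u+1}) := by
    rw [IsZero.iff_id_eq_zero]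
    apply (SheafOfModules.freeHomEquiv _).injective
    funext i; exact i.elim
  let P : M.Presentation :=
    { generators := G
      relations := { I := PEmpty, s := fun i ↦ i.elim
                     epi := ((h0.of_mono (kernel.ι G.π)).epi _) } }
  exact P.isQuasicoherent
end Generalities

section Modules

variable {X : Scheme.{0}}

/-- `𝒪_X` as a module over itself. -/
def structureModule (X : Scheme.{0}) : X.Modules := SheafOfModules.unit X.ringCatSheaf

/-- `M ⊗ N` over `𝒪_X`: the sheaf associated with `U ↦ M(U) ⊗ N(U)`. -/
def tensorModule (M N : X.Modules) : X.Modules :=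
  (PresheafOfModules.sheafification (𝟙 X.ringCatSheaf.obj)).obj
    (PresheafOfModules.Monoidal.tensorObj (R := X.presheaf) M.val N.val)

/-- The ideal sheaf of the closed subscheme `i : Z → X`, as the kernel of `𝒪_X → i_* 𝒪_Z`. -/
def idealModule (I : X.IdealSheafData) : X.Modules :=
  kernel (SheafOfModules.unitToPushforwardObjUnit I.subschemeι.toRingCatSheafHom :
    structureModule X ⟶ (Scheme.Modules.pushforward I.subschemeι).obj (structureModule I.subscheme))

/-- Sections over `U` of the sheaf `ℋom(M, 𝒪_X)`: the families of `𝒪_X(V)`-linear maps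
`M(V) → 𝒪_X(V)`, for `V ⊆ U` open, that commute with restriction (that is, the morphisms
`M|_U → 𝒪_U`). -/
def dualSections (M : X.Modules) (U : X.Opens) :
    AddSubgroup (∀ V : {V : X.Opens // V ≤ U}, Γ(M, V.1) →ₗ[Γ(X, V.1)] Γ(X, V.1)) where
  carrier := {φ | ∀ (V W : {V : X.Opens // V ≤ U}) (h : W.1 ≤ V.1) (x : Γ(M, V.1)),
    X.presheaf.map (homOfLE h).op (φ V x) = φ W (M.presheaf.map (homOfLE h).op x)}
  zero_mem' := by intro V W h x; simp
  add_mem' := by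
    intro a b ha hb V W h x
    simp [ha V W h x, hb V W h x]
  neg_mem' := by
    intro a ha V W h x
    simp [ha V W h x]

/-- `(r φ)_V = r|_V φ_V`. -/
instance (M : X.Modules) (U : X.Opens) : Module Γ(X, U) (dualSections M U) where
  smul r φ := ⟨fun V ↦ X.presheaf.map (homOfLE V.2).op r • φ.1 V, by
    intro V W h x
    simp only [LinearMap.smul_apply, smul_eq_mul, map_mul]
    rw [φ.2 V W h x, ← CommRingCat.comp_apply, ← Functor.map_comp]
    rfl⟩
  one_smul φ := by
    apply Subtype.ext; funext V
    change X.presheaf.map (homOfLE V.2).op 1 • φ.1 V = φ.1 V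
    simp
  mul_smul r s φ := by
    apply Subtype.ext; funext V
    change X.presheaf.map (homOfLE V.2).op (r * s) • φ.1 V =
      X.presheaf.map (homOfLE V.2).op r • X.presheaf.map (homOfLE V.2).op s • φ.1 V
    rw [map_mul, mul_smul]
  smul_zero r := by
    apply Subtype.ext; funext V
    exact smul_zero _
  smul_add r φ ψ := by
    apply Subtype.ext; funext V
    exact smul_add _ _ _
  add_smul r s φ := by
    apply Subtype.ext; funext V
    change X.presheaf.map (homOfLE V.2).op (r + s) • φ.1 V =
      X.presheaf.map (homOfLE V.2).op r • φ.1 V + X.presheaf.map (homOfLE V.2).op s • φ.1 V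
    rw [map_add, add_smul]
  zero_smul φ := by
    apply Subtype.ext; funext V
    change X.presheaf.map (homOfLE V.2).op 0 • φ.1 V = 0
    rw [map_zero, zero_smul]

def dualRestrict (M : X.Modules) {U V : X.Opens} (h : V ≤ U) :
    dualSections M U →+ dualSections M V where
  toFun φ := ⟨fun W ↦ φ.1 ⟨W.1, W.2.trans h⟩, fun W W' h' x ↦
    φ.2 ⟨W.1, W.2.trans h⟩ ⟨W'.1, W'.2.trans h⟩ h' x⟩
  map_zero' := rfl
  map_add' _ _ := rfl

def dualPresheaf (M : X.Modules) : TopCat.Presheaf Ab X where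
  obj U := AddCommGrpCat.of (dualSections M U.unop)
  map f := AddCommGrpCat.ofHom (dualRestrict M f.unop.le)
  map_id _ := by ext φ; rfl
  map_comp _ _ := by ext φ; rfl

instance (M : X.Modules) (U : (Opens X)ᵒᵖ) :
    Module (X.ringCatSheaf.obj.obj U) ((dualPresheaf M).obj U) :=
  inferInstanceAs (Module Γ(X, U.unop) (dualSections M U.unop))

lemma dualPresheaf_map_smul (M : X.Modules) {U V : (Opens X)ᵒᵖ} (f : U ⟶ V)
    (r : X.ringCatSheaf.obj.obj U) (φ : (dualPresheaf M).obj U) :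
    (dualPresheaf M).map f (r • φ) = X.ringCatSheaf.obj.map f r • (dualPresheaf M).map f φ := by
  refine Subtype.ext (a1 := (_ : dualSections M V.unop)) (a2 := (_ : dualSections M V.unop)) ?_
  funext W
  exact congrArg (· • φ.1 ⟨W.1, W.2.trans f.unop.le⟩)
    (ConcreteCategory.congr_hom (X.presheaf.map_comp f (homOfLE W.2).op) r)

lemma res_res (X : Scheme.{0}) {U V W : X.Opens} (h : V ≤ U) (h' : W ≤ V) (a : Γ(X, U)) :
    X.presheaf.map (homOfLE h').op (X.presheaf.map (homOfLE h).op a) =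
      X.presheaf.map (homOfLE (h'.trans h)).op a :=
  (ConcreteCategory.congr_hom (X.presheaf.map_comp (homOfLE h).op (homOfLE h').op) a).symm

lemma res_res_module (M : X.Modules) {U V W : X.Opens} (h : V ≤ U) (h' : W ≤ V) (a : Γ(M, U)) :
    M.presheaf.map (homOfLE h').op (M.presheaf.map (homOfLE h).op a) =
      M.presheaf.map (homOfLE (h'.trans h)).op a :=
  (ConcreteCategory.congr_hom (M.presheaf.map_comp (homOfLE h).op (homOfLE h').op) a).symm

lemma dualSections_glue (M : X.Modules) {ι : Type} (U : ι → X.Opens)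
    (sf : ∀ i, dualSections M (U i))
    (hsf : ∀ i j (W : X.Opens) (hi : W ≤ U i) (hj : W ≤ U j), (sf i).1 ⟨W, hi⟩ = (sf j).1 ⟨W, hj⟩) :
    ∃! φ : dualSections M (iSup U), ∀ i (W : X.Opens) (hi : W ≤ U i),
      φ.1 ⟨W, hi.trans (le_iSup U i)⟩ = (sf i).1 ⟨W, hi⟩ := by
  have cov (V : X.Opens) (hV : V ≤ iSup U) : V ≤ ⨆ i, V ⊓ U i := by
    rw [← inf_iSup_eq]; exact le_inf le_rfl hV
  have key (V : {V : X.Opens // V ≤ iSup U}) (x : Γ(M, V.1)) :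
      ∃! s : Γ(X, V.1), ∀ i, X.presheaf.map (homOfLE (inf_le_left : V.1 ⊓ U i ≤ V.1)).op s =
        (sf i).1 ⟨V.1 ⊓ U i, inf_le_right⟩
          (M.presheaf.map (homOfLE (inf_le_left : V.1 ⊓ U i ≤ V.1)).op x) := by
    refine X.sheaf.existsUnique_gluing' (fun i ↦ V.1 ⊓ U i) V.1 (fun i ↦ homOfLE inf_le_left)
      (cov V.1 V.2) (fun i ↦ (sf i).1 ⟨V.1 ⊓ U i, inf_le_right⟩
        (M.presheaf.map (homOfLE (inf_le_left : V.1 ⊓ U i ≤ V.1)).op x)) ?_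
    intro i j
    have hi := (sf i).2 ⟨V.1 ⊓ U i, inf_le_right⟩ ⟨(V.1 ⊓ U i) ⊓ (V.1 ⊓ U j),
      inf_le_left.trans inf_le_right⟩ inf_le_left
      (M.presheaf.map (homOfLE (inf_le_left : V.1 ⊓ U i ≤ V.1)).op x)
    have hj := (sf j).2 ⟨V.1 ⊓ U j, inf_le_right⟩ ⟨(V.1 ⊓ U i) ⊓ (V.1 ⊓ U j),
      inf_le_right.trans inf_le_right⟩ inf_le_right
      (M.presheaf.map (homOfLE (inf_le_left : V.1 ⊓ U j ≤ V.1)).op x)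
    refine hi.trans (Eq.trans ?_ hj.symm)
    rw [hsf i j _ _ (inf_le_right.trans inf_le_right), res_res_module, res_res_module]
  choose g hg hu using key
  have ext (V : {V : X.Opens // V ≤ iSup U}) (a b : Γ(X, V.1))
      (h : ∀ i, X.presheaf.map (homOfLE (inf_le_left : V.1 ⊓ U i ≤ V.1)).op a =
        X.presheaf.map (homOfLE (inf_le_left : V.1 ⊓ U i ≤ V.1)).op b) : a = b :=
    X.sheaf.eq_of_locally_eq' (fun i ↦ V.1 ⊓ U i) V.1 (fun i ↦ homOfLE inf_le_left)
      (cov V.1 V.2) a b h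
  let φ : dualSections M (iSup U) := ⟨fun V ↦
    { toFun := g V
      map_add' := fun x y ↦ ext V _ _ fun i ↦ by
        rw [map_add, hg, hg, hg, map_add, map_add]
      map_smul' := fun r x ↦ ext V _ _ fun i ↦ by
        rw [RingHom.id_apply, smul_eq_mul, map_mul, hg, hg, Scheme.Modules.map_smul, map_smul,
          smul_eq_mul] }, by
    intro V W h x
    refine ext W _ _ fun i ↦ ?_
    change X.presheaf.map _ (X.presheaf.map _ (g V x)) = X.presheaf.map _ (g W _)
    rw [hg, res_res, res_res_module,
      ← res_res X (inf_le_left : V.1 ⊓ U i ≤ V.1) (inf_le_inf_right (U i) h), hg,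
      (sf i).2 ⟨V.1 ⊓ U i, inf_le_right⟩ ⟨W.1 ⊓ U i, inf_le_right⟩ (inf_le_inf_right (U i) h),
      res_res_module]⟩
  refine ⟨φ, ?_, ?_⟩
  · intro i W hi
    ext x
    refine (hu ⟨W, hi.trans (le_iSup U i)⟩ x _ fun j ↦ ?_).symm
    rw [(sf i).2 ⟨W, hi⟩ ⟨W ⊓ U j, inf_le_left.trans hi⟩ inf_le_left, hsf i j _ _ inf_le_right]
  · intro ψ hψ
    refine Subtype.ext (funext fun V ↦ LinearMap.ext fun x ↦ hu V x _ fun i ↦ ?_)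
    rw [ψ.2 V ⟨V.1 ⊓ U i, inf_le_left.trans V.2⟩ inf_le_left, ← hψ i]

lemma dualPresheaf_isSheaf (M : X.Modules) : (dualPresheaf M).IsSheaf := by
  rw [TopCat.Presheaf.isSheaf_iff_isSheafUniqueGluing]
  intro ι U sf hsf
  have h := dualSections_glue M U sf (fun i j W hi hj ↦
    congrFun (congrArg Subtype.val (hsf i j :
      dualRestrict M inf_le_left (sf i) = dualRestrict M inf_le_right (sf j))) ⟨W, le_inf hi hj⟩)
  obtain ⟨φ, hφ, hu⟩ := h
  refine ⟨φ, fun i ↦ ?_, fun ψ hψ ↦ hu ψ fun i W hi ↦ ?_⟩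
  · exact Subtype.ext (a1 := (_ : dualSections M (U i))) (a2 := (_ : dualSections M (U i)))
      (funext fun W ↦ hφ i W.1 W.2)
  · exact congrFun (congrArg Subtype.val (hψ i :
      dualRestrict M (le_iSup U i) ψ = sf i)) ⟨W, hi⟩

/-- The dual sheaf `ℋom(M, 𝒪_X)`. -/
def dualModule (M : X.Modules) : X.Modules :=
  { val := PresheafOfModules.ofPresheaf (dualPresheaf M)
      (fun _ _ f r φ ↦ dualPresheaf_map_smul M f r φ)
    isSheaf := dualPresheaf_isSheaf M }

/-- `M^{⊗ k}` for a natural number `k`. -/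
def tensorNPow (M : X.Modules) : ℕ → X.Modules
  | 0 => structureModule X
  | k + 1 => tensorModule (tensorNPow M k) M

/-- `M^{⊗ k}` for an integer `k` and an invertible sheaf `M`: for `k < 0` it is the `|k|`-th power
of the dual of `M`. -/
def tensorPow (M : X.Modules) : ℤ → X.Modules
  | Int.ofNat k => tensorNPow M k
  | Int.negSucc k => tensorNPow (dualModule M) (k + 1)

/-- Coherent sheaves on a (locally Noetherian) scheme: quasi-coherent and of finite type. -/
def IsCoherent (M : X.Modules) : Prop :=
  SheafOfModules.IsQuasicoherent M ∧ SheafOfModules.IsFiniteType M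

lemma isCoherent_of_iso {M N : X.Modules} (e : M ≅ N) (h : IsCoherent M) : IsCoherent N :=
  ⟨(SheafOfModules.isQuasicoherent X.ringCatSheaf).prop_of_iso (X := M) (Y := N)
      ⟨e.hom, e.inv, e.hom_inv_id, e.inv_hom_id⟩ h.1,
    isFiniteType_of_iso (M := M) (N := N) ⟨e.hom, e.inv, e.hom_inv_id, e.inv_hom_id⟩ h.2⟩

lemma isCoherent_zero {M : X.Modules} (h : IsZero M) : IsCoherent M :=
  ⟨isQuasicoherent_of_isZero (M := M) ⟨h.1, h.2⟩, isFiniteType_of_isZero (M := M) ⟨h.1, h.2⟩⟩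

/-! ### The bounded derived category of coherent sheaves -/

/-- Bounded cochain complexes whose terms are coherent sheaves. -/
def isBoundedCoherent (Y : Scheme.{0}) : ObjectProperty (CochainComplex Y.Modules ℤ) := fun K ↦
  (∀ i, IsCoherent (K.X i)) ∧ ∃ a b : ℤ, ∀ i, i < a ∨ b < i → IsZero (K.X i)

instance (Y : Scheme.{0}) : (isBoundedCoherent Y).IsStableUnderShift ℤ where
  isStableUnderShiftBy n := ⟨by
    rintro K ⟨h, a, b, hab⟩
    refine ⟨fun i ↦ h (i + n), a - n, b - n, fun i hi ↦ hab (i + n) (by omega)⟩⟩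

/-- The category of bounded complexes of coherent sheaves on `Y`. -/
abbrev BoundedComplexes (Y : Scheme.{0}) := (isBoundedCoherent Y).FullSubcategory

/-- The quasi-isomorphisms between bounded complexes of coherent sheaves. -/
def quasiIsos (Y : Scheme.{0}) : MorphismProperty (BoundedComplexes Y) :=
  (HomologicalComplex.quasiIso Y.Modules (ComplexShape.up ℤ)).inverseImage (isBoundedCoherent Y).ι

instance (Y : Scheme.{0}) : (quasiIsos Y).IsCompatibleWithShift ℤ where
  condition n := by
    ext K L f
    change HomologicalComplex.quasiIso _ _ _ ↔ HomologicalComplex.quasiIso _ _ f.hom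
    rw [← MorphismProperty.IsCompatibleWithShift.iff
      (HomologicalComplex.quasiIso Y.Modules (ComplexShape.up ℤ)) f.hom n]
    exact (HomologicalComplex.quasiIso Y.Modules (ComplexShape.up ℤ)).arrow_mk_iso_iff
      (Arrow.isoOfNatIso ((isBoundedCoherent Y).ι.commShiftIso n) (Arrow.mk f))

/-- The bounded derived category of coherent sheaves on `Y`: the category of bounded complexes
of coherent sheaves, localized at the quasi-isomorphisms, with its induced shift. -/
abbrev DbCoh (Y : Scheme.{0}) := (quasiIsos Y).Localization

/-- A coherent sheaf as a complex concentrated in degree `0`. -/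
def sheafComplex {Y : Scheme.{0}} (A : Y.Modules) (hA : IsCoherent A) : BoundedComplexes Y :=
  ⟨(CochainComplex.singleFunctor Y.Modules 0).obj A, by
    refine ⟨fun i ↦ ?_, 0, 0, fun i hi ↦
      HomologicalComplex.isZero_single_obj_X _ _ _ _ (by omega)⟩
    by_cases hi : i = 0
    · subst hi
      exact isCoherent_of_iso (HomologicalComplex.singleObjXSelf (ComplexShape.up ℤ) 0 A).symm hA
    · exact isCoherent_zero (HomologicalComplex.isZero_single_obj_X _ _ _ _ hi)⟩

/-- A coherent sheaf as an object of the bounded derived category. -/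
def sheafObj {Y : Scheme.{0}} (A : Y.Modules) (hA : IsCoherent A) : DbCoh Y :=
  (quasiIsos Y).Q.obj (sheafComplex A hA)

/-- `Ext^r(E, F) = Hom(E, F[r])` in the bounded derived category. As this is a group, it is
nonzero if and only if it has more than one element. -/
abbrev DbExt {Y : Scheme.{0}} (r : ℤ) (E F : DbCoh Y) := E ⟶ F⟦r⟧

end Modules

/-! ### Reflexive polytopes and their toric varieties -/

section Toric

/-- The pairing of `m ∈ (ℝⁿ)^*` with `u ∈ ℤⁿ`. -/
def pairing {n : ℕ} (m : Fin n → ℝ) (u : Fin n → ℤ) : ℝ := ∑ i, m i * (u i : ℝ)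

/-- A lattice point as a point of `(ℝⁿ)^*`. -/
def latticePt {n : ℕ} (m : Fin n → ℤ) : Fin n → ℝ := fun i ↦ (m i : ℝ)

/-- `u` is the primitive inward conormal vector of a facet `F` of `Δ`, and `F` lies on the
hyperplane `⟨m, u⟩ = -c`; here `F = {m ∈ Δ | ⟨m, u⟩ = -c}` is a face of dimension `n - 1`. -/
structure IsFacetNormal {n : ℕ} (Δ : Set (Fin n → ℝ)) (u : Fin n → ℤ) (c : ℝ) : Prop where
  primitive : ∀ d : ℤ, (∀ i, d ∣ u i) → IsUnit d
  inward : ∀ m ∈ Δ, -c ≤ pairing m u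
  nonempty : {m ∈ Δ | pairing m u = -c}.Nonempty
  dim : Module.finrank ℝ (vectorSpan ℝ {m ∈ Δ | pairing m u = -c}) + 1 = n

/-- A reflexive polytope: an `n`-dimensional lattice polytope in `(ℝⁿ)^*` each of whose facets
lies on the hyperplane `⟨m, u⟩ = -1`, where `u` is the primitive inward conormal of the facet. -/
structure ReflexivePolytope (n : ℕ) where
  carrier : Set (Fin n → ℝ)
  lattice : ∃ S : Finset (Fin n → ℤ), carrier = convexHull ℝ (latticePt '' (S : Set (Fin n → ℤ)))
  fullDim : affineSpan ℝ carrier = ⊤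
  reflexive : ∀ (u : Fin n → ℤ) (c : ℝ), IsFacetNormal carrier u c → c = 1

namespace ReflexivePolytope

open scoped Pointwise

variable {n : ℕ} (Δ : ReflexivePolytope n)

lemma convex : Convex ℝ Δ.carrier := by
  obtain ⟨S, hS⟩ := Δ.lattice
  rw [hS]
  exact convex_convexHull ℝ _

lemma nonempty : Δ.carrier.Nonempty := by
  rw [← affineSpan_nonempty ℝ, Δ.fullDim]
  exact ⟨0, trivial⟩

/-- The lattice points of the cone over `Δ × {1}`: the pairs `(m, k)` with `m ∈ kΔ`. -/
def cone : AddSubmonoid ((Fin n → ℤ) × ℕ) where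
  carrier := {p | latticePt p.1 ∈ (p.2 : ℝ) • Δ.carrier}
  zero_mem' := by
    obtain ⟨x, hx⟩ := Δ.nonempty
    refine ⟨x, hx, ?_⟩
    ext i
    simp [latticePt]
  add_mem' := by
    intro p q hp hq
    have h : latticePt (p + q).1 = latticePt p.1 + latticePt q.1 := by
      ext i
      simp [latticePt]
    change latticePt (p + q).1 ∈ ((p.2 + q.2 : ℕ) : ℝ) • Δ.carrier
    rw [h, Nat.cast_add, Δ.convex.add_smul (Nat.cast_nonneg _) (Nat.cast_nonneg _)]
    exact Set.add_mem_add hp hq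

/-- The homogeneous coordinate ring `S_Δ`, with basis the monomials `χ^m t^k` for `m ∈ kΔ`. -/
abbrev coordRing : Type := AddMonoidAlgebra ℂ Δ.cone

/-- The degree `(m, k) ↦ k`. -/
def degree : Δ.cone →+ ℕ := (AddMonoidHom.snd (Fin n → ℤ) ℕ).comp Δ.cone.subtype

/-- The grading of `S_Δ` by the degree in `t`. -/
abbrev grading : ℕ → Submodule ℂ Δ.coordRing := AddMonoidAlgebra.gradeBy ℂ Δ.degree

/-- The toric variety `X = Proj S_Δ` of `Δ`. -/
def toricVariety : Scheme.{0} := Proj Δ.grading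

/-- The facets of `Δ`, each given by its primitive inward conormal. -/
abbrev Facet : Type := {u : Fin n → ℤ // IsFacetNormal Δ.carrier u 1}

/-- The torus-invariant prime divisor `D_F` of the facet `F`: the common zeros of the monomials
`χ^m t^k` with `m ∉ kF`. -/
def facetDivisor (F : Δ.Facet) : Closeds Δ.toricVariety :=
  ⟨ProjectiveSpectrum.zeroLocus Δ.grading
    {f | ∃ p : Δ.cone, pairing (latticePt p.1.1) F.1 ≠ -(p.1.2 : ℝ) ∧
      f = AddMonoidAlgebra.single p 1},
    ProjectiveSpectrum.isClosed_zeroLocus Δ.grading _⟩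

/-- The canonical sheaf `𝒪_X(K_X)`, for the canonical divisor `K_X = -∑_F D_F`. Since `∑_F D_F` is
reduced and `X` is normal, this is the ideal sheaf of the (reduced) union of the `D_F`. -/
def canonicalSheaf : Δ.toricVariety.Modules :=
  idealModule (Scheme.IdealSheafData.vanishingIdeal (⨆ F, Δ.facetDivisor F))

/-- The closed subscheme `Y` with ideal sheaf `I` is an anticanonical hypersurface, that is a member
of the complete linear system `|-K_X|`: it is an effective Cartier divisor with
`𝒪_X(-Y) ≅ 𝒪_X(K_X)`. -/
def IsAnticanonical (I : Δ.toricVariety.IdealSheafData) : Prop :=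
  Nonempty (idealModule I ≅ Δ.canonicalSheaf)

/-- The sheaf `𝒪_X(-(n-1)K_X)`. -/
def polarization : Δ.toricVariety.Modules :=
  tensorPow Δ.canonicalSheaf (-((n : ℤ) - 1))

/-- The restriction `ℒ` of `𝒪_X(-(n-1)K_X)` to the closed subscheme `Y` with ideal sheaf `I`. -/
def lineBundle (I : Δ.toricVariety.IdealSheafData) : I.subscheme.Modules :=
  (Scheme.Modules.pullback I.subschemeι).obj Δ.polarization

end ReflexivePolytope

end Toric

end ToricCY

end

/-!
A sheaf which is given on the charts `U_v` of a cover by frames with transition functions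
`(x_v / x_w) ^ d` behaves like `𝒪(d)`. Sections of kernels of morphisms of quasi-coherent sheaves
extend after multiplication by powers of a function, so, as in Serre's theorem, a nonzero morphism
`Z ⟶ H` out of such a kernel stays nonzero after composition with some `𝒪(-k) ⟶ Z`, for all large
`k`. If the cohomology sheaf of a complex `F` in degree `r` is nonzero, the surjection from the
cycles onto it yields morphisms `𝒪(-k) ⟶ F[r]` that are nonzero on cohomology.

Reflexivity places every facet at height `-1`, so a monomial whose divisor contains every `D_F` is a
multiple of `t`. Hence the canonical sheaf, the ideal sheaf of `⋃_F D_F`, is generated by `t / x_v`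
on `D₊(x_v)`; it is an `𝒪(-1)`, and the polarization is an `𝒪(n - 1)`, which is enough for `2 ≤ n`.
For `n = 0` there is a single chart. For `n = 1` the polarization is trivial, but the proper
subscheme `Y` of the projective line is affine, being contained in the complement of a point.
-/

noncomputable section

namespace ToricCY

/-! ### Frames -/

section Frames

variable {X : Scheme.{0}}

/-- Restriction of functions. -/
def resO {U W : X.Opens} (h : W ≤ U) : Γ(X, U) →+* Γ(X, W) := (X.presheaf.map (homOfLE h).op).hom

/-- Restriction of sections of a module. -/
def resM (M : X.Modules) {U W : X.Opens} (h : W ≤ U) : Γ(M, U) →+ Γ(M, W) :=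
  (M.presheaf.map (homOfLE h).op).hom

lemma resO_resO {U V W : X.Opens} (h : V ≤ U) (h' : W ≤ V) (a : Γ(X, U)) :
    resO h' (resO h a) = resO (h'.trans h) a := res_res X h h' a

lemma resM_resM (M : X.Modules) {U V W : X.Opens} (h : V ≤ U) (h' : W ≤ V) (a : Γ(M, U)) :
    resM M h' (resM M h a) = resM M (h'.trans h) a := res_res_module M h h' a

lemma resO_rfl {U : X.Opens} (h : U ≤ U) (a : Γ(X, U)) : resO h a = a :=
  ConcreteCategory.congr_hom (X.presheaf.map_id (.op U)) a

lemma resM_rfl (M : X.Modules) {U : X.Opens} (h : U ≤ U) (a : Γ(M, U)) : resM M h a = a :=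
  ConcreteCategory.congr_hom (M.presheaf.map_id (.op U)) a

lemma resM_smul (M : X.Modules) {U W : X.Opens} (h : W ≤ U) (r : Γ(X, U)) (a : Γ(M, U)) :
    resM M h (r • a) = resO h r • resM M h a := Scheme.Modules.map_smul M (homOfLE h) r a

lemma app_resM {M N : X.Modules} (φ : M ⟶ N) {U W : X.Opens} (h : W ≤ U) (a : Γ(M, U)) :
    φ.app W (resM M h a) = resM N h (φ.app U a) :=
  (ConcreteCategory.congr_hom (φ.mapPresheaf.naturality (homOfLE h).op) a)

lemma section_ext (M : X.Modules) {ι : Type} (U : ι → X.Opens) {W : X.Opens}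
    (hU : ∀ i, U i ≤ W) (hW : W ≤ iSup U) {a b : Γ(M, W)}
    (h : ∀ i, resM M (hU i) a = resM M (hU i) b) : a = b :=
  TopCat.Sheaf.eq_of_locally_eq' ⟨M.presheaf, M.isSheaf⟩ U W (fun i ↦ homOfLE (hU i)) hW a b h

lemma function_ext {ι : Type} (U : ι → X.Opens) {W : X.Opens}
    (hU : ∀ i, U i ≤ W) (hW : W ≤ iSup U) {a b : Γ(X, W)}
    (h : ∀ i, resO (hU i) a = resO (hU i) b) : a = b :=
  X.sheaf.eq_of_locally_eq' U W (fun i ↦ homOfLE (hU i)) hW a b h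

lemma section_glue (M : X.Modules) {ι : Type} (U : ι → X.Opens) {W : X.Opens}
    (hU : ∀ i, U i ≤ W) (hW : W ≤ iSup U) (s : ∀ i, Γ(M, U i))
    (h : ∀ i j, resM M (inf_le_left : U i ⊓ U j ≤ U i) (s i) =
      resM M (inf_le_right : U i ⊓ U j ≤ U j) (s j)) :
    ∃ a : Γ(M, W), ∀ i, resM M (hU i) a = s i := by
  obtain ⟨a, ha, -⟩ := TopCat.Sheaf.existsUnique_gluing' ⟨M.presheaf, M.isSheaf⟩ U W
    (fun i ↦ homOfLE (hU i)) hW s h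
  exact ⟨a, ha⟩

lemma function_glue {ι : Type} (U : ι → X.Opens) {W : X.Opens}
    (hU : ∀ i, U i ≤ W) (hW : W ≤ iSup U) (s : ∀ i, Γ(X, U i))
    (h : ∀ i j, resO (inf_le_left : U i ⊓ U j ≤ U i) (s i) =
      resO (inf_le_right : U i ⊓ U j ≤ U j) (s j)) :
    ∃ a : Γ(X, W), ∀ i, resO (hU i) a = s i := by
  obtain ⟨a, ha, -⟩ := X.sheaf.existsUnique_gluing' U W
    (fun i ↦ homOfLE (hU i)) hW s h
  exact ⟨a, ha⟩

/-- A section `e` of `M` over `U` is a frame if it freely generates `M` over `U`. -/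
def IsFrame (M : X.Modules) {U : X.Opens} (e : Γ(M, U)) : Prop :=
  ∀ (W : X.Opens) (h : W ≤ U), Function.Bijective fun r : Γ(X, W) ↦ r • resM M h e

variable {M N : X.Modules} {U : X.Opens}

namespace IsFrame

variable {e : Γ(M, U)}

/-- The coordinate of a section with respect to a frame. -/
def coord (he : IsFrame M e) {W : X.Opens} (h : W ≤ U) : Γ(M, W) →ₗ[Γ(X, W)] Γ(X, W) :=
  (LinearEquiv.ofBijective ((LinearMap.id (R := Γ(X, W))).smulRight (resM M h e)) (he W h)).symm

lemma coord_smul_frame (he : IsFrame M e) {W : X.Opens} (h : W ≤ U) (m : Γ(M, W)) :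
    he.coord h m • resM M h e = m :=
  (LinearEquiv.ofBijective ((LinearMap.id (R := Γ(X, W))).smulRight (resM M h e))
    (he W h)).apply_symm_apply m

lemma coord_eq (he : IsFrame M e) {W : X.Opens} (h : W ≤ U) {m : Γ(M, W)} {r : Γ(X, W)}
    (hr : r • resM M h e = m) : he.coord h m = r :=
  (he W h).1 ((he.coord_smul_frame h m).trans hr.symm)

lemma coord_frame (he : IsFrame M e) {W : X.Opens} (h : W ≤ U) :
    he.coord h (resM M h e) = 1 := he.coord_eq h (one_smul _ _)

lemma resO_coord (he : IsFrame M e) {V W : X.Opens} (h : V ≤ U) (h' : W ≤ V) (m : Γ(M, V)) :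
    resO h' (he.coord h m) = he.coord (h'.trans h) (resM M h' m) := by
  refine (he.coord_eq _ ?_).symm
  rw [← resM_resM M h h', ← resM_smul, coord_smul_frame]

end IsFrame

/-- The morphism of modules with the given components. -/
def homMk (f : ∀ W : X.Opens, Γ(M, W) →ₗ[Γ(X, W)] Γ(N, W))
    (hf : ∀ (V W : X.Opens) (h : W ≤ V) (m : Γ(M, V)), resM N h (f V m) = f W (resM M h m)) :
    M ⟶ N :=
  ⟨{ app V := ModuleCat.ofHom (f V.unop)
     naturality {V W} i := by
      ext m
      exact (hf V.unop W.unop i.unop.le m).symm }⟩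

lemma homMk_app (f : ∀ W : X.Opens, Γ(M, W) →ₗ[Γ(X, W)] Γ(N, W))
    (hf : ∀ (V W : X.Opens) (h : W ≤ V) (m : Γ(M, V)), resM N h (f V m) = f W (resM M h m))
    {W : X.Opens} (m : Γ(M, W)) : (homMk f hf).app W m = f W m := rfl

/-- Injectivity makes the local coordinates of a section unique, so that they glue. -/
lemma isFrame_of_locally {e : Γ(M, U)}
    (hinj : ∀ (W : X.Opens) (h : W ≤ U) (r : Γ(X, W)), r • resM M h e = 0 →
      ∀ x ∈ W, ∃ (V : X.Opens) (hV : V ≤ W), x ∈ V ∧ resO hV r = 0)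
    (hsurj : ∀ (W : X.Opens) (h : W ≤ U) (m : Γ(M, W)),
      ∀ x ∈ W, ∃ (V : X.Opens) (hV : V ≤ W), x ∈ V ∧
        ∃ r : Γ(X, V), r • resM M (hV.trans h) e = resM M hV m) :
    IsFrame M e := by
  have inj (W : X.Opens) (h : W ≤ U) : Function.Injective fun r : Γ(X, W) ↦ r • resM M h e := by
    intro r s hrs
    have hsub : (r - s) • resM M h e = 0 := by
      rw [sub_smul]
      exact sub_eq_zero.2 hrs
    choose V hV hxV hr using fun x : W ↦ hinj W h _ hsub x.1 x.2
    refine function_ext V hV (fun x hx ↦ Opens.mem_iSup.2 ⟨⟨x, hx⟩, hxV ⟨x, hx⟩⟩) fun i ↦ ?_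
    exact sub_eq_zero.1 ((map_sub _ _ _).symm.trans (hr i))
  refine fun W h ↦ ⟨inj W h, fun m ↦ ?_⟩
  choose V hV hxV r hr using fun x : W ↦ hsurj W h m x.1 x.2
  have cover : W ≤ iSup V := fun x hx ↦ Opens.mem_iSup.2 ⟨⟨x, hx⟩, hxV ⟨x, hx⟩⟩
  obtain ⟨a, ha⟩ := function_glue V hV cover r fun i j ↦ by
    refine inj _ ((inf_le_left.trans (hV i)).trans h) ?_
    have hi := congrArg (resM M (inf_le_left : V i ⊓ V j ≤ V i)) (hr i)
    have hj := congrArg (resM M (inf_le_right : V i ⊓ V j ≤ V j)) (hr j)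
    rw [resM_smul, resM_resM, resM_resM] at hi hj
    exact hi.trans hj.symm
  refine ⟨a, section_ext M V hV cover fun i ↦ ?_⟩
  rw [resM_smul, ha, resM_resM, hr]

lemma isFrame_of_basis {e : Γ(M, U)} (B : Set X.Opens)
    (hB : ∀ W ≤ U, ∀ x ∈ W, ∃ V ∈ B, x ∈ V ∧ V ≤ W)
    (he : ∀ V ∈ B, ∀ h : V ≤ U, Function.Bijective fun r : Γ(X, V) ↦ r • resM M h e) :
    IsFrame M e := by
  refine isFrame_of_locally (fun W h r hr x hx ↦ ?_) fun W h m x hx ↦ ?_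
  all_goals obtain ⟨V, hVB, hxV, hV⟩ := hB W h x hx
  · refine ⟨V, hV, hxV, (he V hVB (hV.trans h)).1 ?_⟩
    simpa only [resM_smul, resM_resM, map_zero, zero_smul] using congrArg (resM M hV) hr
  · exact ⟨V, hV, hxV, (he V hVB (hV.trans h)).2 (resM M hV m)⟩

lemma exists_glue_hom {ι : Type} (U : ι → X.Opens) (hU : iSup U = ⊤)
    (Φ : ∀ (i : ι) (W : X.Opens), W ≤ U i → (Γ(M, W) →ₗ[Γ(X, W)] Γ(N, W)))
    (hres : ∀ i (W V : X.Opens) (hW : W ≤ U i) (h : V ≤ W) (m : Γ(M, W)),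
      resM N h (Φ i W hW m) = Φ i V (h.trans hW) (resM M h m))
    (hagree : ∀ i j (W : X.Opens) (hi : W ≤ U i) (hj : W ≤ U j) (m : Γ(M, W)),
      Φ i W hi m = Φ j W hj m) :
    ∃ φ : M ⟶ N, ∀ i (W : X.Opens) (h : W ≤ U i) (m : Γ(M, W)), φ.app W m = Φ i W h m := by
  have cover (V : X.Opens) : V ≤ ⨆ i, V ⊓ U i := by
    rw [← inf_iSup_eq, hU, inf_top_eq]
  have glue (V : X.Opens) (m : Γ(M, V)) : ∃ s : Γ(N, V), ∀ i,
      resM N (inf_le_left : V ⊓ U i ≤ V) s =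
        Φ i (V ⊓ U i) inf_le_right (resM M inf_le_left m) := by
    refine section_glue N (fun i ↦ V ⊓ U i) (fun i ↦ inf_le_left) (cover V) _ fun i j ↦ ?_
    rw [hres, hres, resM_resM, resM_resM]
    exact hagree _ _ _ _ _ _
  choose g hg using glue
  have ext (V : X.Opens) {a b : Γ(N, V)} (h : ∀ i, resM N (inf_le_left : V ⊓ U i ≤ V) a =
      resM N (inf_le_left : V ⊓ U i ≤ V) b) : a = b :=
    section_ext N (fun i ↦ V ⊓ U i) (fun i ↦ inf_le_left) (cover V) h
  let f (V : X.Opens) : Γ(M, V) →ₗ[Γ(X, V)] Γ(N, V) :=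
    { toFun := g V
      map_add' := fun a b ↦ ext V fun i ↦ by simp only [hg, map_add]
      map_smul' := fun r a ↦ ext V fun i ↦ by
        simp only [hg, resM_smul, map_smul, RingHom.id_apply] }
  refine ⟨homMk f fun V W h m ↦ ext W fun i ↦ ?_, fun i W h m ↦ ext W fun j ↦ ?_⟩
  · change resM N _ (resM N h (g V m)) = resM N _ (g W _)
    rw [hg, resM_resM, ← resM_resM N (inf_le_left : V ⊓ U i ≤ V) (inf_le_inf_right (U i) h), hg,
      hres, resM_resM, resM_resM]
  · rw [homMk_app]
    change resM N _ (g W m) = _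
    rw [hg, hres]
    exact hagree _ _ _ _ _ _

end Frames

section FrameOperations

variable {X : Scheme.{0}} {M N : X.Modules} {U : X.Opens}

/-- The section `1` of the structure sheaf. -/
def oneSec (U : X.Opens) : Γ(structureModule X, U) := (1 : Γ(X, U))

lemma resM_oneSec {U V : X.Opens} (h : V ≤ U) : resM (structureModule X) h (oneSec U) = oneSec V :=
  map_one (resO h)

lemma isFrame_one (U : X.Opens) : IsFrame (structureModule X) (oneSec U) := by
  intro W h
  rw [resM_oneSec]
  have : (fun r : Γ(X, W) ↦ r • oneSec W) = id := funext fun r ↦ mul_one (M := Γ(X, W)) r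
  exact this ▸ Function.bijective_id

/-- The coordinate function of a frame, as a section of the dual. -/
def IsFrame.dual {e : Γ(M, U)} (he : IsFrame M e) : Γ(dualModule M, U) :=
  (⟨fun V ↦ he.coord V.2, fun V _ h x ↦ he.resO_coord V.2 h x⟩ : dualSections M U)

/-- Evaluation of a section of the dual. -/
def dualEval {U : X.Opens} (φ : Γ(dualModule M, U)) {V : X.Opens} (h : V ≤ U) :
    Γ(M, V) →ₗ[Γ(X, V)] Γ(X, V) := (show dualSections M U from φ).1 ⟨V, h⟩

lemma dual_ext {U : X.Opens} {φ ψ : Γ(dualModule M, U)}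
    (h : ∀ (V : X.Opens) (hV : V ≤ U) (m : Γ(M, V)), dualEval φ hV m = dualEval ψ hV m) : φ = ψ :=
  Subtype.ext (a1 := (φ : dualSections M U)) (a2 := (ψ : dualSections M U))
    (funext fun V ↦ LinearMap.ext fun m ↦ h V.1 V.2 m)

lemma dualEval_smul {U V : X.Opens} (h : V ≤ U) (r : Γ(X, U)) (φ : Γ(dualModule M, U))
    (m : Γ(M, V)) : dualEval (r • φ) h m = resO h r * dualEval φ h m := rfl

lemma dualEval_resM {U V W : X.Opens} (h : V ≤ U) (h' : W ≤ V) (φ : Γ(dualModule M, U))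
    (m : Γ(M, W)) : dualEval (resM _ h φ) h' m = dualEval φ (h'.trans h) m := rfl

lemma resO_dualEval {U V W : X.Opens} (h : V ≤ U) (h' : W ≤ V) (φ : Γ(dualModule M, U))
    (m : Γ(M, V)) : resO h' (dualEval φ h m) = dualEval φ (h'.trans h) (resM M h' m) :=
  (show dualSections M U from φ).2 ⟨V, h⟩ ⟨W, h'.trans h⟩ h' m

lemma IsFrame.dualEval_dual {e : Γ(M, U)} (he : IsFrame M e) {V : X.Opens} (h : V ≤ U)
    (m : Γ(M, V)) : dualEval he.dual h m = he.coord h m := rfl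

lemma IsFrame.isFrame_dual {e : Γ(M, U)} (he : IsFrame M e) :
    IsFrame (dualModule M) he.dual := by
  intro W h
  constructor
  · intro r s hrs
    have := congrArg (fun φ ↦ dualEval φ le_rfl (resM M h e)) hrs
    simpa only [dualEval_smul, dualEval_resM, he.dualEval_dual, he.coord_frame, mul_one,
      resO_rfl] using this
  · intro φ
    refine ⟨dualEval φ le_rfl (resM M h e), dual_ext fun V hV m ↦ ?_⟩
    rw [dualEval_smul, dualEval_resM, he.dualEval_dual, resO_dualEval, resM_resM, mul_comm,
      ← smul_eq_mul, ← map_smul, he.coord_smul_frame]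

/-! ### Tensor products -/

open TensorProduct

/-- The canonical map from the presheaf tensor product. -/
def tensorToSheaf (M N : X.Modules) (U : X.Opens) :
    (Γ(M, U) ⊗[Γ(X, U)] Γ(N, U)) →ₗ[Γ(X, U)] Γ(tensorModule M N, U) :=
  (((PresheafOfModules.sheafificationAdjunction (𝟙 X.ringCatSheaf.obj)).unit.app
    (PresheafOfModules.Monoidal.tensorObj (R := X.presheaf) M.val N.val)).app (.op U)).hom

/-- Restriction on the presheaf tensor product. -/
def tensorRes (M N : X.Modules) {U V : X.Opens} (h : V ≤ U) :
    (Γ(M, U) ⊗[Γ(X, U)] Γ(N, U)) →+ (Γ(M, V) ⊗[Γ(X, V)] Γ(N, V)) :=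
  ((PresheafOfModules.Monoidal.tensorObj (R := X.presheaf) M.val N.val).presheaf.map
    (homOfLE h).op).hom

lemma tensorRes_tmul {U V : X.Opens} (h : V ≤ U) (m : Γ(M, U)) (n : Γ(N, U)) :
    tensorRes M N h (m ⊗ₜ n) = resM M h m ⊗ₜ resM N h n := rfl

lemma resM_tensorToSheaf {U V : X.Opens} (h : V ≤ U) (z : Γ(M, U) ⊗[Γ(X, U)] Γ(N, U)) :
    resM _ h (tensorToSheaf M N U z) = tensorToSheaf M N V (tensorRes M N h z) :=
  (ConcreteCategory.congr_hom ((CategoryTheory.toSheafify (Opens.grothendieckTopology X)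
    (PresheafOfModules.Monoidal.tensorObj (R := X.presheaf) M.val N.val).presheaf).naturality
      (homOfLE h).op) z).symm

lemma tensorToSheaf_locally_injective {U : X.Opens} (z : Γ(M, U) ⊗[Γ(X, U)] Γ(N, U))
    (hz : tensorToSheaf M N U z = 0) (x : X) (hx : x ∈ U) :
    ∃ (V : X.Opens) (h : V ≤ U), x ∈ V ∧ tensorRes M N h z = 0 := by
  have := Presheaf.equalizerSieve_mem (Opens.grothendieckTopology X)
    (CategoryTheory.toSheafify (Opens.grothendieckTopology X)
    (PresheafOfModules.Monoidal.tensorObj (R := X.presheaf) M.val N.val).presheaf)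
    (X := .op U) z 0 (by rw [map_zero]; exact hz)
  obtain ⟨V, f, hf, hxV⟩ := this x hx
  refine ⟨V, f.le, hxV, ?_⟩
  exact (hf : _ = _).trans (map_zero (tensorRes M N f.le))

lemma tensorToSheaf_locally_surjective {U : X.Opens} (s : Γ(tensorModule M N, U))
    (x : X) (hx : x ∈ U) :
    ∃ (V : X.Opens) (h : V ≤ U) (z : Γ(M, V) ⊗[Γ(X, V)] Γ(N, V)), x ∈ V ∧
      tensorToSheaf M N V z = resM _ h s := by
  have := Presheaf.imageSieve_mem (Opens.grothendieckTopology X)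
    (CategoryTheory.toSheafify (Opens.grothendieckTopology X)
    (PresheafOfModules.Monoidal.tensorObj (R := X.presheaf) M.val N.val).presheaf) (U := .op U) s
  obtain ⟨V, f, ⟨z, hz⟩, hxV⟩ := this x hx
  exact ⟨V, f.le, z, hxV, hz⟩

/-- The tensor product of two sections. -/
def tmulSec {U : X.Opens} (m : Γ(M, U)) (n : Γ(N, U)) : Γ(tensorModule M N, U) :=
  tensorToSheaf M N U (m ⊗ₜ n)

lemma resM_tmulSec {U V : X.Opens} (h : V ≤ U) (m : Γ(M, U)) (n : Γ(N, U)) :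
    resM _ h (tmulSec m n) = tmulSec (resM M h m) (resM N h n) :=
  resM_tensorToSheaf h _

lemma smul_tmulSec_smul {U : X.Opens} (a b : Γ(X, U)) (m : Γ(M, U)) (n : Γ(N, U)) :
    tmulSec (a • m) (b • n) = (a * b) • tmulSec m n := by
  rw [tmulSec, tmulSec, TensorProduct.smul_tmul_smul, map_smul]

lemma IsFrame.exists_eq_smul_tmul {e : Γ(M, U)} {f : Γ(N, U)} (he : IsFrame M e)
    (hf : IsFrame N f) {W : X.Opens} (h : W ≤ U) (z : Γ(M, W) ⊗[Γ(X, W)] Γ(N, W)) :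
    ∃ r : Γ(X, W), z = r • (resM M h e ⊗ₜ resM N h f) := by
  induction z with
  | zero => exact ⟨0, by simp⟩
  | tmul m n =>
    obtain ⟨a, rfl⟩ := (he W h).2 m
    obtain ⟨b, rfl⟩ := (hf W h).2 n
    exact ⟨a * b, by rw [TensorProduct.smul_tmul_smul]⟩
  | add y z hy hz =>
    obtain ⟨a, ha⟩ := hy
    obtain ⟨b, hb⟩ := hz
    exact ⟨a + b, by rw [add_smul, ← ha, ← hb]⟩

lemma IsFrame.eq_zero_of_smul_tmul {e : Γ(M, U)} {f : Γ(N, U)} (he : IsFrame M e)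
    (hf : IsFrame N f) {W : X.Opens} (h : W ≤ U) {r : Γ(X, W)}
    (hr : r • (resM M h e ⊗ₜ[Γ(X, W)] resM N h f) = 0) : r = 0 := by
  have := congrArg (TensorProduct.lift ((LinearMap.mul Γ(X, W) Γ(X, W)).compl₁₂
    (he.coord h) (hf.coord h))) hr
  simpa [he.coord_frame, hf.coord_frame] using this

lemma IsFrame.tmulSec {e : Γ(M, U)} {f : Γ(N, U)} (he : IsFrame M e) (hf : IsFrame N f) :
    IsFrame (tensorModule M N) (tmulSec e f) := by
  refine isFrame_of_locally (fun W h r hr x hx ↦ ?_) fun W h s x hx ↦ ?_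
  · rw [resM_tmulSec, ToricCY.tmulSec, ← map_smul] at hr
    obtain ⟨V, hV, hxV, hz⟩ := tensorToSheaf_locally_injective _ hr x hx
    refine ⟨V, hV, hxV, he.eq_zero_of_smul_tmul hf (hV.trans h) ?_⟩
    rw [TensorProduct.smul_tmul', tensorRes_tmul, resM_smul, resM_resM, resM_resM] at hz
    rw [TensorProduct.smul_tmul', hz]
  · obtain ⟨V, hV, z, hxV, hz⟩ := tensorToSheaf_locally_surjective s x hx
    obtain ⟨r, rfl⟩ := he.exists_eq_smul_tmul hf (hV.trans h) z
    refine ⟨V, hV, hxV, r, ?_⟩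
    rw [← hz, map_smul, resM_tmulSec]
    rfl

end FrameOperations

section GlobalSections

variable {X : Scheme.{0}} {N : X.Modules} {U : X.Opens}

/-- Multiples of a section `e`, as a linear map `𝒪(W) → N(W)`. -/
def smulSec (e : Γ(N, U)) {W : X.Opens} (h : W ≤ U) :
    Γ(structureModule X, W) →ₗ[Γ(X, W)] Γ(N, W) where
  toFun r := (show Γ(X, W) from r) • resM N h e
  map_add' r s := add_smul (R := Γ(X, W)) r s _
  map_smul' r s := mul_smul (α := Γ(X, W)) r s _

lemma resM_smulSec (e : Γ(N, U)) {V W : X.Opens} (h : V ≤ U) (h' : W ≤ V)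
    (r : Γ(structureModule X, V)) :
    resM N h' (smulSec e h r) = smulSec e (h'.trans h) (resM _ h' r) := by
  change resM N h' ((show Γ(X, V) from r) • resM N h e) = _
  rw [resM_smul, resM_resM]
  rfl

/-- The morphism `𝒪 ⟶ N` given by a global section. -/
def unitHom (a : Γ(N, ⊤)) : structureModule X ⟶ N :=
  homMk (fun _ ↦ smulSec a le_top) fun _ _ h ↦ resM_smulSec a le_top h

lemma unitHom_app (a : Γ(N, ⊤)) (W : X.Opens) (r : Γ(X, W)) :
    (unitHom a).app W r = r • resM N le_top a := rfl

lemma unitHom_app_one (a : Γ(N, ⊤)) (W : X.Opens) :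
    (unitHom a).app W (oneSec W) = resM N le_top a := one_smul Γ(X, W) _

lemma bijective_resM_of_eq (M : X.Modules) {U V : X.Opens} (h : V ≤ U)
    (h' : U = V) : Function.Bijective (resM M h) := by
  subst h'
  have : (resM M h : Γ(M, U) → Γ(M, U)) = id := funext fun a ↦ resM_rfl M h a
  rw [this]
  exact Function.bijective_id

/-- Morphisms into a module extended from `U` are determined freely by the image of a frame
over `U`. -/
lemma IsFrame.bijective_eval {M : X.Modules} {e : Γ(M, U)} (he : IsFrame M e) (P : X.Modules)
    (hP : ∀ A : X.Opens, Function.Bijective (resM P (inf_le_left : A ⊓ U ≤ A))) :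
    Function.Bijective fun ψ : M ⟶ P ↦ ψ.app U e := by
  constructor
  · intro φ ψ h
    dsimp only at h
    refine Scheme.Modules.hom_ext _ _ fun A ↦ ?_
    ext m
    refine (hP A).1 ?_
    change resM P _ (φ.app A m) = resM P _ (ψ.app A m)
    rw [← app_resM, ← app_resM, ← he.coord_smul_frame inf_le_right (resM M inf_le_left m),
      Scheme.Modules.Hom.app_smul, Scheme.Modules.Hom.app_smul, app_resM, app_resM, h]
  · intro p
    choose g hg using fun (A : X.Opens) (m : Γ(M, A)) ↦ (hP A).2
      (he.coord inf_le_right (resM M (inf_le_left : A ⊓ U ≤ A) m) • resM P inf_le_right p)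
    let f (V : X.Opens) : Γ(M, V) →ₗ[Γ(X, V)] Γ(P, V) :=
      { toFun := g V
        map_add' := fun a b ↦ (hP V).1 (by simp only [hg, map_add, add_smul])
        map_smul' := fun r a ↦ (hP V).1 (by
          simp only [hg, resM_smul, map_smul, RingHom.id_apply, smul_eq_mul, mul_smul]) }
    have resM_f (V W : X.Opens) (h : W ≤ V) (m : Γ(M, V)) :
        resM P h (f V m) = f W (resM M h m) := by
      refine (hP W).1 ?_
      change resM P _ (resM P h (g V m)) = resM P _ (g W _)
      rw [hg, resM_resM, ← resM_resM P (inf_le_left : V ⊓ U ≤ V) (inf_le_inf_right U h), hg,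
        resM_smul, he.resO_coord, resM_resM, resM_resM, resM_resM]
    refine ⟨homMk f resM_f, (hP U).1 ?_⟩
    change resM P _ (g U e) = _
    rw [hg, he.coord_frame, one_smul]

lemma bijective_unitHom_eval (N : X.Modules) :
    Function.Bijective fun φ : structureModule X ⟶ N ↦ φ.app ⊤ (oneSec ⊤) :=
  (isFrame_one ⊤).bijective_eval N fun _ ↦ bijective_resM_of_eq N _ (inf_top_eq _).symm

end GlobalSections

section Pullback

variable {X Y : Scheme.{0}} (f : Y ⟶ X) {M : X.Modules} {U : X.Opens}

/-- The pullback of a section. -/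
def pullbackSec (e : Γ(M, U)) : Γ((Scheme.Modules.pullback f).obj M, f ⁻¹ᵁ U) :=
  ((Scheme.Modules.pullbackPushforwardAdjunction f).unit.app M).app U e

lemma resM_pullbackSec {V : X.Opens} (h : V ≤ U) (e : Γ(M, U)) :
    resM ((Scheme.Modules.pullback f).obj M) (f.preimage_mono h) (pullbackSec f e) =
      pullbackSec f (resM M h e) :=
  (app_resM ((Scheme.Modules.pullbackPushforwardAdjunction f).unit.app M) h e).symm

lemma pullbackSec_smul (r : Γ(X, U)) (e : Γ(M, U)) :
    pullbackSec f (r • e) = (f.app U).hom r • pullbackSec f e :=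
  Scheme.Modules.Hom.app_smul ((Scheme.Modules.pullbackPushforwardAdjunction f).unit.app M) r e

lemma pullback_homEquiv_app (P : Y.Modules) (φ : (Scheme.Modules.pullback f).obj M ⟶ P)
    (e : Γ(M, U)) :
    ((Scheme.Modules.pullbackPushforwardAdjunction f).homEquiv M P φ).app U e =
      φ.app (f ⁻¹ᵁ U) (pullbackSec f e) := by
  rw [Adjunction.homEquiv_unit]
  rfl

/-- A section over `U`, viewed as a global section of the restriction to the subscheme `U`. -/
def restrictSec (e : Γ(M, U)) : Γ(M.restrict U.ι, ⊤) := resM M U.ι_image_top.le e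

lemma restrict_homEquiv_app (T : U.toScheme.Modules) (φ : M.restrict U.ι ⟶ T) (e : Γ(M, U)) :
    resM T U.ι_preimage_self.ge
      (((Scheme.Modules.restrictAdjunction U.ι).homEquiv M T φ).app U e) =
      φ.app ⊤ (restrictSec e) := by
  rw [Adjunction.homEquiv_unit]
  change resM T _ (φ.app (U.ι ⁻¹ᵁ U) (resM M (U.ι.image_preimage_le _) e)) = _
  refine (app_resM φ U.ι_preimage_self.ge _).symm.trans (congrArg (φ.app ⊤) ?_)
  exact resM_resM M (U.ι.image_preimage_le _) (U.ι.image_mono U.ι_preimage_self.ge) _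

lemma IsFrame.of_isIso_unitHom {e : Γ(M, U)} (h : IsIso (unitHom (restrictSec e))) :
    IsFrame M e := by
  intro W hW
  obtain ⟨W, rfl⟩ : ∃ W' : U.toScheme.Opens, U.ι ''ᵁ W' = W :=
    ⟨U.ι ⁻¹ᵁ W, by
      rw [Scheme.Hom.image_preimage_eq_opensRange_inf, Scheme.Opens.opensRange_ι]
      exact inf_eq_right.2 hW⟩
  have smul_eq (r : Γ(X, U.ι ''ᵁ W)) : r • resM M hW e =
      (unitHom (restrictSec e)).app W ((U.ι.appIso W).hom r) := by
    rw [unitHom_app]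
    refine Eq.trans ?_ (Scheme.Modules.smul_restrictAppIso_hom_apply U.ι M W
      ((U.ι.appIso W).hom r) (resM (M.restrict U.ι) le_top (restrictSec e))).symm
    change _ = ((U.ι.appIso W).hom ≫ (U.ι.appIso W).inv) r •
      resM M (U.ι.image_mono le_top) (resM M U.ι_image_top.le _)
    rw [Iso.hom_inv_id, resM_resM]
    rfl
  have bijective_app : Function.Bijective ((unitHom (restrictSec e)).app W) :=
    (ConcreteCategory.isIso_iff_bijective _).1 inferInstance
  rw [funext smul_eq]
  exact bijective_app.comp ((ConcreteCategory.isIso_iff_bijective (U.ι.appIso W).hom).1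
    inferInstance)

lemma IsFrame.bijective_eval_pullback {e : Γ(M, U)} (he : IsFrame M e)
    (T : (f ⁻¹ᵁ U).toScheme.Modules) :
    Function.Bijective fun φ : ((Scheme.Modules.pullback f).obj M).restrict (f ⁻¹ᵁ U).ι ⟶ T ↦
      φ.app ⊤ (restrictSec (pullbackSec f e)) := by
  let j := (f ⁻¹ᵁ U).ι
  have extended : ∀ B : X.Opens, Function.Bijective (resM ((Scheme.Modules.pushforward f).obj
      ((Scheme.Modules.pushforward j).obj T)) (inf_le_left : B ⊓ U ≤ B)) := by
    intro B
    refine bijective_resM_of_eq T (U := j ⁻¹ᵁ f ⁻¹ᵁ B) (V := j ⁻¹ᵁ f ⁻¹ᵁ (B ⊓ U))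
      (j.preimage_mono (f.preimage_mono inf_le_left)) ?_
    ext x
    exact ⟨fun h ↦ ⟨h, x.2⟩, fun h ↦ h.1⟩
  have transpose := (((Scheme.Modules.restrictAdjunction j).homEquiv _ T).trans
    ((Scheme.Modules.pullbackPushforwardAdjunction f).homEquiv M _)).bijective
  have res_top := bijective_resM_of_eq T (f ⁻¹ᵁ U).ι_preimage_self.ge (f ⁻¹ᵁ U).ι_preimage_self
  convert (res_top.comp (he.bijective_eval _ extended)).comp transpose using 1
  funext φ
  rw [← restrict_homEquiv_app]
  exact congrArg (resM T _) (pullback_homEquiv_app f _ _ e).symm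

lemma IsFrame.pullbackSec {e : Γ(M, U)} (he : IsFrame M e) :
    IsFrame ((Scheme.Modules.pullback f).obj M) (pullbackSec f e) := by
  refine .of_isIso_unitHom ?_
  rw [isIso_iff_coyoneda_map_bijective]
  intro T
  rw [← (bijective_unitHom_eval T).of_comp_iff']
  convert he.bijective_eval_pullback f T using 1
  funext φ
  change φ.app ⊤ ((unitHom (restrictSec (ToricCY.pullbackSec f e))).app ⊤ (oneSec ⊤)) = _
  rw [unitHom_app_one, resM_rfl]

end Pullback

section Coherent

variable {X : Scheme.{0}} {M : X.Modules}

/-- A frame over `U` as an isomorphism `𝒪_U ≅ M|_U`. -/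
def IsFrame.overIso {U : X.Opens} {e : Γ(M, U)} (he : IsFrame M e) :
    SheafOfModules.unit (X.ringCatSheaf.over U) ≅ SheafOfModules.over (R := X.ringCatSheaf) M U :=
  (SheafOfModules.fullyFaithfulForget _).preimageIso (PresheafOfModules.isoMk
    (fun W ↦ (LinearEquiv.ofBijective (smulSec e W.unop.hom.le)
      (he _ W.unop.hom.le)).toModuleIso)
    (fun W _ i ↦ ModuleCat.hom_ext (LinearMap.ext fun r ↦
      (resM_smulSec e W.unop.hom.le i.unop.left.le r).symm)))

lemma isCoherent_of_frames {ι : Type} (U : ι → X.Opens) (hU : iSup U = ⊤)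
    (e : ∀ i, Γ(M, U i)) (he : ∀ i, IsFrame M (e i)) : IsCoherent M := by
  let φ (i : ι) : SheafOfModules.free PUnit ≅ SheafOfModules.over (R := X.ringCatSheaf) M (U i) :=
    (coproductUniqueIso fun _ : PUnit ↦ SheafOfModules.unit (X.ringCatSheaf.over (U i))) ≪≫
      (he i).overIso
  let q : SheafOfModules.LocalGeneratorsData (R := X.ringCatSheaf) M :=
    { I := ι
      X := U
      coversTop := by
        intro W x hx
        obtain ⟨i, hi⟩ := Opens.mem_iSup.1 (hU.ge (Opens.mem_top x))
        exact ⟨W ⊓ U i, homOfLE inf_le_left, ⟨i, ⟨homOfLE inf_le_right⟩⟩, hx, hi⟩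
      generators := fun i ↦ (SheafOfModules.free.generatingSections PUnit).ofEpi (φ i).hom }
  have hq : q.IsLocallyFreeData := ⟨fun i ↦ by
    have h := SheafOfModules.GeneratingSections.ofEpi_π
      (SheafOfModules.free.generatingSections PUnit) (φ i).hom
    rw [SheafOfModules.free.generatingSections_π] at h
    exact (congrArg IsIso (h.trans (Category.id_comp _))).mpr (Iso.isIso_hom (φ i))⟩
  have shrink_finite : q.shrink.IsFiniteType := ⟨fun i ↦ ⟨inferInstanceAs (Finite PUnit)⟩⟩
  exact ⟨q.quasiCoherentData.isQuasicoherent, ⟨q.shrink, shrink_finite⟩⟩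

end Coherent

/-! ### Charts -/

section Charts

/-- An open cover together with functions `ratio v w` on the `w`-th chart, standing
for the ratios `x_v / x_w` of homogeneous coordinates. -/
structure Charts (X : Scheme.{0}) (ι : Type) where
  U : ι → X.Opens
  cover : iSup U = ⊤
  ratio : ∀ _ w : ι, Γ(X, U w)
  ratio_self : ∀ v, ratio v v = 1
  cocycle : ∀ u v w, resO (inf_le_right : U v ⊓ U w ≤ U w) (ratio u w) =
    resO inf_le_left (ratio u v) * resO inf_le_right (ratio v w)
  basicOpen_ratio : ∀ v w, X.basicOpen (ratio v w) = U v ⊓ U w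

variable {X : Scheme.{0}} {ι : Type} (C : Charts X ι)

namespace Charts

lemma ratio_mul_ratio (v w : ι) : resO (inf_le_right : C.U v ⊓ C.U w ≤ C.U w) (C.ratio v w) *
    resO inf_le_left (C.ratio w v) = 1 := by
  rw [mul_comm, ← C.cocycle w v w, C.ratio_self, map_one]

/-- The transition functions on overlaps. -/
def trans (v w : ι) : Γ(X, C.U v ⊓ C.U w)ˣ where
  val := resO inf_le_right (C.ratio v w)
  inv := resO inf_le_left (C.ratio w v)
  val_inv := C.ratio_mul_ratio v w
  inv_val := by rw [mul_comm, ratio_mul_ratio]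

/-- `M` is isomorphic to `𝒪(d)`, the line bundle with transition functions `(x_v / x_w) ^ d`. -/
def HasWeight (M : X.Modules) (d : ℤ) : Prop :=
  ∃ e : ∀ w, Γ(M, C.U w), (∀ w, IsFrame M (e w)) ∧ ∀ v w,
    resM M (inf_le_left : C.U v ⊓ C.U w ≤ C.U v) (e v) =
      ((C.trans v w ^ d : Γ(X, C.U v ⊓ C.U w)ˣ) : Γ(X, C.U v ⊓ C.U w)) • resM M inf_le_right (e w)

variable {C}

lemma HasWeight.isCoherent {M : X.Modules} {d : ℤ} (h : C.HasWeight M d) : IsCoherent M := by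
  obtain ⟨e, he, -⟩ := h
  exact isCoherent_of_frames C.U C.cover e he

variable (C) in
lemma hasWeight_structureModule : C.HasWeight (structureModule X) 0 :=
  ⟨fun w ↦ oneSec _, fun w ↦ isFrame_one _, fun v w ↦ by
    rw [resM_oneSec, resM_oneSec, zpow_zero, Units.val_one, one_smul]⟩

lemma HasWeight.tensorModule {M N : X.Modules} {c d : ℤ} (hM : C.HasWeight M c)
    (hN : C.HasWeight N d) : C.HasWeight (tensorModule M N) (c + d) := by
  obtain ⟨e, he, he_trans⟩ := hM
  obtain ⟨f, hf, hf_trans⟩ := hN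
  refine ⟨fun w ↦ tmulSec (e w) (f w), fun w ↦ (he w).tmulSec (hf w), fun v w ↦ ?_⟩
  rw [resM_tmulSec, resM_tmulSec, he_trans, hf_trans, smul_tmulSec_smul, zpow_add, Units.val_mul]

lemma HasWeight.dualModule {M : X.Modules} {d : ℤ} (hM : C.HasWeight M d) :
    C.HasWeight (dualModule M) (-d) := by
  obtain ⟨e, he, he_trans⟩ := hM
  refine ⟨fun w ↦ (he w).dual, fun w ↦ (he w).isFrame_dual, fun v w ↦ ?_⟩
  refine dual_ext fun V hV m ↦ ?_
  rw [dualEval_smul, dualEval_resM, dualEval_resM, (he v).dualEval_dual, (he w).dualEval_dual]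
  refine (he v).coord_eq _ ?_
  rw [← resM_resM M inf_le_left hV, he_trans v w, resM_smul, smul_smul, resM_resM, mul_right_comm,
    ← map_mul, ← Units.val_mul, ← zpow_add, neg_add_cancel, zpow_zero, Units.val_one, map_one,
    one_mul, (he w).coord_smul_frame]

lemma HasWeight.tensorNPow {M : X.Modules} {d : ℤ} (hM : C.HasWeight M d) (k : ℕ) :
    C.HasWeight (tensorNPow M k) (k * d) := by
  induction k with
  | zero => simpa using! C.hasWeight_structureModule
  | succ k ih =>
    have := ih.tensorModule hM
    rw [Nat.cast_succ, add_mul, one_mul]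
    exact this

lemma HasWeight.tensorPow {M : X.Modules} {d : ℤ} (hM : C.HasWeight M d) (i : ℤ) :
    C.HasWeight (tensorPow M i) (i * d) := by
  match i with
  | Int.ofNat k => exact hM.tensorNPow k
  | Int.negSucc k =>
    have := hM.dualModule.tensorNPow (k + 1)
    have h : ((k + 1 : ℕ) : ℤ) * -d = Int.negSucc k * d := by
      rw [Int.negSucc_eq]; push_cast; ring
    rw [h] at this
    exact this

lemma resO_app {Y : Scheme.{0}} (f : Y ⟶ X) {U V : X.Opens} (h : V ≤ U) (a : Γ(X, U)) :
    resO (f.preimage_mono h) ((f.app U).hom a) = (f.app V).hom (resO h a) :=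
  (ConcreteCategory.congr_hom (f.naturality (homOfLE h).op) a).symm

variable (C) in
/-- The inverse image of charts. -/
def pullback {Y : Scheme.{0}} (f : Y ⟶ X) : Charts Y ι where
  U w := f ⁻¹ᵁ C.U w
  cover := by
    rw [← Scheme.Hom.preimage_iSup, C.cover]
    rfl
  ratio v w := (f.app (C.U w)).hom (C.ratio v w)
  ratio_self v := by rw [C.ratio_self, map_one]
  cocycle u v w := by
    have := congrArg (f.app (C.U v ⊓ C.U w)).hom (C.cocycle u v w)
    rw [map_mul, ← resO_app, ← resO_app, ← resO_app] at this
    exact this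
  basicOpen_ratio v w := by
    rw [← Scheme.preimage_basicOpen, C.basicOpen_ratio]
    rfl

lemma HasWeight.pullback {Y : Scheme.{0}} (f : Y ⟶ X) {M : X.Modules} {d : ℤ}
    (hM : C.HasWeight M d) : (C.pullback f).HasWeight ((Scheme.Modules.pullback f).obj M) d := by
  obtain ⟨e, he, he_trans⟩ := hM
  refine ⟨fun w ↦ pullbackSec f (e w), fun w ↦ (he w).pullbackSec f, fun v w ↦ ?_⟩
  have := congrArg (pullbackSec f) (he_trans v w)
  rw [pullbackSec_smul, ← resM_pullbackSec, ← resM_pullbackSec] at this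
  refine this.trans ?_
  congr 1
  let G : Γ(X, C.U v ⊓ C.U w) →+* Γ(Y, (C.pullback f).U v ⊓ (C.pullback f).U w) :=
    (f.app (C.U v ⊓ C.U w)).hom
  have h : (C.pullback f).trans v w = Units.map (G : _ →* _) (C.trans v w) :=
    Units.ext (resO_app f (inf_le_right : C.U v ⊓ C.U w ≤ C.U w) (C.ratio v w))
  rw [h, ← map_zpow]
  rfl

end Charts

end Charts

section Extension

variable {Y : Scheme.{0}}

/-- Sections of `Z` over basic opens of affine opens are obtained by localization. -/
structure LocalizesSections (Z : Y.Modules) : Prop where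
  exists_extend : ∀ (U : Y.Opens), IsAffineOpen U → ∀ (g : Γ(Y, U)) (D : Y.Opens) (hD : D ≤ U),
    D = Y.basicOpen g → ∀ s : Γ(Z, D), ∃ (m : ℕ) (t : Γ(Z, U)), resM Z hD t = resO hD g ^ m • s
  exists_kill : ∀ (U : Y.Opens), IsAffineOpen U → ∀ (g : Γ(Y, U)) (D : Y.Opens) (hD : D ≤ U),
    D = Y.basicOpen g → ∀ t : Γ(Z, U), resM Z hD t = 0 → ∃ m : ℕ, g ^ m • t = 0

lemma LocalizesSections.of_kernel {Z A B : Y.Modules} (i : Z ⟶ A) (d : A ⟶ B)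
    (hA : LocalizesSections A) (hB : LocalizesSections B)
    (hi : ∀ U, Function.Injective (i.app U)) (hid : i ≫ d = 0)
    (hker : ∀ (U : Y.Opens) (a : Γ(A, U)), d.app U a = 0 → ∃ z, i.app U z = a) :
    LocalizesSections Z where
  exists_extend U hU g D hD hDg s := by
    obtain ⟨m, t, ht⟩ := hA.exists_extend U hU g D hD hDg (i.app D s)
    have d_i : d.app D (i.app D s) = 0 := congrArg (fun φ ↦ Scheme.Modules.Hom.app φ D s) hid
    obtain ⟨m', hm'⟩ := hB.exists_kill U hU g D hD hDg (d.app U t) (by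
      rw [← app_resM, ht, Scheme.Modules.Hom.app_smul, d_i, smul_zero])
    rw [← Scheme.Modules.Hom.app_smul] at hm'
    obtain ⟨z, hz⟩ := hker U _ hm'
    refine ⟨m' + m, z, hi D ?_⟩
    rw [app_resM, hz, resM_smul, ht, map_pow, Scheme.Modules.Hom.app_smul, smul_smul, pow_add]
  exists_kill U hU g D hD hDg t ht := by
    obtain ⟨m, hm⟩ := hA.exists_kill U hU g D hD hDg (i.app U t) (by
      rw [← app_resM, ht, map_zero])
    refine ⟨m, hi U ?_⟩
    rw [Scheme.Modules.Hom.app_smul, hm, map_zero]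

namespace Charts

variable {ι : Type} (C : Charts Y ι) {Z : Y.Modules}

/-- A family of sections `t w` of `Z` that defines a section of `Z(k)`. -/
def IsTwisted (k : ℕ) (t : ∀ w, Γ(Z, C.U w)) : Prop :=
  ∀ u w, resM Z (inf_le_right : C.U u ⊓ C.U w ≤ C.U w) (t w) =
    resO (inf_le_right : C.U u ⊓ C.U w ≤ C.U w) (C.ratio u w) ^ k •
      resM Z (inf_le_left : C.U u ⊓ C.U w ≤ C.U u) (t u)

variable {C}

lemma IsTwisted.resM_eq {k : ℕ} {t : ∀ w, Γ(Z, C.U w)} (ht : C.IsTwisted k t) {u w : ι}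
    {W : Y.Opens} (hu : W ≤ C.U u) (hw : W ≤ C.U w) :
    resM Z hw (t w) = resO hw (C.ratio u w) ^ k • resM Z hu (t u) := by
  simpa only [resM_smul, resM_resM, map_pow, resO_resO] using
    congrArg (resM Z (le_inf hu hw)) (ht u w)

lemma HasWeight.exists_isTwisted {M : Y.Modules} {k : ℕ} (hM : C.HasWeight M (-k)) :
    ∃ e : ∀ w, Γ(M, C.U w), (∀ w, IsFrame M (e w)) ∧ C.IsTwisted k e := by
  obtain ⟨e, he, he_trans⟩ := hM
  refine ⟨e, he, fun u w ↦ ?_⟩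
  change _ = ((C.trans u w : Γ(Y, C.U u ⊓ C.U w)ˣ) : Γ(Y, C.U u ⊓ C.U w)) ^ k • _
  rw [he_trans, smul_smul, ← Units.val_pow_eq_pow_val, ← Units.val_mul, ← zpow_natCast, ← zpow_add,
    add_neg_cancel, zpow_zero, Units.val_one, one_smul]

lemma HasWeight.exists_hom {M : Y.Modules} {k : ℕ} (hM : C.HasWeight M (-k))
    (t : ∀ w, Γ(Z, C.U w)) (ht : C.IsTwisted k t) :
    ∃ φ : M ⟶ Z, ∀ w, ∃ e, φ.app (C.U w) e = t w := by
  obtain ⟨e, he, he_twisted⟩ := hM.exists_isTwisted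
  have coord_eq {u w : ι} {W : Y.Opens} (hu : W ≤ C.U u) (hw : W ≤ C.U w) (m : Γ(M, W)) :
      (he u).coord hu m = (he w).coord hw m * resO hw (C.ratio u w) ^ k := by
    refine (he u).coord_eq hu ?_
    rw [mul_smul, ← he_twisted.resM_eq hu hw, (he w).coord_smul_frame]
  obtain ⟨φ, hφ⟩ := exists_glue_hom (M := M) (N := Z) C.U C.cover
    (fun w W hW ↦ ((he w).coord hW).smulRight (resM Z hW (t w)))
    (fun w W V hW h m ↦ by
      rw [LinearMap.smulRight_apply, LinearMap.smulRight_apply, resM_smul, resM_resM,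
        (he w).resO_coord])
    (fun u w W hu hw m ↦ by
      rw [LinearMap.smulRight_apply, LinearMap.smulRight_apply, ht.resM_eq hu hw, smul_smul,
        coord_eq hu hw])
  refine ⟨φ, fun w ↦ ⟨resM M le_rfl (e w), ?_⟩⟩
  rw [hφ w _ le_rfl, LinearMap.smulRight_apply, (he w).coord_frame, one_smul, resM_rfl]

variable (C) [Finite ι] (hC : ∀ w, IsAffineOpen (C.U w)) (hZ : LocalizesSections Z)

include hC hZ in
lemma exists_ratio_pow_smul_extend (v : ι) (s : Γ(Z, C.U v)) :
    ∃ (m : ℕ) (T : ∀ w, Γ(Z, C.U w)), ∀ w,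
      resM Z (inf_le_right : C.U v ⊓ C.U w ≤ C.U w) (T w) =
        resO (inf_le_right : C.U v ⊓ C.U w ≤ C.U w) (C.ratio v w) ^ m •
          resM Z (inf_le_left : C.U v ⊓ C.U w ≤ C.U v) s := by
  choose m t ht using fun w ↦ hZ.exists_extend (C.U w) (hC w) (C.ratio v w) (C.U v ⊓ C.U w)
    inf_le_right (C.basicOpen_ratio v w).symm (resM Z inf_le_left s)
  obtain ⟨m₀, hm₀⟩ := (Set.finite_range m).bddAbove
  refine ⟨m₀, fun w ↦ C.ratio v w ^ (m₀ - m w) • t w, fun w ↦ ?_⟩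
  rw [resM_smul, ht, smul_smul, map_pow, ← pow_add, Nat.sub_add_cancel (hm₀ ⟨w, rfl⟩)]

include hC hZ in
lemma exists_ratio_pow_smul_eq_zero (v : ι) (δ : ∀ u w, Γ(Z, C.U u ⊓ C.U w))
    (hδ : ∀ u w, resM Z (inf_le_right : C.U v ⊓ (C.U u ⊓ C.U w) ≤ _) (δ u w) = 0) :
    ∃ k₀ : ℕ, ∀ k ≥ k₀, ∀ u w,
      resO (inf_le_right : C.U u ⊓ C.U w ≤ C.U w) (C.ratio v w) ^ k • δ u w = 0 := by
  have affine_inf (u w : ι) : IsAffineOpen (C.U u ⊓ C.U w) := by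
    rw [← C.basicOpen_ratio u w]
    exact (hC w).basicOpen _
  have basicOpen_eq (u w : ι) : C.U v ⊓ (C.U u ⊓ C.U w) =
      Y.basicOpen (resO (inf_le_right : C.U u ⊓ C.U w ≤ C.U w) (C.ratio v w)) := by
    refine Eq.trans ?_ (Y.basicOpen_res _ _).symm
    rw [C.basicOpen_ratio]
    exact le_antisymm (le_inf inf_le_right (inf_le_inf_left _ inf_le_right))
      (le_inf (inf_le_right.trans inf_le_left) inf_le_left)
  choose m hm using fun p : ι × ι ↦ hZ.exists_kill _ (affine_inf p.1 p.2) _ _ inf_le_right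
    (basicOpen_eq p.1 p.2) _ (hδ p.1 p.2)
  obtain ⟨k₀, hk₀⟩ := (Set.finite_range m).bddAbove
  refine ⟨k₀, fun k hk u w ↦ ?_⟩
  rw [← Nat.sub_add_cancel ((hk₀ ⟨(u, w), rfl⟩).trans hk), pow_add, mul_smul, hm (u, w), smul_zero]

include hC hZ in
lemma exists_isTwisted (v : ι) (s : Γ(Z, C.U v)) :
    ∃ k₀ : ℕ, ∀ k ≥ k₀, ∃ t : ∀ w, Γ(Z, C.U w), t v = s ∧ C.IsTwisted k t := by
  obtain ⟨m, T, hT⟩ := C.exists_ratio_pow_smul_extend hC hZ v s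
  have hT' {w : ι} {W : Y.Opens} (hv : W ≤ C.U v) (hw : W ≤ C.U w) :
      resM Z hw (T w) = resO hw (C.ratio v w) ^ m • resM Z hv s := by
    simpa only [resM_smul, resM_resM, map_pow, resO_resO] using
      congrArg (resM Z (le_inf hv hw)) (hT w)
  obtain ⟨k₀, hk₀⟩ := C.exists_ratio_pow_smul_eq_zero hC hZ v
    (fun u w ↦ resM Z inf_le_right (T w) -
      resO (inf_le_right : C.U u ⊓ C.U w ≤ C.U w) (C.ratio u w) ^ m •
        resM Z (inf_le_left : C.U u ⊓ C.U w ≤ C.U u) (T u)) fun u w ↦ by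
    have cocycle := congrArg (resO (inf_le_right : C.U v ⊓ (C.U u ⊓ C.U w) ≤ _)) (C.cocycle v u w)
    simp only [resO_resO, map_mul] at cocycle
    simp only [map_sub, resM_smul, resM_resM, map_pow, resO_resO]
    rw [hT' inf_le_left, hT' inf_le_left, cocycle, smul_smul, ← mul_pow, mul_comm, sub_self]
  refine ⟨m + k₀, fun k hk ↦ ⟨fun w ↦ C.ratio v w ^ (k - m) • T w, ?_, fun u w ↦ ?_⟩⟩
  · have := hT' (w := v) le_rfl le_rfl
    simpa only [C.ratio_self, map_one, one_pow, one_smul, resM_rfl] using this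
  · have defect := hk₀ (k - m) (Nat.le_sub_of_add_le' hk) u w
    rw [smul_sub, sub_eq_zero] at defect
    rw [resM_smul, resM_smul, map_pow, map_pow, defect, smul_smul, smul_smul, C.cocycle v u w,
      mul_pow, mul_assoc, ← pow_add, Nat.sub_add_cancel (Nat.le_of_add_right_le hk), mul_comm]

omit [Finite ι] in
include hC hZ in
lemma exists_app_chart_ne_zero {H : Y.Modules} {q : Z ⟶ H} (hq : q ≠ 0) :
    ∃ (v : ι) (s : Γ(Z, C.U v)), q.app (C.U v) s ≠ 0 := by
  obtain ⟨W, s, hs⟩ : ∃ (W : Y.Opens) (s : Γ(Z, W)), q.app W s ≠ 0 := by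
    by_contra! h
    exact hq (Scheme.Modules.hom_ext _ _ fun W ↦ by ext s; exact h W s)
  have basis (x : W) : ∃ (v : ι) (g : Γ(Y, C.U v)),
      Y.basicOpen g ≤ W ∧ x.1 ∈ Y.basicOpen g := by
    obtain ⟨v, hv⟩ := Opens.mem_iSup.1 (C.cover.ge (Opens.mem_top x.1))
    exact ⟨v, (hC v).exists_basicOpen_le x hv⟩
  choose v g hgW hxg using basis
  obtain ⟨x, hx⟩ : ∃ x, resM H (hgW x) (q.app W s) ≠ 0 := by
    by_contra! h
    refine hs (section_ext H (fun x ↦ Y.basicOpen (g x)) hgW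
      (fun x hx ↦ Opens.mem_iSup.2 ⟨⟨x, hx⟩, hxg ⟨x, hx⟩⟩) fun x ↦ ?_)
    rw [h x, map_zero]
  obtain ⟨m, t, ht⟩ := hZ.exists_extend (C.U (v x)) (hC _) (g x) _ (Y.basicOpen_le _) rfl
    (resM Z (hgW x) s)
  refine ⟨v x, t, fun hzero ↦ hx ?_⟩
  have smul_eq_zero := congrArg (resM H (Y.basicOpen_le (g x))) hzero
  rw [← app_resM, ht, Scheme.Modules.Hom.app_smul, map_zero, app_resM] at smul_eq_zero
  have unit : IsUnit (resO (Y.basicOpen_le (g x)) (g x) ^ m) :=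
    (RingedSpace.isUnit_res_basicOpen Y.toRingedSpace (g x)).pow m
  exact unit.smul_eq_zero.1 smul_eq_zero

include hC hZ in
lemma exists_comp_ne_zero {H : Y.Modules} {q : Z ⟶ H} (hq : q ≠ 0) :
    ∃ k₀ : ℕ, ∀ k ≥ k₀, ∀ M : Y.Modules, C.HasWeight M (-k) → ∃ φ : M ⟶ Z, φ ≫ q ≠ 0 := by
  obtain ⟨v, s, hs⟩ := C.exists_app_chart_ne_zero hC hZ hq
  obtain ⟨k₀, hk₀⟩ := C.exists_isTwisted hC hZ v s
  refine ⟨k₀, fun k hk M hM ↦ ?_⟩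
  obtain ⟨t, rfl, ht⟩ := hk₀ k hk
  obtain ⟨φ, hφ⟩ := hM.exists_hom t ht
  obtain ⟨e, he⟩ := hφ v
  refine ⟨φ, fun hzero ↦ hs ?_⟩
  rw [← he]
  exact congrArg (fun ψ ↦ Scheme.Modules.Hom.app ψ _ e) hzero

end Charts

end Extension

/-! ### Quasi-coherent sheaves and the derived category -/

section Quasicoherent

variable {Y : Scheme.{0}}

lemma fromSpec_appIso_inv {U : Y.Opens} (hU : IsAffineOpen U) (V : (Spec Γ(Y, U)).Opens)
    (hV : hU.fromSpec ''ᵁ V ≤ U) (r : Γ(Y, U)) :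
    (hU.fromSpec.appIso V).inv ((Spec Γ(Y, U)).presheaf.map (homOfLE le_top : V ⟶ ⊤).op
      ((Scheme.ΓSpecIso Γ(Y, U)).inv r)) = resO hV r := by
  have map_comp_appIso : (Scheme.ΓSpecIso Γ(Y, U)).inv ≫
      (Spec Γ(Y, U)).presheaf.map (homOfLE le_top : V ⟶ ⊤).op =
      Y.presheaf.map (homOfLE hV).op ≫ (hU.fromSpec.appIso V).hom := by
    rw [Scheme.Hom.appIso_hom', Scheme.Hom.map_appLE, Scheme.Hom.appLE, hU.fromSpec_app_self,
      Category.assoc, ← Functor.map_comp]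
    rfl
  exact ConcreteCategory.congr_hom ((Iso.comp_inv_eq _).2 map_comp_appIso) r

lemma restrict_fromSpec_smul (M : Y.Modules) {U : Y.Opens} (hU : IsAffineOpen U)
    (V : (Spec Γ(Y, U)).Opens) (hV : hU.fromSpec ''ᵁ V ≤ U) (r : Γ(Y, U))
    (x : Γ(M.restrict hU.fromSpec, V)) :
    (M.restrictAppIso hU.fromSpec V).hom (r • x) =
      resO hV r • (M.restrictAppIso hU.fromSpec V).hom x := by
  refine (Scheme.Modules.smul_restrictAppIso_hom_apply hU.fromSpec M V
    ((Spec Γ(Y, U)).presheaf.map (homOfLE le_top : V ⟶ ⊤).op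
      ((Scheme.ΓSpecIso Γ(Y, U)).inv r)) x).trans ?_
  rw [← fromSpec_appIso_inv hU V hV r]

section IsQuasicoherent

variable (M : Y.Modules) [SheafOfModules.IsQuasicoherent M] {U : Y.Opens} (hU : IsAffineOpen U)
  (g : Γ(Y, U))

lemma isLocalizedModule_restrict_fromSpec :
    IsLocalizedModule (.powers g) ((modulesSpecToSheaf.obj (M.restrict hU.fromSpec)).obj.map
      (PrimeSpectrum.basicOpen g).leTop.op).hom :=
  have : SheafOfModules.IsQuasicoherent (M.restrict hU.fromSpec) :=
    Scheme.Modules.isQuasicoherent_restrictFunctor hU.fromSpec M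
  (isIso_fromTildeΓ_iff_isLocalizing (M.restrict hU.fromSpec)).1
    (Scheme.Modules.isIso_fromTildeΓ_of_isQuasicoherent _) g

lemma exists_resM_image_eq_pow_smul {V : (Spec Γ(Y, U)).Opens}
    (hV : V = PrimeSpectrum.basicOpen g) (hVU : hU.fromSpec ''ᵁ V ≤ U)
    (s : Γ(M, hU.fromSpec ''ᵁ V)) :
    ∃ (m : ℕ) (t : Γ(M, hU.fromSpec ''ᵁ ⊤)),
      resM M (hU.fromSpec.image_mono le_top) t = resO hVU (g ^ m) • s := by
  subst hV
  obtain ⟨⟨t, _, m, rfl⟩, ht⟩ := (isLocalizedModule_restrict_fromSpec M hU g).surj s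
  exact ⟨m, t, ht.symm.trans (restrict_fromSpec_smul M hU _ hVU (g ^ m) s)⟩

lemma exists_pow_smul_eq_zero_of_resM_image {V : (Spec Γ(Y, U)).Opens}
    (hV : V = PrimeSpectrum.basicOpen g) (htop : hU.fromSpec ''ᵁ ⊤ ≤ U)
    (t : Γ(M, hU.fromSpec ''ᵁ ⊤)) (ht : resM M (hU.fromSpec.image_mono (le_top : V ≤ ⊤)) t = 0) :
    ∃ m : ℕ, resO htop (g ^ m) • t = 0 := by
  subst hV
  obtain ⟨⟨_, m, rfl⟩, hm⟩ := (isLocalizedModule_restrict_fromSpec M hU g).exists_of_eq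
    (x₁ := t) (x₂ := 0) (by rw [map_zero]; exact ht)
  exact ⟨m, (restrict_fromSpec_smul M hU ⊤ htop (g ^ m) t).symm.trans (hm.trans (smul_zero _))⟩

lemma localizesSections_of_isQuasicoherent : LocalizesSections M := by
  have eq_image_top {U : Y.Opens} (hU : IsAffineOpen U) : U = hU.fromSpec ''ᵁ ⊤ := by
    rw [Scheme.Hom.image_top_eq_opensRange, hU.opensRange_fromSpec]
  have exists_eq_image {U : Y.Opens} (hU : IsAffineOpen U) (g : Γ(Y, U)) :
      ∃ V : (Spec Γ(Y, U)).Opens, V = PrimeSpectrum.basicOpen g ∧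
        Y.basicOpen g = hU.fromSpec ''ᵁ V :=
    ⟨_, rfl, (hU.fromSpec_image_basicOpen g).symm⟩
  constructor
  · intro U hU g D hD hDg s
    obtain ⟨V, hV, hgV⟩ := exists_eq_image hU g
    have hDV := hDg.trans hgV
    obtain ⟨m, t, ht⟩ :=
      exists_resM_image_eq_pow_smul M hU g hV (hDV.ge.trans hD) (resM M hDV.ge s)
    refine ⟨m, resM M (eq_image_top hU).le t, (bijective_resM_of_eq M hDV.ge hDV).1 ?_⟩
    rw [resM_smul, resM_resM, resM_resM, ht, map_pow, map_pow, resO_resO]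
  · intro U hU g D hD hDg t ht
    obtain ⟨V, hV, hgV⟩ := exists_eq_image hU g
    obtain ⟨m, hm⟩ := exists_pow_smul_eq_zero_of_resM_image M hU g hV (eq_image_top hU).ge
      (resM M (eq_image_top hU).ge t) (by
        rw [resM_resM, ← resM_resM M hD (hDg.trans hgV).ge, ht, map_zero])
    refine ⟨m, (bijective_resM_of_eq M (eq_image_top hU).ge (eq_image_top hU)).1 ?_⟩
    rw [map_zero, resM_smul, hm]

end IsQuasicoherent

/-- The functor of sections over `U`, with values in abelian groups. -/
def sectionsFunctor (U : Y.Opens) : Y.Modules ⥤ Ab :=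
  Scheme.Modules.toPresheaf Y ⋙ (evaluation _ _).obj (.op U)

instance (U : Y.Opens) : PreservesLimits (sectionsFunctor U) :=
  have : PreservesLimits ((evaluation (Opens Y)ᵒᵖ Ab.{0}).obj (.op U)) :=
    evaluationPreservesLimits _
  comp_preservesLimits _ _

instance (U : Y.Opens) : (sectionsFunctor U).PreservesZeroMorphisms where
  map_zero _ _ := rfl

lemma injective_app_of_mono {Z A : Y.Modules} (i : Z ⟶ A) [Mono i] (U : Y.Opens) :
    Function.Injective (i.app U) :=
  (AddCommGrpCat.mono_iff_injective _).1 (inferInstanceAs (Mono ((sectionsFunctor U).map i)))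

lemma exists_app_eq_of_isKernel {Z A B : Y.Modules} {i : Z ⟶ A} {d : A ⟶ B} (w : i ≫ d = 0)
    (h : IsLimit (KernelFork.ofι i w)) {U : Y.Opens} {a : Γ(A, U)} (ha : d.app U a = 0) :
    ∃ z, i.app U z = a := by
  have hS := ShortComplex.exact_of_f_is_kernel (ShortComplex.mk i d w) h
  have : Mono i := mono_of_isLimit_fork h
  have := hS.map_of_mono_of_preservesKernel (sectionsFunctor U) this inferInstance
  exact ((ShortComplex.ab_exact_iff _).1 this) a ha

lemma localizesSections_cycles (K : CochainComplex Y.Modules ℤ)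
    [∀ i, SheafOfModules.IsQuasicoherent (K.X i)] (i : ℤ) :
    LocalizesSections (K.cycles i) :=
  .of_kernel (K.iCycles i) (K.d i (i + 1)) (localizesSections_of_isQuasicoherent _)
    (localizesSections_of_isQuasicoherent _) (injective_app_of_mono _) (K.iCycles_d _ _)
    fun _ _ ha ↦ exists_app_eq_of_isKernel (K.iCycles_d _ _)
      (K.cyclesIsKernel i (i + 1) (by simp)) ha

end Quasicoherent

section Derived

lemma isZero_localization_obj {C D : Type*} [Category* C] [Category* D] (L : C ⥤ D)
    (W : MorphismProperty C) [L.IsLocalization W] {z : C} (hz : IsZero z) : IsZero (L.obj z) := by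
  let lift : Localization.Lifting L W ((Functor.const C).obj (L.obj z))
    ((Functor.const D).obj (L.obj z)) := ⟨Iso.refl _⟩
  let η : 𝟭 D ⟶ (Functor.const D).obj (L.obj z) := Localization.liftNatTrans L W L
    ((Functor.const C).obj (L.obj z)) _ _
    { app := fun X ↦ L.map (hz.from_ X)
      naturality := fun X Y f ↦ by
        dsimp
        rw [← L.map_comp, Category.comp_id, hz.eq_of_tgt (f ≫ hz.from_ Y) (hz.from_ X)] }
  let θ : (Functor.const D).obj (L.obj z) ⟶ 𝟭 D := Localization.liftNatTrans L W
    ((Functor.const C).obj (L.obj z)) L _ _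
    { app := fun X ↦ L.map (hz.to_ X)
      naturality := fun X Y f ↦ by
        dsimp
        rw [← L.map_comp, Category.id_comp, hz.eq_of_src (hz.to_ X ≫ f) (hz.to_ Y)] }
  have hη : η.app (L.obj z) = 𝟙 _ := by
    simp [η, lift, hz.eq_of_src (hz.from_ z) (𝟙 z), Localization.Lifting.iso]
  have hθ : θ.app (L.obj z) = 𝟙 _ := by
    simp [θ, lift, hz.eq_of_src (hz.to_ z) (𝟙 z), Localization.Lifting.iso]
  refine ⟨fun X ↦ ⟨⟨⟨θ.app X⟩, fun g ↦ ?_⟩⟩, fun X ↦ ⟨⟨⟨η.app X⟩, fun g ↦ ?_⟩⟩⟩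
  · have := θ.naturality g
    rw [hθ] at this
    simpa using! this.symm
  · have := η.naturality g
    rw [hη] at this
    simpa using! this

variable {Y : Scheme.{0}}

lemma isZero_Q_obj (K : BoundedComplexes Y) (hK : ∀ i, IsZero (K.obj.homology i)) :
    IsZero ((quasiIsos Y).Q.obj K) := by
  obtain ⟨T, hT⟩ : ∃ T : CochainComplex Y.Modules ℤ, IsZero T := HasZeroObject.zero
  let Z : BoundedComplexes Y := ⟨T, fun i ↦ isCoherent_zero
    ((HomologicalComplex.eval Y.Modules (ComplexShape.up ℤ) i).map_isZero hT), 0, 0, fun i _ ↦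
      (HomologicalComplex.eval Y.Modules (ComplexShape.up ℤ) i).map_isZero hT⟩
  have hZ : IsZero Z := IsZero.of_full_of_faithful_of_isZero (isBoundedCoherent Y).ι Z hT
  have quasiIso_to_zero : quasiIsos Y (hZ.from_ K) := by
    change QuasiIso (hZ.from_ K).hom
    refine ⟨fun i ↦ ?_⟩
    rw [quasiIsoAt_iff_isIso_homologyMap]
    exact ⟨0, (hK i).eq_of_src _ _, IsZero.eq_of_src ((HomologicalComplex.homologyFunctor
      Y.Modules (ComplexShape.up ℤ) i).map_isZero hT) _ _⟩
  have := Localization.inverts (quasiIsos Y).Q (quasiIsos Y) _ quasiIso_to_zero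
  exact (isZero_localization_obj (quasiIsos Y).Q (quasiIsos Y) hZ).of_iso
    (asIso ((quasiIsos Y).Q.map (hZ.from_ K)))

lemma homologyMap_eq_of_Q_map_eq {E K : BoundedComplexes Y} {α β : E ⟶ K}
    (h : (quasiIsos Y).Q.map α = (quasiIsos Y).Q.map β) (r : ℤ) :
    HomologicalComplex.homologyMap α.hom r = HomologicalComplex.homologyMap β.hom r := by
  let H : BoundedComplexes Y ⥤ Y.Modules :=
    (isBoundedCoherent Y).ι ⋙ HomologicalComplex.homologyFunctor _ _ r
  have hH : (quasiIsos Y).IsInvertedBy H := fun A B f (_ : QuasiIso f.hom) ↦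
    inferInstanceAs (IsIso (HomologicalComplex.homologyMap f.hom r))
  refine (NatIso.naturality_1 (Localization.fac H hH (quasiIsos Y).Q) α).symm.trans
    (Eq.trans ?_ (NatIso.naturality_1 (Localization.fac H hH (quasiIsos Y).Q) β))
  rw [Functor.comp_map, h, Functor.comp_map]

lemma comp_homologyπ_eq_zero {A : Y.Modules} {L : CochainComplex Y.Modules ℤ}
    (φ : A ⟶ L.cycles 0)
    (α : (HomologicalComplex.single Y.Modules (ComplexShape.up ℤ) 0).obj A ⟶ L)
    (hα : α.f 0 = (HomologicalComplex.singleObjXSelf (ComplexShape.up ℤ) 0 A).hom ≫ φ ≫ L.iCycles 0)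
    (h : HomologicalComplex.homologyMap α 0 = 0) : φ ≫ L.homologyπ 0 = 0 := by
  have cyclesMap_eq : HomologicalComplex.cyclesMap α 0 =
      (HomologicalComplex.singleObjCyclesSelfIso (ComplexShape.up ℤ) 0 A).hom ≫ φ := by
    rw [← cancel_mono (L.iCycles 0), HomologicalComplex.cyclesMap_i, Category.assoc,
      HomologicalComplex.singleObjCyclesSelfIso_hom, Category.assoc, hα]
  have naturality := HomologicalComplex.homologyπ_naturality α 0
  rw [h, comp_zero, cyclesMap_eq, Category.assoc] at naturality
  exact (cancel_epi (HomologicalComplex.singleObjCyclesSelfIso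
    (ComplexShape.up ℤ) 0 A).hom).1 (naturality.symm.trans comp_zero.symm)

lemma nontrivial_hom_sheafObj {A : Y.Modules} (hA : IsCoherent A) {L : BoundedComplexes Y}
    (φ : A ⟶ L.obj.cycles 0) (hφ : φ ≫ L.obj.homologyπ 0 ≠ 0) :
    Nontrivial (sheafObj A hA ⟶ (quasiIsos Y).Q.obj L) := by
  let α : (HomologicalComplex.single Y.Modules (ComplexShape.up ℤ) 0).obj A ⟶ L.obj :=
    HomologicalComplex.mkHomFromSingle (φ ≫ L.obj.iCycles 0) (fun j _ ↦ by
      rw [Category.assoc, HomologicalComplex.iCycles_d, comp_zero])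
  refine ⟨⟨(quasiIsos Y).Q.map (ObjectProperty.homMk α : sheafComplex A hA ⟶ L),
    (quasiIsos Y).Q.map (ObjectProperty.homMk 0), fun hQ ↦ hφ ?_⟩⟩
  exact comp_homologyπ_eq_zero φ α (HomologicalComplex.mkHomFromSingle_f _ _)
    ((homologyMap_eq_of_Q_map_eq hQ 0).trans (HomologicalComplex.homologyMap_zero _ _ _))

lemma exists_shift_homology_not_isZero (F : DbCoh Y) (hF : ¬ IsZero F) :
    ∃ (L : BoundedComplexes Y) (r : ℤ),
      ¬ IsZero (L.obj.homology 0) ∧ Nonempty ((quasiIsos Y).Q.obj L ≅ F⟦r⟧) := by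
  obtain ⟨K, ⟨e⟩⟩ := (Localization.essSurj (quasiIsos Y).Q (quasiIsos Y)).mem_essImage F
  obtain ⟨r, hr⟩ : ∃ r, ¬ IsZero (K.obj.homology r) := by
    by_contra! h
    exact hF ((isZero_Q_obj K h).of_iso e.symm)
  let homologyIso : K.obj.homology r ≅ (K⟦r⟧ : BoundedComplexes Y).obj.homology 0 :=
    ((CochainComplex.ShiftSequence.shiftIso Y.Modules r 0 r (by simp)).app K.obj).symm ≪≫
      HomologicalComplex.homologyMapIso (((isBoundedCoherent Y).ι.commShiftIso r).app K).symm 0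
  exact ⟨K⟦r⟧, r, fun h ↦ hr (h.of_iso homologyIso),
    ⟨((quasiIsos Y).Q.commShiftIso r).app K ≪≫ (shiftFunctor _ r).mapIso e⟩⟩

lemma exists_nontrivial_dbExt {M : ℕ → Y.Modules} (hM : ∀ k, IsCoherent (M k))
    (h : ∀ (Z H : Y.Modules) (q : Z ⟶ H), LocalizesSections Z → q ≠ 0 →
      ∃ k₀ : ℕ, ∀ k ≥ k₀, ∃ φ : M k ⟶ Z, φ ≫ q ≠ 0) (F : DbCoh Y) (hF : ¬ IsZero F) :
    ∃ (k₀ : ℕ) (r : ℤ), ∀ k ≥ k₀, Nontrivial (DbExt r (sheafObj (M k) (hM k)) F) := by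
  obtain ⟨L, r, hL, ⟨i⟩⟩ := exists_shift_homology_not_isZero F hF
  have (j : ℤ) : SheafOfModules.IsQuasicoherent (L.obj.X j) := (L.property.1 j).1
  have homologyπ_ne_zero : L.obj.homologyπ 0 ≠ 0 := fun h₀ ↦ hL ((IsZero.iff_id_eq_zero _).2 (by
    rw [← cancel_epi (L.obj.homologyπ 0), h₀, zero_comp, zero_comp]))
  obtain ⟨k₀, hk₀⟩ := h _ _ _ (localizesSections_cycles L.obj 0) homologyπ_ne_zero
  refine ⟨k₀, r, fun k hk ↦ ?_⟩
  obtain ⟨φ, hφ⟩ := hk₀ k hk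
  have := nontrivial_hom_sheafObj (hM k) φ hφ
  exact i.homToEquiv.symm.nontrivial

end Derived

/-! ### Lattice polytopes -/

section ConvexGeometry

open scoped Pointwise

lemma exists_mem_smul_sub_le_of_mem_convexHull {E : Type*} [AddCommGroup E] [Module ℝ E]
    {T : Set E} (hT : T.Finite) {x : E} (hx : x ∈ convexHull ℝ T) :
    ∃ v ∈ T, ∃ c > 0, ∀ (f : E →ₗ[ℝ] ℝ) (b : ℝ), (∀ s ∈ T, b ≤ f s) → c * (f v - b) ≤ f x - b := by
  lift T to Finset E using hT
  obtain ⟨c, hc₀, hc₁, hx⟩ := Finset.mem_convexHull'.1 hx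
  obtain ⟨v, hv, hcv⟩ : ∃ v ∈ T, 0 < c v := by
    by_contra! nonpos
    linarith [Finset.sum_nonpos nonpos]
  refine ⟨v, hv, c v, hcv, fun f b hb ↦ ?_⟩
  have sub_eq_sum : f x - b = ∑ s ∈ T, c s * (f s - b) := by
    simp only [← hx, map_sum, map_smul, smul_eq_mul, mul_sub, Finset.sum_sub_distrib,
      ← Finset.sum_mul, hc₁, one_mul]
  rw [sub_eq_sum]
  exact Finset.single_le_sum (f := fun s ↦ c s * (f s - b))
    (fun s hs ↦ mul_nonneg (hc₀ s hs) (sub_nonneg.2 (hb s hs))) hv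

section DotProduct

variable {ι K : Type*} [Fintype ι]

lemma dotProduct_eq_zero_of_mem_span [CommSemiring K] {B : Set (ι → K)} {x z : ι → K}
    (hB : ∀ b ∈ B, b ⬝ᵥ z = 0) (hx : x ∈ Submodule.span K B) : x ⬝ᵥ z = 0 := by
  induction hx using Submodule.span_induction with
  | mem b hb => exact hB b hb
  | zero => exact zero_dotProduct z
  | add x y _ _ hx hy => rw [add_dotProduct, hx, hy, add_zero]
  | smul c x _ hx => rw [smul_dotProduct, hx, smul_zero]

lemma dotProduct_eq_zero_of_mem_vectorSpan [CommRing K] {A : Set (ι → K)} {x z : ι → K} {b : K}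
    (hA : ∀ a ∈ A, a ⬝ᵥ z = b) (hx : x ∈ vectorSpan K A) : x ⬝ᵥ z = 0 := by
  refine dotProduct_eq_zero_of_mem_span ?_ hx
  rintro _ ⟨s, hs, t, ht, rfl⟩
  change (s - t) ⬝ᵥ z = 0
  rw [sub_dotProduct, hA s hs, hA t ht, sub_self]

lemma exists_dotProduct_eq_zero [Field K] {W : Submodule K (ι → K)} (hW : W ≠ ⊤) :
    ∃ z : ι → K, z ≠ 0 ∧ ∀ x ∈ W, x ⬝ᵥ z = 0 := by
  classical
  obtain ⟨f, hf₀, hf⟩ := W.exists_le_ker_of_lt_top hW.lt_top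
  obtain ⟨z, rfl⟩ := (dotProductEquiv K ι).surjective f
  exact ⟨z, fun hz ↦ hf₀ (by rw [hz, map_zero]), fun x hx ↦ (dotProduct_comm x z).trans (hf hx)⟩

lemma finrank_add_one_le_card {w : ι → ℝ} (hw : w ≠ 0) {W : Submodule ℝ (ι → ℝ)}
    (hW : ∀ x ∈ W, x ⬝ᵥ w = 0) : Module.finrank ℝ W + 1 ≤ Fintype.card ι := by
  have lt_top : W < ⊤ := lt_top_iff_ne_top.2 fun h ↦
    hw (dotProduct_self_eq_zero.1 (hW w (h ▸ Submodule.mem_top)))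
  simpa using Submodule.finrank_lt_finrank_of_lt lt_top

lemma sup_span_singleton_eq_top {w : ι → ℝ} (hw : w ≠ 0) {W : Submodule ℝ (ι → ℝ)}
    (hW : ∀ x ∈ W, x ⬝ᵥ w = 0) (hdim : Module.finrank ℝ W + 1 = Fintype.card ι) :
    W ⊔ Submodule.span ℝ {w} = ⊤ := by
  have lt_sup : W < W ⊔ Submodule.span ℝ {w} := left_lt_sup.2 fun h ↦
    hw (dotProduct_self_eq_zero.1 (hW w (h (Submodule.mem_span_singleton_self w))))
  refine Submodule.eq_top_of_finrank_eq (le_antisymm (Submodule.finrank_le _) ?_)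
  rw [Module.finrank_fintype_fun_eq_card, ← hdim]
  exact Submodule.finrank_lt_finrank_of_lt lt_sup

lemma exists_eq_smul_of_forall_dotProduct_eq_zero {w z : ι → ℝ} (hw : w ≠ 0)
    {W : Submodule ℝ (ι → ℝ)} (hW : ∀ x ∈ W, x ⬝ᵥ w = 0)
    (hdim : Module.finrank ℝ W + 1 = Fintype.card ι) (hz : ∀ x ∈ W, x ⬝ᵥ z = 0) :
    ∃ c : ℝ, z = c • w := by
  set c := (w ⬝ᵥ z) / (w ⬝ᵥ w)
  refine ⟨c, sub_eq_zero.1 (dotProduct_self_eq_zero.1 ?_)⟩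
  have orthogonal : ∀ y ∈ (W : Set (ι → ℝ)) ∪ {w}, y ⬝ᵥ (z - c • w) = 0 := by
    rintro y (hy | rfl)
    · rw [dotProduct_sub, hz y hy, dotProduct_smul, hW y hy, smul_zero, sub_zero]
    · rw [dotProduct_sub, dotProduct_smul, smul_eq_mul,
        div_mul_cancel₀ _ (mt dotProduct_self_eq_zero.1 hw), sub_self]
  refine dotProduct_eq_zero_of_mem_span orthogonal ?_
  rw [Submodule.span_union, Submodule.span_eq, sup_span_singleton_eq_top hw hW hdim]
  exact Submodule.mem_top

end DotProduct

variable {n : ℕ}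

section Integral

lemma span_intCast_eq_top {B : Set (Fin n → ℤ)}
    (hB : Submodule.span ℚ ((fun b i ↦ (b i : ℚ)) '' B) = ⊤) :
    Submodule.span ℝ (latticePt '' B) = ⊤ := by
  let L : (Fin n → ℚ) →ₗ[ℚ] (Fin n → ℝ) := (Algebra.linearMap ℚ ℝ).compLeft (Fin n)
  have image_eq : L '' ((fun b i ↦ (b i : ℚ)) '' B) = latticePt '' B := by
    rw [Set.image_image]
    exact Set.image_congr fun b _ ↦ funext fun i ↦ by simp [L, latticePt]
  rw [eq_top_iff, ← (Pi.basisFun ℝ (Fin n)).span_eq, Submodule.span_le]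
  rintro _ ⟨i, rfl⟩
  have mem_map : L (Pi.single i 1) ∈ (Submodule.span ℚ _).map L :=
    Submodule.mem_map_of_mem (hB ▸ Submodule.mem_top)
  rw [Submodule.map_span, image_eq] at mem_map
  have single_eq : L (Pi.single i 1) = Pi.basisFun ℝ (Fin n) i := by
    ext j
    obtain rfl | hj := eq_or_ne j i <;> simp [L, *]
  exact single_eq ▸ Submodule.span_le_restrictScalars ℚ ℝ _ mem_map

lemma exists_integer_smul_eq (q : Fin n → ℚ) :
    ∃ (d : ℤ) (u : Fin n → ℤ), d ≠ 0 ∧ ∀ i, (u i : ℚ) = d * q i := by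
  obtain ⟨d, hd⟩ := IsLocalization.exist_integer_multiples_of_finite (nonZeroDivisors ℤ) q
  choose u hu using hd
  exact ⟨d, u, nonZeroDivisors.coe_ne_zero d, fun i ↦ by simpa [Algebra.smul_def] using hu i⟩

lemma exists_integral_annihilator {B : Set (Fin n → ℤ)}
    (hB : Submodule.span ℝ (latticePt '' B) ≠ ⊤) :
    ∃ u : Fin n → ℤ, u ≠ 0 ∧ ∀ b ∈ B, latticePt b ⬝ᵥ latticePt u = 0 := by
  obtain ⟨q, hq₀, hq⟩ := exists_dotProduct_eq_zero (mt span_intCast_eq_top hB)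
  obtain ⟨d, u, hd, hu⟩ := exists_integer_smul_eq q
  refine ⟨u, ?_, fun b hb ↦ ?_⟩
  · rintro rfl
    refine hq₀ (funext fun i ↦ ?_)
    simpa [hd] using hu i
  · have rational : ∑ i, (b i : ℚ) * u i = 0 := by
      simp only [hu, mul_left_comm _ (d : ℚ), ← Finset.mul_sum]
      exact mul_eq_zero_of_right _ (hq _ (Submodule.subset_span ⟨b, hb, rfl⟩))
    unfold dotProduct latticePt
    exact_mod_cast rational

lemma exists_eq_smul_primitive {u : Fin n → ℤ} (hu : u ≠ 0) :
    ∃ (d : ℤ) (u' : Fin n → ℤ), d ≠ 0 ∧ u = d • u' ∧ ∀ a : ℤ, (∀ i, a ∣ u' i) → IsUnit a := by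
  obtain ⟨i, -⟩ := Function.ne_iff.1 hu
  obtain ⟨u', hu', gcd_eq_one⟩ := Finset.extract_gcd u ⟨i, Finset.mem_univ i⟩
  refine ⟨Finset.univ.gcd u, u', fun h ↦ hu (funext fun j ↦ ?_),
    funext fun j ↦ hu' j (Finset.mem_univ j),
    fun a ha ↦ isUnit_of_dvd_one (gcd_eq_one ▸ Finset.dvd_gcd fun j _ ↦ ha j)⟩
  rw [hu' j (Finset.mem_univ j), h, zero_mul, Pi.zero_apply]

lemma latticePt_smul (d : ℤ) (u : Fin n → ℤ) : latticePt (d • u) = (d : ℝ) • latticePt u :=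
  funext fun i ↦ by simp [latticePt]

lemma latticePt_neg (u : Fin n → ℤ) : latticePt (-u) = -latticePt u :=
  funext fun i ↦ by simp [latticePt]

lemma latticePt_sub (u v : Fin n → ℤ) : latticePt (u - v) = latticePt u - latticePt v :=
  funext fun i ↦ by simp [latticePt]

lemma latticePt_eq_zero {u : Fin n → ℤ} : latticePt u = 0 ↔ u = 0 := by
  simp [funext_iff, latticePt]

lemma exists_primitive_normal {w : Fin n → ℝ} (hw : w ≠ 0) {B : Set (Fin n → ℤ)}
    (hB : ∀ b ∈ B, latticePt b ⬝ᵥ w = 0)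
    (hdim : Module.finrank ℝ (Submodule.span ℝ (latticePt '' B)) + 1 = n) :
    ∃ (u : Fin n → ℤ) (c : ℝ), 0 < c ∧ latticePt u = c • w ∧
      ∀ a : ℤ, (∀ i, a ∣ u i) → IsUnit a := by
  have span_ne_top : Submodule.span ℝ (latticePt '' B) ≠ ⊤ := fun h ↦ by
    rw [h, finrank_top, Module.finrank_fin_fun] at hdim
    omega
  obtain ⟨u₀, hu₀, hu₀B⟩ := exists_integral_annihilator span_ne_top
  obtain ⟨d, u, hd, rfl, primitive⟩ := exists_eq_smul_primitive hu₀
  have huB : ∀ b ∈ B, latticePt b ⬝ᵥ latticePt u = 0 := fun b hb ↦ by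
    have smul_eq := hu₀B b hb
    rw [latticePt_smul, dotProduct_smul] at smul_eq
    exact (smul_eq_zero.1 smul_eq).resolve_left (Int.cast_ne_zero.2 hd)
  obtain ⟨c, hc⟩ := exists_eq_smul_of_forall_dotProduct_eq_zero hw
    (fun x ↦ dotProduct_eq_zero_of_mem_span (Set.forall_mem_image.2 hB))
    (hdim.trans (Fintype.card_fin n).symm)
    (fun x ↦ dotProduct_eq_zero_of_mem_span (Set.forall_mem_image.2 huB))
  rcases lt_trichotomy c 0 with neg | rfl | pos
  · exact ⟨-u, -c, neg_pos.2 neg, by rw [latticePt_neg, hc, neg_smul],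
      fun a ha ↦ primitive a fun i ↦ dvd_neg.1 (ha i)⟩
  · exact absurd (latticePt_eq_zero.1 (hc.trans (zero_smul ℝ w))) (right_ne_zero_of_smul hu₀)
  · exact ⟨u, c, pos, hc, primitive⟩

end Integral

section PolarBody

/-- The polar body of `T - p`, in coordinates for the dot product: the vectors `w` with
`-1 ≤ ⟨s - p, w⟩` for all `s ∈ T`. -/
def polarBody (T : Set (Fin n → ℝ)) (p : Fin n → ℝ) : Set (Fin n → ℝ) :=
  {w | ∀ s ∈ T, -1 ≤ (s - p) ⬝ᵥ w}

/-- The points of `T` whose inequality in the definition of `polarBody T p` is an equality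
at `w`. -/
def activePoints (T : Set (Fin n → ℝ)) (p w : Fin n → ℝ) : Set (Fin n → ℝ) :=
  {s ∈ T | (s - p) ⬝ᵥ w = -1}

variable {T : Set (Fin n → ℝ)} {p w : Fin n → ℝ}

lemma polarBody_subset_polarBody_convexHull : polarBody T p ⊆ polarBody (convexHull ℝ T) p := by
  intro w hw
  have convex : Convex ℝ {s : Fin n → ℝ | -1 + p ⬝ᵥ w ≤ s ⬝ᵥ w} :=
    convex_halfSpace_ge ⟨fun x y ↦ add_dotProduct x y w, fun c x ↦ smul_dotProduct c x w⟩ _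
  intro s hs
  rw [sub_dotProduct, le_sub_iff_add_le]
  refine convexHull_min (fun s hs ↦ ?_) convex hs
  simpa only [Set.mem_ofPred_eq, ← le_sub_iff_add_le, ← sub_dotProduct] using hw s hs

lemma isClosed_polarBody : IsClosed (polarBody T p) := by
  simp only [polarBody, Set.ofPred_forall]
  refine isClosed_biInter fun s _ ↦ isClosed_le continuous_const ?_
  unfold dotProduct
  fun_prop

lemma isCompact_polarBody (hp : p ∈ interior (convexHull ℝ T)) : IsCompact (polarBody T p) := by
  obtain ⟨ε, hε, ball_subset⟩ := Metric.isOpen_iff.1 isOpen_interior p hp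
  refine (isCompact_Icc (a := fun _ : Fin n ↦ -(2 / ε)) (b := fun _ ↦ 2 / ε)).of_isClosed_subset
    isClosed_polarBody fun w hw ↦ ?_
  have neg_one_le (i : Fin n) (δ : ℝ) (hδ : |δ| < ε) : -1 ≤ δ * w i := by
    have mem_ball : p + Pi.single i δ ∈ Metric.ball p ε := by
      rwa [Metric.mem_ball, dist_eq_norm, add_sub_cancel_left, Pi.norm_single]
    simpa using polarBody_subset_polarBody_convexHull hw _ (interior_subset (ball_subset mem_ball))
  have half_lt : |ε / 2| < ε := by rw [abs_of_pos (half_pos hε)]; exact half_lt_self hε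
  refine ⟨fun i ↦ ?_, fun i ↦ ?_⟩
  · rw [← neg_div, div_le_iff₀ hε]
    linarith [neg_one_le i _ half_lt]
  · rw [le_div_iff₀ hε]
    linarith [neg_one_le i _ ((abs_neg _).trans_lt half_lt)]

lemma exists_extremePoint_le {Q : Set (Fin n → ℝ)} (hQ : IsCompact Q) (y : Fin n → ℝ)
    {w₀ : Fin n → ℝ} (hw₀ : w₀ ∈ Q) : ∃ w ∈ Q.extremePoints ℝ, y ⬝ᵥ w ≤ y ⬝ᵥ w₀ := by
  let l : StrongDual ℝ (Fin n → ℝ) :=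
    LinearMap.toContinuousLinearMap (-dotProductEquiv ℝ (Fin n) y)
  have l_apply (w) : l w = -(y ⬝ᵥ w) := rfl
  obtain ⟨w₁, hw₁, hmax⟩ := hQ.exists_isMaxOn ⟨w₀, hw₀⟩ l.continuous.continuousOn
  have exposed : IsExposed ℝ Q {w ∈ Q | ∀ y ∈ Q, l y ≤ l w} := fun _ ↦ ⟨l, rfl⟩
  obtain ⟨w, hw⟩ := (exposed.isCompact hQ).extremePoints_nonempty ⟨w₁, hw₁, fun y hy ↦ hmax hy⟩
  refine ⟨w, exposed.isExtreme.extremePoints_subset_extremePoints hw, ?_⟩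
  simpa only [l_apply, neg_le_neg_iff] using hw.1.2 w₀ hw₀

lemma exists_extremePoint_polarBody_lt (hT : T.Finite) (hp : p ∈ interior (convexHull ℝ T))
    {x : Fin n → ℝ} (hx : x ∉ convexHull ℝ T) :
    ∃ w ∈ (polarBody T p).extremePoints ℝ, (x - p) ⬝ᵥ w < -1 := by
  obtain ⟨f, a, hfx, hfa⟩ := geometric_hahn_banach_point_closed (convex_convexHull ℝ T)
    (hT.isClosed_convexHull ℝ) hx
  obtain ⟨z, hz⟩ := (dotProductEquiv ℝ (Fin n)).surjective (f : (Fin n → ℝ) →ₗ[ℝ] ℝ)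
  have hpa : 0 < f p - a := sub_pos.2 (hfa p (interior_subset hp))
  have sub_dotProduct_eq (y) : (y - p) ⬝ᵥ ((f p - a)⁻¹ • z) = (f y - f p) / (f p - a) := by
    have hzf : z ⬝ᵥ (y - p) = f (y - p) := LinearMap.congr_fun hz (y - p)
    rw [dotProduct_smul, dotProduct_comm, hzf, map_sub, smul_eq_mul, div_eq_inv_mul]
  have mem_polarBody : (f p - a)⁻¹ • z ∈ polarBody T p := fun s hs ↦ by
    rw [sub_dotProduct_eq, le_div_iff₀ hpa]
    linarith [hfa s (subset_convexHull ℝ T hs)]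
  obtain ⟨w, hw, hle⟩ := exists_extremePoint_le (isCompact_polarBody hp) (x - p) mem_polarBody
  refine ⟨w, hw, hle.trans_lt ?_⟩
  rw [sub_dotProduct_eq, div_lt_iff₀ hpa]
  linarith

lemma eventually_add_smul_mem_polarBody (hT : T.Finite) (hw : w ∈ polarBody T p)
    {z : Fin n → ℝ} (hz : ∀ s ∈ activePoints T p w, (s - p) ⬝ᵥ z = 0) :
    ∀ᶠ ε : ℝ in nhds 0, w + ε • z ∈ polarBody T p := by
  change ∀ᶠ ε : ℝ in nhds 0, ∀ s ∈ T, -1 ≤ (s - p) ⬝ᵥ (w + ε • z)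
  rw [hT.eventually_all]
  intro s hs
  rcases (hw s hs).eq_or_lt with active | inactive
  · refine Filter.Eventually.of_forall fun ε ↦ ?_
    rw [dotProduct_add, dotProduct_smul, hz s ⟨hs, active.symm⟩, smul_zero, add_zero, active]
  · have continuous : Continuous fun ε : ℝ ↦ (s - p) ⬝ᵥ (w + ε • z) := by
      unfold dotProduct
      fun_prop
    exact (continuous.continuousAt.eventually
      (lt_mem_nhds (by simpa using inactive))).mono fun _ ↦ le_of_lt

lemma span_activePoints_eq_top (hT : T.Finite) (hw : w ∈ (polarBody T p).extremePoints ℝ) :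
    Submodule.span ℝ ((· - p) '' activePoints T p w) = ⊤ := by
  by_contra ne_top
  obtain ⟨z, hz₀, hz⟩ := exists_dotProduct_eq_zero ne_top
  obtain ⟨ε, hε, mem⟩ := Metric.eventually_nhds_iff.1 <| eventually_add_smul_mem_polarBody hT hw.1
    fun s hs ↦ hz _ (Submodule.subset_span ⟨s, hs, rfl⟩)
  have half_dist : dist (ε / 2) 0 < ε := by
    rw [Real.dist_0_eq_abs, abs_of_pos (half_pos hε)]
    exact half_lt_self hε
  have neg_half_dist : dist (-(ε / 2)) 0 < ε := by
    rwa [Real.dist_0_eq_abs, abs_neg, ← Real.dist_0_eq_abs]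
  have endpoint_eq : w + (ε / 2) • z = w := hw.2 (mem half_dist) (mem neg_half_dist)
    ⟨1 / 2, 1 / 2, by norm_num, by norm_num, by norm_num, by module⟩
  exact (smul_ne_zero (half_pos hε).ne' hz₀) (add_eq_left.1 endpoint_eq)

lemma le_finrank_vectorSpan_add_one {A : Set (Fin n → ℝ)}
    (hA : Submodule.span ℝ ((· - p) '' A) = ⊤) :
    n ≤ Module.finrank ℝ (vectorSpan ℝ A) + 1 := by
  obtain rfl | ⟨s₀, hs₀⟩ := A.eq_empty_or_nonempty
  · have finrank_eq := finrank_bot ℝ (Fin n → ℝ)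
    rw [Set.image_empty, Submodule.span_empty] at hA
    rw [hA, finrank_top, Module.finrank_fin_fun] at finrank_eq
    omega
  have top_le : ⊤ ≤ vectorSpan ℝ A ⊔ Submodule.span ℝ {s₀ - p} := by
    rw [← hA, Submodule.span_le]
    rintro _ ⟨s, hs, rfl⟩
    change s - p ∈ _
    rw [← sub_add_sub_cancel s s₀ p]
    exact add_mem (Submodule.mem_sup_left (vsub_mem_vectorSpan ℝ hs hs₀))
      (Submodule.mem_sup_right (Submodule.mem_span_singleton_self _))
  calc n = Module.finrank ℝ (⊤ : Submodule ℝ (Fin n → ℝ)) := by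
        rw [finrank_top, Module.finrank_fin_fun]
    _ ≤ _ := Submodule.finrank_mono top_le
    _ ≤ _ := Submodule.finrank_add_le_finrank_add_finrank _ _
    _ ≤ _ := Nat.add_le_add_left ((finrank_span_le_card _).trans (by simp)) _

lemma dotProduct_eq_of_mem_activePoints {s : Fin n → ℝ} (hs : s ∈ activePoints T p w) :
    s ⬝ᵥ w = p ⬝ᵥ w - 1 := by
  have := hs.2
  rw [sub_dotProduct] at this
  linarith

lemma finrank_vectorSpan_activePoints (hT : T.Finite)
    (hw : w ∈ (polarBody T p).extremePoints ℝ) (hw₀ : w ≠ 0) :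
    Module.finrank ℝ (vectorSpan ℝ (activePoints T p w)) + 1 = n :=
  le_antisymm
    ((finrank_add_one_le_card hw₀ fun _ ↦ dotProduct_eq_zero_of_mem_vectorSpan fun _ ↦
      dotProduct_eq_of_mem_activePoints).trans_eq (Fintype.card_fin n))
    (le_finrank_vectorSpan_add_one (span_activePoints_eq_top hT hw))

lemma activePoints_nonempty (hT : T.Finite) (hw : w ∈ (polarBody T p).extremePoints ℝ)
    (hw₀ : w ≠ 0) : (activePoints T p w).Nonempty := by
  by_contra! empty
  have span_eq := span_activePoints_eq_top hT hw
  rw [empty, Set.image_empty, Submodule.span_empty] at span_eq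
  exact hw₀ ((Submodule.mem_bot ℝ).1 (span_eq ▸ Submodule.mem_top))

end PolarBody

section LatticePolytope

lemma pairing_eq_dotProduct (x : Fin n → ℝ) (u : Fin n → ℤ) : pairing x u = x ⬝ᵥ latticePt u :=
  rfl

variable {S : Finset (Fin n → ℤ)} {p w : Fin n → ℝ}

lemma exists_primitive_normal_activePoints
    (hw : w ∈ (polarBody (latticePt '' (S : Set (Fin n → ℤ))) p).extremePoints ℝ) (hw₀ : w ≠ 0) :
    ∃ (u : Fin n → ℤ) (c : ℝ), 0 < c ∧ latticePt u = c • w ∧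
      ∀ a : ℤ, (∀ i, a ∣ u i) → IsUnit a := by
  set A := activePoints (latticePt '' (S : Set (Fin n → ℤ))) p w
  have span_eq : Submodule.span ℝ (latticePt '' {b | latticePt b ∈ A -ᵥ A}) = vectorSpan ℝ A := by
    rw [vectorSpan]
    congr 1
    refine Set.image_preimage_eq_of_subset ?_
    rintro _ ⟨_, ⟨⟨s, -, rfl⟩, -⟩, _, ⟨⟨t, -, rfl⟩, -⟩, rfl⟩
    exact ⟨s - t, latticePt_sub s t⟩
  refine exists_primitive_normal hw₀ (B := {b | latticePt b ∈ A -ᵥ A}) (fun b hb ↦ ?_) ?_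
  · exact dotProduct_eq_zero_of_mem_vectorSpan (fun _ ↦ dotProduct_eq_of_mem_activePoints)
      (Submodule.subset_span hb)
  · rw [span_eq, finrank_vectorSpan_activePoints (S.finite_toSet.image _) hw hw₀]

lemma exists_isFacetNormal_of_extremePoint
    (hw : w ∈ (polarBody (latticePt '' (S : Set (Fin n → ℤ))) p).extremePoints ℝ) (hw₀ : w ≠ 0) :
    ∃ (u : Fin n → ℤ) (c : ℝ), 0 < c ∧ latticePt u = c • w ∧
      IsFacetNormal (convexHull ℝ (latticePt '' (S : Set (Fin n → ℤ)))) u (c * (1 - p ⬝ᵥ w)) := by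
  set T := latticePt '' (S : Set (Fin n → ℤ))
  have hT : T.Finite := S.finite_toSet.image _
  obtain ⟨u, c, hc, hu, primitive⟩ := exists_primitive_normal_activePoints hw hw₀
  have pairing_eq (y) : pairing y u = c * (y ⬝ᵥ w) := by
    rw [pairing_eq_dotProduct, hu, dotProduct_smul, smul_eq_mul]
  have active_subset : activePoints T p w ⊆
      {m ∈ convexHull ℝ T | pairing m u = -(c * (1 - p ⬝ᵥ w))} := fun s hs ↦
    ⟨subset_convexHull ℝ T hs.1, by
      rw [pairing_eq, dotProduct_eq_of_mem_activePoints hs]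
      ring⟩
  refine ⟨u, c, hc, hu, primitive, fun m hm ↦ ?_,
    (activePoints_nonempty hT hw hw₀).mono active_subset, le_antisymm ?_ ?_⟩
  · have := polarBody_subset_polarBody_convexHull hw.1 m hm
    rw [sub_dotProduct] at this
    rw [pairing_eq]
    nlinarith
  · refine (finrank_add_one_le_card hw₀ fun x ↦ dotProduct_eq_zero_of_mem_vectorSpan
      (b := p ⬝ᵥ w - 1) fun m hm ↦ mul_left_cancel₀ hc.ne' ?_).trans_eq (Fintype.card_fin n)
    linarith [hm.2, pairing_eq m]
  · exact (finrank_vectorSpan_activePoints hT hw hw₀).ge.trans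
      (Nat.add_le_add_right (Submodule.finrank_mono (vectorSpan_mono ℝ active_subset)) 1)

lemma exists_isFacetNormal_pairing_lt
    (hS : affineSpan ℝ (convexHull ℝ (latticePt '' (S : Set (Fin n → ℤ)))) = ⊤) {x : Fin n → ℝ}
    (hx : x ∉ convexHull ℝ (latticePt '' (S : Set (Fin n → ℤ)))) :
    ∃ (u : Fin n → ℤ) (b : ℝ),
      IsFacetNormal (convexHull ℝ (latticePt '' (S : Set (Fin n → ℤ)))) u b ∧
        pairing x u < -b := by
  obtain ⟨p, hp⟩ := interior_convexHull_nonempty_iff_affineSpan_eq_top.2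
    ((affineSpan_convexHull _).symm.trans hS)
  obtain ⟨w, hw, hxw⟩ := exists_extremePoint_polarBody_lt (S.finite_toSet.image _) hp hx
  have hw₀ : w ≠ 0 := by
    rintro rfl
    rw [dotProduct_zero] at hxw
    linarith
  obtain ⟨u, c, hc, hu, facet⟩ := exists_isFacetNormal_of_extremePoint hw hw₀
  refine ⟨u, _, facet, ?_⟩
  rw [sub_dotProduct] at hxw
  rw [pairing_eq_dotProduct, hu, dotProduct_smul, smul_eq_mul]
  nlinarith

end LatticePolytope

end ConvexGeometry

namespace ReflexivePolytope

open scoped Pointwise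

variable {n : ℕ} (Δ : ReflexivePolytope n)

lemma mem_carrier_iff (x : Fin n → ℝ) : x ∈ Δ.carrier ↔ ∀ F : Δ.Facet, -1 ≤ pairing x F.1 := by
  refine ⟨fun hx F ↦ F.2.inward x hx, fun h ↦ ?_⟩
  by_contra hx
  obtain ⟨S, hS⟩ := Δ.lattice
  obtain ⟨u, b, facet, lt⟩ :=
    exists_isFacetNormal_pairing_lt (hS ▸ Δ.fullDim) (hS ▸ hx)
  rw [← hS] at facet
  obtain rfl := Δ.reflexive u b facet
  exact (h ⟨u, facet⟩).not_gt lt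

lemma zero_mem_carrier : (0 : Fin n → ℝ) ∈ Δ.carrier :=
  (Δ.mem_carrier_iff 0).2 fun F ↦ by simp [pairing]

lemma isBounded_carrier : Bornology.IsBounded Δ.carrier := by
  obtain ⟨S, hS⟩ := Δ.lattice
  rw [hS, isBounded_convexHull]
  exact (S.finite_toSet.image _).isBounded

lemma pairing_smul (a : ℝ) (x : Fin n → ℝ) (u : Fin n → ℤ) :
    pairing (a • x) u = a * pairing x u :=
  smul_dotProduct a x (latticePt u)

lemma eq_zero_of_forall_pairing_nonneg {x : Fin n → ℝ} (hx : ∀ F : Δ.Facet, 0 ≤ pairing x F.1) :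
    x = 0 := by
  by_contra hx₀
  have smul_mem (r : ℝ) (hr : 0 ≤ r) : r • x ∈ Δ.carrier := (Δ.mem_carrier_iff _).2 fun F ↦ by
    rw [pairing_smul]
    linarith [mul_nonneg hr (hx F)]
  obtain ⟨R, hR⟩ := Δ.isBounded_carrier.exists_norm_le
  have norm_pos : 0 < ‖x‖ := norm_pos_iff.2 hx₀
  have hR₀ : 0 ≤ R := (norm_nonneg _).trans (hR 0 Δ.zero_mem_carrier)
  have norm_le := hR _ (smul_mem ((R + 1) / ‖x‖) (by positivity))
  rw [norm_smul, Real.norm_of_nonneg (by positivity), div_mul_cancel₀ _ norm_pos.ne'] at norm_le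
  linarith

lemma mem_smul_carrier_iff {a : ℝ} (ha : 0 ≤ a) (x : Fin n → ℝ) :
    x ∈ a • Δ.carrier ↔ ∀ F : Δ.Facet, -a ≤ pairing x F.1 := by
  rcases ha.eq_or_lt with rfl | ha
  · rw [Set.zero_smul_set Δ.nonempty, neg_zero]
    refine ⟨?_, Δ.eq_zero_of_forall_pairing_nonneg⟩
    rintro rfl F
    simp [pairing]
  · rw [Set.mem_smul_set_iff_inv_smul_mem₀ ha.ne', mem_carrier_iff]
    refine forall_congr' fun F ↦ ?_
    rw [pairing_smul, ← div_eq_inv_mul, le_div_iff₀ ha, neg_one_mul]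

lemma mem_cone_iff (p : (Fin n → ℤ) × ℕ) :
    p ∈ Δ.cone ↔ ∀ F : Δ.Facet, -(p.2 : ℤ) ≤ ∑ i, p.1 i * F.1 i := by
  change latticePt p.1 ∈ (p.2 : ℝ) • Δ.carrier ↔ _
  rw [mem_smul_carrier_iff _ (Nat.cast_nonneg _)]
  refine forall_congr' fun F ↦ ?_
  unfold pairing latticePt
  exact_mod_cast Iff.rfl

/- Pairings of lattice points with conormals are integers, so `-(k + 1) < ⟨m, u⟩` improves to
`-k ≤ ⟨m, u⟩`. -/
lemma mem_cone_of_forall_ne {m : Fin n → ℤ} {k : ℕ} (h : (m, k + 1) ∈ Δ.cone)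
    (hF : ∀ F : Δ.Facet, pairing (latticePt m) F.1 ≠ -((k + 1 : ℕ) : ℝ)) : (m, k) ∈ Δ.cone := by
  rw [mem_cone_iff] at h ⊢
  intro F
  have le := h F
  have ne : ∑ i, m i * F.1 i ≠ -((k + 1 : ℕ) : ℤ) := fun eq ↦ hF F (by
    unfold pairing latticePt
    exact_mod_cast eq)
  simp only [Nat.cast_add, Nat.cast_one] at le ne ⊢
  omega

lemma zero_one_mem_cone : ((0 : Fin n → ℤ), 1) ∈ Δ.cone := by
  rw [mem_cone_iff]
  intro F
  simp

/-- A finite set of lattice points whose convex hull is `Δ`, possibly with points that are not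
vertices of `Δ`. -/
def vertices : Finset (Fin n → ℤ) := Δ.lattice.choose

lemma carrier_eq : Δ.carrier = convexHull ℝ (latticePt '' (Δ.vertices : Set (Fin n → ℤ))) :=
  Δ.lattice.choose_spec

lemma latticePt_mem_carrier {v : Fin n → ℤ} (hv : v ∈ Δ.vertices) : latticePt v ∈ Δ.carrier := by
  rw [carrier_eq]
  exact subset_convexHull ℝ _ ⟨v, hv, rfl⟩

lemma mem_cone_of_mem_vertices {v : Fin n → ℤ} (hv : v ∈ Δ.vertices) : (v, 1) ∈ Δ.cone := by
  change latticePt v ∈ ((1 : ℕ) : ℝ) • Δ.carrier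
  rw [Nat.cast_one, one_smul]
  exact Δ.latticePt_mem_carrier hv

lemma exists_vertex_mul_pairing_le {x : Fin n → ℝ} (hx : x ∈ Δ.carrier) :
    ∃ v ∈ Δ.vertices, ∃ c > 0, ∀ F : Δ.Facet,
      c * (pairing (latticePt v) F.1 + 1) ≤ pairing x F.1 + 1 := by
  rw [carrier_eq] at hx
  obtain ⟨_, ⟨v, hv, rfl⟩, c, hc, h⟩ :=
    exists_mem_smul_sub_le_of_mem_convexHull (Δ.vertices.finite_toSet.image _) hx
  refine ⟨v, hv, c, hc, fun F ↦ ?_⟩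
  have dotProduct_eq (y : Fin n → ℝ) :
      dotProductEquiv ℝ (Fin n) (latticePt F.1) y = pairing y F.1 :=
    dotProduct_comm (latticePt F.1) y
  simpa only [dotProduct_eq, sub_neg_eq_add] using h (dotProductEquiv ℝ (Fin n) (latticePt F.1))
    (-1) fun _ ⟨s, hs, h⟩ ↦ h ▸ dotProduct_eq _ ▸ F.2.inward _ (Δ.latticePt_mem_carrier hs)

lemma exists_nsmul_eq_add {p : (Fin n → ℤ) × ℕ} (hp : p ∈ Δ.cone) (hp₂ : 0 < p.2) :
    ∃ v ∈ Δ.vertices, ∃ N : ℕ, ∃ q ∈ Δ.cone, N • p = (v, 1) + q := by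
  obtain ⟨x, hx, hxp⟩ : latticePt p.1 ∈ (p.2 : ℝ) • Δ.carrier := hp
  obtain ⟨v, hv, c, hc, hvc⟩ := Δ.exists_vertex_mul_pairing_le hx
  obtain ⟨N, hN⟩ := exists_nat_ge (1 / c)
  rw [div_le_iff₀ hc] at hN
  have N_pos : 0 < N := Nat.pos_of_ne_zero fun h ↦ by
    simp only [h, Nat.cast_zero, zero_mul] at hN
    linarith
  have one_le : 1 ≤ N * p.2 := Nat.mul_pos N_pos hp₂
  refine ⟨v, hv, N, (N • p.1 - v, N * p.2 - 1), ?_, ?_⟩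
  · refine (Δ.mem_smul_carrier_iff (Nat.cast_nonneg _) _).2 fun F ↦ ?_
    have pairing_eq : pairing (latticePt (N • p.1 - v)) F.1 =
        N * p.2 * pairing x F.1 - pairing (latticePt v) F.1 := by
      rw [← natCast_zsmul, latticePt_sub, latticePt_smul, ← hxp]
      simp only [pairing_eq_dotProduct, sub_dotProduct, smul_dotProduct, smul_eq_mul]
      push_cast
      ring
    have inward := F.2.inward _ (Δ.latticePt_mem_carrier hv)
    have scaled : pairing (latticePt v) F.1 + 1 ≤ N * p.2 * (pairing x F.1 + 1) := by
      have hp₂' : (1 : ℝ) ≤ p.2 := by exact_mod_cast hp₂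
      calc pairing (latticePt v) F.1 + 1
          ≤ N * p.2 * c * (pairing (latticePt v) F.1 + 1) :=
            le_mul_of_one_le_left (by linarith) (by nlinarith)
        _ ≤ N * p.2 * (pairing x F.1 + 1) := by
            rw [mul_assoc]
            exact mul_le_mul_of_nonneg_left (hvc F) (by positivity)
    rw [pairing_eq, Nat.cast_sub one_le]
    push_cast
    linarith
  · ext i
    · simp
    · simp only [Prod.smul_snd, smul_eq_mul, Prod.snd_add]
      omega

end ReflexivePolytope

/-! ### Ideal sheaves and projective spectra -/

section IdealModule

variable {X : Scheme.{0}} (I : X.IdealSheafData)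

/-- The surjection of the structure sheaf onto the structure sheaf of a closed subscheme. -/
def quotientMap : structureModule X ⟶
    (Scheme.Modules.pushforward I.subschemeι).obj (structureModule I.subscheme) :=
  SheafOfModules.unitToPushforwardObjUnit I.subschemeι.toRingCatSheafHom

/-- The inclusion of an ideal sheaf into the structure sheaf. -/
def idealInclusion : idealModule I ⟶ structureModule X := kernel.ι (quotientMap I)

instance : Mono (idealInclusion I) := inferInstanceAs (Mono (kernel.ι (quotientMap I)))

/-- The function given by a section of an ideal sheaf. -/
def idealFun {U : X.Opens} (z : Γ(idealModule I, U)) : Γ(X, U) := (idealInclusion I).app U z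

lemma idealFun_injective (U : X.Opens) : Function.Injective (idealFun I (U := U)) :=
  injective_app_of_mono (idealInclusion I) U

lemma idealFun_smul {U : X.Opens} (r : Γ(X, U)) (z : Γ(idealModule I, U)) :
    idealFun I (r • z) = r * idealFun I z :=
  Scheme.Modules.Hom.app_smul (φ := idealInclusion I) (U := U) r z

lemma resO_idealFun {U V : X.Opens} (h : V ≤ U) (z : Γ(idealModule I, U)) :
    resO h (idealFun I z) = idealFun I (resM _ h z) :=
  (app_resM (idealInclusion I) h z).symm

lemma idealFun_mem (U : X.affineOpens) (z : Γ(idealModule I, U.1)) :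
    idealFun I z ∈ I.ideal U := by
  rw [← I.ker_subschemeι_app U]
  exact congrArg (fun f ↦ Scheme.Modules.Hom.app f U.1 z) (kernel.condition (quotientMap I))

lemma exists_idealFun_eq (U : X.affineOpens) {a : Γ(X, U.1)} (ha : a ∈ I.ideal U) :
    ∃ z : Γ(idealModule I, U.1), idealFun I z = a := by
  rw [← I.ker_subschemeι_app U] at ha
  exact exists_app_eq_of_isKernel (kernel.condition (quotientMap I)) (kernelIsKernel _)
    (U := U.1) (a := a) ha

lemma isFrame_idealModule (U : X.affineOpens) (z : Γ(idealModule I, U.1))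
    (hz : idealFun I z ∈ nonZeroDivisors Γ(X, U.1)) (hI : I.ideal U = Ideal.span {idealFun I z}) :
    IsFrame (idealModule I) z := by
  refine isFrame_of_basis {V | ∃ g : Γ(X, U.1), V = X.basicOpen g} (fun W hW x hx ↦ ?_) ?_
  · obtain ⟨g, hg, hxg⟩ := U.2.exists_basicOpen_le ⟨x, hx⟩ (hW hx)
    exact ⟨_, ⟨g, rfl⟩, hxg, hg⟩
  · rintro _ ⟨g, rfl⟩ h
    have := U.2.isLocalization_basicOpen g
    have regular : idealFun I (resM _ h z) ∈ nonZeroDivisors Γ(X, X.basicOpen g) := by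
      rw [← resO_idealFun]
      exact IsLocalization.map_nonZeroDivisors_le (.powers g) _ ⟨_, hz, rfl⟩
    have span_eq : I.ideal (X.affineBasicOpen g) = Ideal.span {idealFun I (resM _ h z)} := by
      rw [← I.map_ideal_basicOpen U g, hI, Ideal.map_span, Set.image_singleton, ← resO_idealFun]
      rfl
    constructor
    · intro r s hrs
      have mul_eq := congrArg (idealFun I) hrs
      simp only [idealFun_smul] at mul_eq
      exact (mul_cancel_right_mem_nonZeroDivisors regular).1 mul_eq
    · intro y
      obtain ⟨r, hr⟩ := Ideal.mem_span_singleton'.1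
        (span_eq ▸ idealFun_mem I (X.affineBasicOpen g) y)
      exact ⟨r, idealFun_injective I _ ((idealFun_smul I _ _).trans hr)⟩

lemma mem_vanishingIdeal_iff (Z : Closeds X) (U : X.affineOpens) (a : Γ(X, U.1)) :
    a ∈ (Scheme.IdealSheafData.vanishingIdeal Z).ideal U ↔
      ∀ x ∈ Z, x ∈ U.1 → x ∉ X.basicOpen a := by
  rw [Scheme.IdealSheafData.vanishingIdeal_ideal, PrimeSpectrum.mem_vanishingIdeal]
  have mem_basicOpen_iff (p : Spec Γ(X, U.1)) : U.2.fromSpec p ∈ X.basicOpen a ↔ a ∉ p.asIdeal := by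
    refine Iff.trans ?_ (PrimeSpectrum.mem_basicOpen a p)
    exact iff_of_eq (congrArg (p ∈ ·) (IsAffineOpen.fromSpec_preimage_basicOpen U.2 a))
  constructor
  · intro h x hxZ hxU
    obtain ⟨p, rfl⟩ : x ∈ Set.range U.2.fromSpec := by rwa [U.2.range_fromSpec]
    rw [mem_basicOpen_iff, not_not]
    exact h p hxZ
  · intro h p hp
    have hpU : U.2.fromSpec p ∈ U.1 := by
      rw [← SetLike.mem_coe, ← U.2.range_fromSpec]
      exact ⟨p, rfl⟩
    exact not_not.1 fun hap ↦ h _ hp hpU ((mem_basicOpen_iff p).2 hap)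

end IdealModule

section Proj

open HomogeneousLocalization

variable {A : Type} [CommRing A] {σ : Type*} [SetLike σ A] [AddSubgroupClass σ A]
  {𝒜 : ℕ → σ} [GradedRing 𝒜]

/-- The function `a / f ^ k` on `D₊(f)`, where `f` has degree `1` and `a` has degree `k`. -/
def fracSec {f : A} (hf : f ∈ 𝒜 1) {k : ℕ} {a : A} (ha : a ∈ 𝒜 k) :
    Γ(Proj 𝒜, Proj.basicOpen 𝒜 f) :=
  Proj.awayToSection 𝒜 f (Away.mk 𝒜 hf k a (by simpa using ha))

variable {f : A} (hf : f ∈ 𝒜 1)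

lemma fracSec_surjective (s : Γ(Proj 𝒜, Proj.basicOpen 𝒜 f)) :
    ∃ (k : ℕ) (a : A) (ha : a ∈ 𝒜 k), fracSec hf ha = s := by
  obtain ⟨k, a, ha, h⟩ := Away.mk_surjective 𝒜 hf ((Proj.basicOpenIsoAway 𝒜 f hf one_pos).inv s)
  refine ⟨k, a, by simpa using ha, ?_⟩
  rw [fracSec, h, ← Proj.basicOpenIsoAway_hom 𝒜 f hf one_pos]
  exact ConcreteCategory.congr_hom (Proj.basicOpenIsoAway 𝒜 f hf one_pos).inv_hom_id s

lemma fracSec_eq_iff [IsDomain A] (hf₀ : f ≠ 0) {k l : ℕ} {a b : A} (ha : a ∈ 𝒜 k)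
    (hb : b ∈ 𝒜 l) : fracSec hf ha = fracSec hf hb ↔ f ^ l * a = f ^ k * b := by
  have injective : Function.Injective (Proj.awayToSection 𝒜 f) := by
    rw [← Proj.basicOpenIsoAway_hom 𝒜 f hf one_pos]
    exact (ConcreteCategory.bijective_of_isIso _).1
  rw [fracSec, fracSec, injective.eq_iff, ext_iff_val, Away.val_mk, Away.val_mk,
    Localization.mk_eq_mk_iff, Localization.r_iff_exists]
  constructor
  · rintro ⟨⟨_, m, rfl⟩, h⟩
    exact mul_left_cancel₀ (pow_ne_zero m hf₀) h
  · intro h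
    exact ⟨1, by simpa using h⟩

lemma fracSec_mul {k l : ℕ} {a b : A} (ha : a ∈ 𝒜 k) (hb : b ∈ 𝒜 l) :
    fracSec hf ha * fracSec hf hb = fracSec hf (SetLike.mul_mem_graded ha hb) := by
  rw [fracSec, fracSec, ← map_mul, fracSec]
  congr 1
  rw [ext_iff_val, val_mul, Away.val_mk, Away.val_mk, Away.val_mk, Localization.mk_mul]
  congr 1
  exact Subtype.ext (pow_add f k l).symm

lemma fracSec_self : fracSec hf hf = 1 := by
  rw [fracSec, ← map_one (Proj.awayToSection 𝒜 f).hom]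
  congr 1
  rw [ext_iff_val, val_one, Away.val_mk, ← Localization.mk_one]
  exact Localization.mk_eq_mk_iff.2 (Localization.r_iff_exists.2 ⟨1, by simp⟩)

lemma fracSec_zero {k : ℕ} : fracSec hf (zero_mem (𝒜 k)) = 0 := by
  rw [fracSec, ← map_zero (Proj.awayToSection 𝒜 f).hom]
  congr 1
  rw [ext_iff_val, val_zero, Away.val_mk, Localization.mk_zero]

lemma fracSec_eq_zero_iff [IsDomain A] (hf₀ : f ≠ 0) {k : ℕ} {a : A} (ha : a ∈ 𝒜 k) :
    fracSec hf ha = 0 ↔ a = 0 := by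
  rw [← fracSec_zero hf (k := 0), fracSec_eq_iff hf hf₀, mul_zero, pow_zero, one_mul]

lemma mem_basicOpen_fracSec {k : ℕ} {a : A} (ha : a ∈ 𝒜 k) (x : Proj 𝒜) :
    x ∈ (Proj 𝒜).basicOpen (fracSec hf ha) ↔
      f ∉ x.asHomogeneousIdeal ∧ a ∉ x.asHomogeneousIdeal := by
  by_cases hx : x ∈ Proj.basicOpen 𝒜 f
  · rw [Scheme.mem_basicOpen _ _ _ hx]
    have germ_eq : (Proj 𝒜).presheaf.germ _ x hx (fracSec hf ha) =
        (Proj.stalkIso' 𝒜 x).symm (mapId 𝒜 (Submonoid.powers_le.mpr hx)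
          (Away.mk 𝒜 hf k a (by simpa using ha))) :=
      ConcreteCategory.congr_hom (ProjectiveSpectrum.Proj.awayToSection_germ 𝒜 f x hx) _
    rw [germ_eq]
    have prime : x.asHomogeneousIdeal.toIdeal.IsPrime := x.isPrime
    refine (isUnit_map_iff (Proj.stalkIso' 𝒜 x).symm _).trans
      ((isUnit_iff_isUnit_val _ _ _).symm.trans ?_)
    refine Iff.trans (b := a ∈ x.asHomogeneousIdeal.toIdeal.primeCompl) ?_
      ⟨fun h ↦ ⟨hx, h⟩, fun h ↦ h.2⟩
    refine (iff_of_eq (congrArg IsUnit (Localization.mk_eq_mk'_apply a _))).trans ?_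
    exact IsLocalization.AtPrime.isUnit_mk'_iff
      (Localization.AtPrime x.asHomogeneousIdeal.toIdeal) x.asHomogeneousIdeal.toIdeal a
      ⟨f ^ k, fun h ↦ hx (prime.mem_of_pow_mem k h)⟩
  · exact ⟨fun h ↦ absurd ((Proj 𝒜).basicOpen_le _ h) hx, fun h ↦ absurd h.1 hx⟩

lemma resO_fracSec {g : A} (hg : g ∈ 𝒜 1) {a : A} (ha : a ∈ 𝒜 1) :
    resO (inf_le_right : Proj.basicOpen 𝒜 g ⊓ Proj.basicOpen 𝒜 f ≤ _) (fracSec hf ha) =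
      resO inf_le_left (fracSec hg ha) * resO inf_le_right (fracSec hf hg) := by
  refine Subtype.ext (funext fun x ↦ val_injective _ ?_)
  have prime : x.1.asHomogeneousIdeal.toIdeal.IsPrime := x.1.isPrime
  have pow_one_mem {h : A} (hh : h ∉ x.1.asHomogeneousIdeal) :
      h ^ 1 ∈ x.1.asHomogeneousIdeal.toIdeal.primeCompl := by rwa [pow_one]
  have hf' := pow_one_mem x.2.2
  have hg' := pow_one_mem x.2.1
  refine Eq.trans ?_ (HomogeneousLocalization.val_mul _ _).symm
  change Localization.mk a ⟨f ^ 1, hf'⟩ =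
    Localization.mk a ⟨g ^ 1, hg'⟩ * Localization.mk g ⟨f ^ 1, hf'⟩
  rw [Localization.mk_mul, Localization.mk_eq_mk_iff, Localization.r_iff_exists]
  refine ⟨1, ?_⟩
  simp only [Submonoid.coe_mul, OneMemClass.coe_one, one_mul, pow_one]
  ring

end Proj

/-! ### The toric variety of a reflexive polytope -/

namespace ReflexivePolytope

variable {n : ℕ} (Δ : ReflexivePolytope n)

instance : UniqueSums Δ.cone :=
  UniqueSums.of_injective_addHom (G := (Fin n → ℤ) × ℕ) (Δ.cone.subtype : Δ.cone →ₙ+ _)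
    Subtype.val_injective inferInstance

/-- The monomial `χ^m t^k`. -/
def monomial (p : Δ.cone) : Δ.coordRing := AddMonoidAlgebra.single p 1

lemma monomial_mul (p q : Δ.cone) : Δ.monomial p * Δ.monomial q = Δ.monomial (p + q) := by
  simp [monomial, AddMonoidAlgebra.single_mul_single]

lemma monomial_pow (p : Δ.cone) (N : ℕ) : Δ.monomial p ^ N = Δ.monomial (N • p) := by
  simp [monomial, AddMonoidAlgebra.single_pow]

lemma monomial_ne_zero (p : Δ.cone) : Δ.monomial p ≠ 0 := by
  simp [monomial]

lemma monomial_mem (p : Δ.cone) : Δ.monomial p ∈ Δ.grading p.1.2 :=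
  AddMonoidAlgebra.single_mem_gradeBy Δ.degree p 1

lemma single_eq_smul (p : Δ.cone) (c : ℂ) :
    (AddMonoidAlgebra.single p c : Δ.coordRing) = c • Δ.monomial p := by
  simp [monomial]

lemma eq_sum_monomial (a : Δ.coordRing) :
    a = ∑ p ∈ a.coeff.support, a.coeff p • Δ.monomial p := by
  simp only [← single_eq_smul]
  exact (AddMonoidAlgebra.sum_coeff_single a).symm

variable {Δ} in
lemma mem_of_forall_monomial_mem {J : Ideal Δ.coordRing} {a : Δ.coordRing}
    (h : ∀ p ∈ a.coeff.support, Δ.monomial p ∈ J) : a ∈ J := by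
  rw [Δ.eq_sum_monomial a]
  exact J.sum_mem fun p hp ↦ Submodule.smul_of_tower_mem J _ (h p hp)

/-- `p` lies on the cone over the facet `F`. -/
def OnFacet (F : Δ.Facet) (p : Δ.cone) : Prop := pairing (latticePt p.1.1) F.1 = -(p.1.2 : ℝ)

lemma neg_le_pairing (F : Δ.Facet) (p : Δ.cone) : -(p.1.2 : ℝ) ≤ pairing (latticePt p.1.1) F.1 :=
  (Δ.mem_smul_carrier_iff (Nat.cast_nonneg _) _).1 p.2 F

/- A point of the cone is on the facet when the nonnegative quantity `⟨m, v_F⟩ + k`, which is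
additive in `(m, k)`, vanishes. -/
lemma onFacet_add (F : Δ.Facet) (p q : Δ.cone) :
    Δ.OnFacet F (p + q) ↔ Δ.OnFacet F p ∧ Δ.OnFacet F q := by
  have hp := Δ.neg_le_pairing F p
  have hq := Δ.neg_le_pairing F q
  have pairing_add : pairing (latticePt (p + q).1.1) F.1 =
      pairing (latticePt p.1.1) F.1 + pairing (latticePt q.1.1) F.1 := by
    simp [pairing, latticePt, add_mul, Finset.sum_add_distrib]
  have degree_add : (((p + q).1.2 : ℕ) : ℝ) = p.1.2 + q.1.2 := by simp
  unfold OnFacet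
  rw [pairing_add, degree_add]
  constructor
  · intro h
    constructor <;> linarith
  · rintro ⟨onF_p, onF_q⟩
    linarith

lemma onFacet_zero (F : Δ.Facet) : Δ.OnFacet F 0 := by
  simp [OnFacet, pairing, latticePt]

open Classical in
/-- The projection of the coordinate ring onto the span of the monomials on a facet. -/
def facetProj (F : Δ.Facet) : Δ.coordRing →ₐ[ℂ] Δ.coordRing :=
  AddMonoidAlgebra.lift ℂ Δ.coordRing Δ.cone
    { toFun := fun p ↦ if Δ.OnFacet F p.toAdd then Δ.monomial p.toAdd else 0
      map_one' := if_pos (Δ.onFacet_zero F)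
      map_mul' := fun p q ↦ by
        rw [toAdd_mul, onFacet_add, ← monomial_mul]
        by_cases hp : Δ.OnFacet F p.toAdd <;> by_cases hq : Δ.OnFacet F q.toAdd <;> simp [hp, hq] }

open Classical in
lemma facetProj_monomial (F : Δ.Facet) (p : Δ.cone) :
    Δ.facetProj F (Δ.monomial p) = if Δ.OnFacet F p then Δ.monomial p else 0 := by
  simp [facetProj, monomial]

open Classical in
lemma coeff_facetProj (F : Δ.Facet) (a : Δ.coordRing) (p : Δ.cone) :
    (Δ.facetProj F a).coeff p = if Δ.OnFacet F p then a.coeff p else 0 := by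
  induction a using AddMonoidAlgebra.induction_linear with
  | zero => simp
  | add a b ha hb =>
    rw [map_add, AddMonoidAlgebra.coeff_add, Finsupp.add_apply, ha, hb]
    split_ifs <;> simp
  | single q c =>
    rw [single_eq_smul, map_smul, facetProj_monomial]
    by_cases hpq : p = q
    · subst hpq
      split_ifs <;> simp
    · by_cases hq : Δ.OnFacet F q <;> simp [hq, monomial, Ne.symm hpq]

variable {Δ}

lemma coeff_eq_zero_of_facetProj_eq_zero {F : Δ.Facet} {a : Δ.coordRing}
    (ha : Δ.facetProj F a = 0) {p : Δ.cone} (hp : Δ.OnFacet F p) : a.coeff p = 0 := by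
  classical
  rw [← if_pos hp (t := a.coeff p) (e := 0), ← coeff_facetProj, ha, AddMonoidAlgebra.coeff_zero,
    Finsupp.zero_apply]

/-- The ideal of a facet divisor. -/
def facetIdeal (F : Δ.Facet) : Ideal Δ.coordRing :=
  Ideal.span {f | ∃ p : Δ.cone, ¬ Δ.OnFacet F p ∧ f = Δ.monomial p}

lemma facetIdeal_eq_ker (F : Δ.Facet) :
    facetIdeal F = RingHom.ker (Δ.facetProj F : Δ.coordRing →+* Δ.coordRing) := by
  refine le_antisymm (Ideal.span_le.2 ?_) fun a ha ↦ mem_of_forall_monomial_mem fun p hp ↦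
    Ideal.subset_span ⟨p, fun onF ↦ ?_, rfl⟩
  · rintro _ ⟨p, hp, rfl⟩
    change Δ.facetProj F (Δ.monomial p) = 0
    rw [facetProj_monomial, if_neg hp]
  · exact Finsupp.mem_support_iff.1 hp (coeff_eq_zero_of_facetProj_eq_zero ha onF)

instance (F : Δ.Facet) : (facetIdeal F).IsPrime := by
  rw [facetIdeal_eq_ker]
  exact RingHom.ker_isPrime _

lemma coeff_eq_zero_of_mem_facetIdeal {F : Δ.Facet} {a : Δ.coordRing} (ha : a ∈ facetIdeal F)
    {p : Δ.cone} (hp : Δ.OnFacet F p) : a.coeff p = 0 := by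
  rw [facetIdeal_eq_ker] at ha
  exact coeff_eq_zero_of_facetProj_eq_zero ha hp

lemma isHomogeneous_facetIdeal (F : Δ.Facet) : (facetIdeal F).IsHomogeneous Δ.grading := by
  refine Ideal.homogeneous_span _ _ ?_
  rintro _ ⟨p, -, rfl⟩
  exact ⟨_, Δ.monomial_mem p⟩

/-- The generic point of a facet divisor. -/
def facetPoint (F : Δ.Facet) {p : Δ.cone} (hp : 0 < p.1.2) (hpF : Δ.monomial p ∉ facetIdeal F) :
    Proj Δ.grading :=
  { asHomogeneousIdeal := ⟨facetIdeal F, isHomogeneous_facetIdeal F⟩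
    isPrime := inferInstanceAs (facetIdeal F).IsPrime
    not_irrelevant_le := fun h ↦ hpF (h (HomogeneousIdeal.mem_irrelevant_of_mem _ hp
      (Δ.monomial_mem p))) }

lemma mem_facetDivisor {F : Δ.Facet} {x : Proj Δ.grading} :
    x ∈ Δ.facetDivisor F ↔ facetIdeal F ≤ x.asHomogeneousIdeal.toIdeal := by
  refine Iff.trans ?_ Ideal.span_le.symm
  rfl

variable (Δ)

/-- The point `(0, 1)` of the cone. -/
def tPt : Δ.cone := ⟨(0, 1), Δ.zero_one_mem_cone⟩

/-- The homogeneous coordinate `t`, whose divisor is `∑_F D_F` by reflexivity. -/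
def t : Δ.coordRing := Δ.monomial Δ.tPt

lemma t_mem : Δ.t ∈ Δ.grading 1 := Δ.monomial_mem Δ.tPt

lemma t_ne_zero : Δ.t ≠ 0 := Δ.monomial_ne_zero Δ.tPt

lemma t_mem_facetIdeal (F : Δ.Facet) : Δ.t ∈ facetIdeal F :=
  Ideal.subset_span ⟨Δ.tPt, by simp [OnFacet, tPt, pairing, latticePt], rfl⟩

variable {Δ} in
lemma exists_eq_t_mul {k : ℕ} {b : Δ.coordRing} (hb : b ∈ Δ.grading (k + 1))
    (hF : ∀ F, b ∈ facetIdeal F) : ∃ c ∈ Δ.grading k, b = Δ.t * c := by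
  have exists_eq_tPt_add (p : Δ.cone) (hp : p ∈ b.coeff.support) :
      ∃ q : Δ.cone, q.1.2 = k ∧ p = Δ.tPt + q := by
    obtain ⟨⟨m, l⟩, hml⟩ := p
    obtain rfl : l = k + 1 := hb _ hp
    refine ⟨⟨(m, k), Δ.mem_cone_of_forall_ne hml fun F h ↦ ?_⟩, rfl, ?_⟩
    · exact Finsupp.mem_support_iff.1 hp (coeff_eq_zero_of_mem_facetIdeal (hF F) h)
    · exact Subtype.ext (Prod.ext (zero_add m).symm (add_comm k 1))
  choose! q hq hpq using exists_eq_tPt_add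
  refine ⟨∑ p ∈ b.coeff.support, b.coeff p • Δ.monomial (q p), sum_mem fun p hp ↦
    Submodule.smul_mem _ _ (hq p hp ▸ Δ.monomial_mem (q p)), ?_⟩
  conv_lhs => rw [Δ.eq_sum_monomial b]
  rw [Finset.mul_sum]
  refine Finset.sum_congr rfl fun p hp ↦ ?_
  rw [mul_smul_comm, t, monomial_mul, ← hpq p hp]

/-- The point of the cone given by a vertex. -/
def vertexPt (v : Δ.vertices) : Δ.cone := ⟨(v, 1), Δ.mem_cone_of_mem_vertices v.2⟩

/-- The homogeneous coordinate `χ^v t` of a vertex `v`. -/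
def x (v : Δ.vertices) : Δ.coordRing := Δ.monomial (Δ.vertexPt v)

variable {Δ}

lemma x_mem (v : Δ.vertices) : Δ.x v ∈ Δ.grading 1 := Δ.monomial_mem (Δ.vertexPt v)

lemma x_ne_zero (v : Δ.vertices) : Δ.x v ≠ 0 := Δ.monomial_ne_zero (Δ.vertexPt v)

lemma monomial_mem_of_forall_x_mem {J : Ideal Δ.coordRing} (hJ : J.IsPrime)
    (hx : ∀ v, Δ.x v ∈ J) {p : Δ.cone} (hp : 0 < p.1.2) : Δ.monomial p ∈ J := by
  obtain ⟨v, hv, N, q, hq, nsmul_eq⟩ := Δ.exists_nsmul_eq_add p.2 hp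
  have pow_eq : Δ.monomial p ^ N = Δ.x ⟨v, hv⟩ * Δ.monomial ⟨q, hq⟩ := by
    rw [x, monomial_pow, monomial_mul]
    exact congrArg Δ.monomial (Subtype.ext nsmul_eq)
  exact hJ.mem_of_pow_mem N (pow_eq ▸ J.mul_mem_right _ (hx _))

lemma exists_x_notMem (y : Proj Δ.grading) : ∃ v, Δ.x v ∉ y.asHomogeneousIdeal := by
  by_contra! hx
  refine y.not_irrelevant_le ((HomogeneousIdeal.irrelevant_le _).2 fun i hi b hb ↦ ?_)
  refine mem_of_forall_monomial_mem (J := y.asHomogeneousIdeal.toIdeal) fun p hp ↦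
    monomial_mem_of_forall_x_mem y.isPrime hx ?_
  have degree_eq : p.1.2 = i := hb p hp
  omega

variable (Δ)

/-- The charts `D₊(x_v)` of the toric variety, for the vertices `v`. -/
def charts : Charts Δ.toricVariety Δ.vertices where
  U v := Proj.basicOpen Δ.grading (Δ.x v)
  cover := top_le_iff.1 fun y _ ↦ Opens.mem_iSup.2 (exists_x_notMem y)
  ratio v w := fracSec (x_mem w) (x_mem v)
  ratio_self v := fracSec_self _
  cocycle u v w := resO_fracSec (x_mem w) (x_mem v) (x_mem u)
  basicOpen_ratio v w := by
    ext y
    exact (mem_basicOpen_fracSec (x_mem w) (x_mem v) y).trans and_comm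

/-- `D₊(x_v)` as an affine open. -/
def affineChart (v : Δ.vertices) : Δ.toricVariety.affineOpens :=
  ⟨Δ.charts.U v, Proj.isAffineOpen_basicOpen Δ.grading _ (x_mem v) one_pos⟩

/-- The function `t / x_v`. -/
def tFrac (v : Δ.vertices) : Γ(Δ.toricVariety, Δ.charts.U v) := fracSec (x_mem v) Δ.t_mem

/-- The ideal of `⋃_F D_F`. -/
abbrev boundaryIdeal : Δ.toricVariety.IdealSheafData :=
  Scheme.IdealSheafData.vanishingIdeal (⨆ F, Δ.facetDivisor F)

lemma tFrac_mem (v : Δ.vertices) : Δ.tFrac v ∈ Δ.boundaryIdeal.ideal (Δ.affineChart v) := by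
  refine (mem_vanishingIdeal_iff _ (Δ.affineChart v) (Δ.tFrac v)).2 fun y hy _ ↦ ?_
  let zeros : Closeds Δ.toricVariety := ⟨((Δ.toricVariety.basicOpen (Δ.tFrac v) : Set _))ᶜ,
    (Δ.toricVariety.basicOpen (Δ.tFrac v)).isOpen.isClosed_compl⟩
  have le_zeros : ⨆ F, Δ.facetDivisor F ≤ zeros := iSup_le fun F z hz hzt ↦
    ((mem_basicOpen_fracSec _ _ z).1 hzt).2 (mem_facetDivisor.1 hz (Δ.t_mem_facetIdeal F))
  exact le_zeros hy

variable {Δ} in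
lemma x_mul_mem_facetIdeal {v : Δ.vertices} {k : ℕ} {a : Δ.coordRing} (ha : a ∈ Δ.grading k)
    (haI : fracSec (x_mem v) ha ∈ Δ.boundaryIdeal.ideal (Δ.affineChart v)) (F : Δ.Facet) :
    Δ.x v * a ∈ facetIdeal F := by
  by_cases hxF : Δ.x v ∈ facetIdeal F
  · exact Ideal.mul_mem_right _ _ hxF
  · refine Ideal.mul_mem_left _ _ ?_
    let y := facetPoint F (p := Δ.vertexPt v) one_pos hxF
    have hy : y ∈ ⨆ F, Δ.facetDivisor F := (le_iSup Δ.facetDivisor F) (mem_facetDivisor.2 le_rfl)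
    by_contra haF
    exact (mem_vanishingIdeal_iff _ _ _).1 haI y hy hxF
      ((mem_basicOpen_fracSec (x_mem v) ha y).2 ⟨hxF, haF⟩)

lemma ideal_boundaryIdeal (v : Δ.vertices) :
    Δ.boundaryIdeal.ideal (Δ.affineChart v) = Ideal.span {Δ.tFrac v} := by
  refine le_antisymm (fun s hs ↦ ?_) ((Ideal.span_singleton_le_iff_mem _).2 (Δ.tFrac_mem v))
  obtain ⟨k, a, ha, rfl⟩ := fracSec_surjective (x_mem v) s
  have hxa : Δ.x v * a ∈ Δ.grading (k + 1) := by
    rw [add_comm k 1]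
    exact SetLike.mul_mem_graded (x_mem v) ha
  obtain ⟨c, hc, hac⟩ := exists_eq_t_mul hxa (x_mul_mem_facetIdeal ha hs)
  refine Ideal.mem_span_singleton.2 ⟨fracSec (x_mem v) hc, ?_⟩
  refine Eq.trans ?_ (fracSec_mul (x_mem v) Δ.t_mem hc).symm
  refine (fracSec_eq_iff (x_mem v) (x_ne_zero v) _ _).2 ?_
  rw [← hac]
  ring

lemma tFrac_mem_nonZeroDivisors (v : Δ.vertices) :
    Δ.tFrac v ∈ nonZeroDivisors Γ(Δ.toricVariety, Δ.charts.U v) := by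
  rw [mem_nonZeroDivisors_iff_right]
  intro s hs
  obtain ⟨k, a, ha, rfl⟩ := fracSec_surjective (x_mem v) s
  have mul_eq_zero' : fracSec (x_mem v) (SetLike.mul_mem_graded ha Δ.t_mem) = 0 :=
    (fracSec_mul (x_mem v) ha Δ.t_mem).symm.trans hs
  rw [fracSec_eq_zero_iff (x_mem v) (x_ne_zero v)] at mul_eq_zero'
  exact (fracSec_eq_zero_iff (x_mem v) (x_ne_zero v) ha).2
    ((mul_eq_zero.1 mul_eq_zero').resolve_right Δ.t_ne_zero)

lemma hasWeight_canonicalSheaf : Δ.charts.HasWeight Δ.canonicalSheaf (-1) := by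
  choose z hz using fun v ↦ exists_idealFun_eq _ _ (Δ.tFrac_mem v)
  refine ⟨z, fun v ↦ isFrame_idealModule _ (Δ.affineChart v) (z v) ?_ ?_,
    fun v w ↦ idealFun_injective _ _ ?_⟩
  · rw [hz]
    exact Δ.tFrac_mem_nonZeroDivisors v
  · rw [hz]
    exact Δ.ideal_boundaryIdeal v
  · refine (resO_idealFun _ _ (z v)).symm.trans (Eq.trans ?_ (idealFun_smul _ _ _).symm)
    refine Eq.trans ?_ (congrArg _ (resO_idealFun _ _ (z w)))
    rw [hz, hz, zpow_neg_one, Units.eq_inv_mul_iff_mul_eq, mul_comm]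
    exact (resO_fracSec (x_mem w) (x_mem v) Δ.t_mem).symm

lemma hasWeight_polarization : Δ.charts.HasWeight Δ.polarization (n - 1) := by
  have := Δ.hasWeight_canonicalSheaf.tensorPow (-((n : ℤ) - 1))
  rwa [neg_mul_neg, mul_one] at this

end ReflexivePolytope

lemma Charts.HasWeight.of_subsingleton {X : Scheme.{0}} {ι : Type} [Subsingleton ι]
    {C : Charts X ι} {M : X.Modules} {d : ℤ} (h : C.HasWeight M d) (d' : ℤ) : C.HasWeight M d' := by
  obtain ⟨e, he, he'⟩ := h
  have trans_eq_one (v w : ι) : C.trans v w = 1 := by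
    obtain rfl := Subsingleton.elim v w
    refine Units.ext ?_
    change resO _ (C.ratio v v) = 1
    rw [C.ratio_self, map_one]
  refine ⟨e, he, fun v w ↦ ?_⟩
  have glue := he' v w
  rw [trans_eq_one, one_zpow] at glue ⊢
  exact glue

/-- The whole scheme as a single chart. -/
def Charts.whole (X : Scheme.{0}) : Charts X Unit where
  U _ := ⊤
  cover := iSup_const
  ratio _ _ := 1
  ratio_self _ := rfl
  cocycle _ _ _ := by simp only [map_one, mul_one]
  basicOpen_ratio _ _ := by
    rw [Scheme.basicOpen_of_isUnit _ isUnit_one, inf_idem]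

lemma exists_forall_nontrivial_dbExt {Y : Scheme.{0}} {ι : Type} [Finite ι] (C : Charts Y ι)
    (hC : ∀ w, IsAffineOpen (C.U w)) {L : Y.Modules} {d : ℤ} (hL : C.HasWeight L d)
    (hd : 1 ≤ d ∨ Subsingleton ι) :
    ∃ hL : ∀ i : ℤ, IsCoherent (tensorPow L i), ∀ F : DbCoh Y, ¬ IsZero F →
      ∃ i₀ r : ℤ, ∀ i : ℤ, i ≤ i₀ → Nontrivial (DbExt r (sheafObj (tensorPow L i) (hL i)) F) := by
  refine ⟨fun i ↦ (hL.tensorPow i).isCoherent, fun F hF ↦ ?_⟩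
  obtain ⟨k₀, r, nontrivial⟩ := exists_nontrivial_dbExt
    (M := fun k : ℕ ↦ tensorPow L (-(k : ℤ))) (fun k ↦ (hL.tensorPow _).isCoherent)
    (fun Z H q hZ hq ↦ by
      obtain ⟨k₀, hk₀⟩ := C.exists_comp_ne_zero hC hZ hq
      refine ⟨k₀, fun k hk ↦ ?_⟩
      have weight := hL.tensorPow (-(k : ℤ))
      rcases hd with hd | hd
      · lift d to ℕ using by omega
        rw [neg_mul] at weight
        exact hk₀ (k * d) (hk.trans (Nat.le_mul_of_pos_right k (by omega))) _ weight
      · exact hk₀ k hk _ (weight.of_subsingleton _)) F hF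
  refine ⟨-k₀, r, fun i hi ↦ ?_⟩
  obtain ⟨k, rfl⟩ : ∃ k : ℕ, i = -(k : ℤ) := ⟨i.natAbs, by omega⟩
  exact nontrivial k (by omega)

section IdealSheaf

variable {X : Scheme.{0}} {I : X.IdealSheafData}

lemma subschemeι_notMem_basicOpen {U : X.affineOpens} {s : Γ(X, U.1)} (hs : s ∈ I.ideal U)
    (y : I.subscheme) : I.subschemeι y ∉ X.basicOpen s := by
  intro hy
  change y ∈ I.subschemeι ⁻¹ᵁ X.basicOpen s at hy
  rw [← I.ker_subschemeι_app U, RingHom.mem_ker] at hs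
  rwa [Scheme.Hom.preimage_basicOpen, hs, Scheme.basicOpen_zero] at hy

lemma ne_bot_of_idealModule_iso {J : X.IdealSheafData} (e : idealModule I ≅ idealModule J)
    (hJ : J ≠ ⊥) : I ≠ ⊥ := by
  contrapose! hJ
  refine Scheme.IdealSheafData.ext (funext fun U ↦ (Submodule.eq_bot_iff _).2 fun a ha ↦ ?_)
  obtain ⟨z, rfl⟩ := exists_idealFun_eq J U ha
  have idealFun_zero (K : X.IdealSheafData) : idealFun K (0 : Γ(idealModule K, U.1)) = 0 :=
    map_zero ((idealInclusion K).app U.1).hom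
  have ideal_eq_bot : I.ideal U = ⊥ := by rw [hJ, Scheme.IdealSheafData.ideal_bot, Pi.bot_apply]
  have idealFun_inv : idealFun I (e.inv.app U.1 z) = 0 := by
    rw [← Submodule.mem_bot Γ(X, U.1), ← ideal_eq_bot]
    exact idealFun_mem I U _
  have inv_eq_zero : e.inv.app U.1 z = 0 :=
    idealFun_injective I U.1 (idealFun_inv.trans (idealFun_zero I).symm)
  have hom_inv : e.hom.app U.1 (e.inv.app U.1 z) = z :=
    congrArg (fun f ↦ Scheme.Modules.Hom.app f U.1 z) e.inv_hom_id
  rw [← hom_inv, inv_eq_zero, map_zero, idealFun_zero]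

end IdealSheaf

namespace ReflexivePolytope

variable {n : ℕ} {Δ : ReflexivePolytope n} {I : Δ.toricVariety.IdealSheafData}

lemma boundaryIdeal_ne_bot : Δ.boundaryIdeal ≠ ⊥ := by
  intro h
  obtain ⟨v, hv, -⟩ := Δ.exists_nsmul_eq_add Δ.zero_one_mem_cone one_pos
  have tFrac_eq_zero := Δ.tFrac_mem ⟨v, hv⟩
  rw [h] at tFrac_eq_zero
  exact Δ.t_ne_zero ((fracSec_eq_zero_iff _ (x_ne_zero _) Δ.t_mem).1 tFrac_eq_zero)

lemma IsAnticanonical.ne_bot (hI : Δ.IsAnticanonical I) : I ≠ ⊥ :=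
  hI.elim fun e ↦ ne_bot_of_idealModule_iso e boundaryIdeal_ne_bot

lemma exists_ne_zero_forall_mem (hI : I ≠ ⊥) : ∃ (k : ℕ) (b : Δ.coordRing), b ∈ Δ.grading k ∧
    b ≠ 0 ∧ ∀ y : I.subscheme, b ∈ (I.subschemeι y).asHomogeneousIdeal := by
  obtain ⟨v, s, hs, hs₀⟩ : ∃ v, ∃ s ∈ I.ideal (Δ.affineChart v), s ≠ 0 := by
    by_contra! eq_zero
    exact hI (Scheme.IdealSheafData.ext_of_iSup_eq_top Δ.affineChart Δ.charts.cover fun v ↦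
      (Submodule.eq_bot_iff _).2 (eq_zero v))
  obtain ⟨k, a, ha, rfl⟩ := fracSec_surjective (x_mem v) s
  have ha₀ : a ≠ 0 := fun ha₀ ↦ hs₀ ((fracSec_eq_zero_iff (x_mem v) (x_ne_zero v) ha).2 ha₀)
  refine ⟨_, Δ.x v * a, SetLike.mul_mem_graded (x_mem v) ha, mul_ne_zero (x_ne_zero v) ha₀,
    fun y ↦ ?_⟩
  by_contra hy
  exact subschemeι_notMem_basicOpen hs y ((mem_basicOpen_fracSec (x_mem v) ha _).2
    ⟨fun hx ↦ hy (Ideal.mul_mem_right _ _ hx), fun ha ↦ hy (Ideal.mul_mem_left _ _ ha)⟩)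

end ReflexivePolytope

/-! ### Reflexive segments -/

namespace ReflexivePolytope

variable (Δ : ReflexivePolytope 1)

lemma facet_eq_one_or_neg_one (F : Δ.Facet) : F.1 0 = 1 ∨ F.1 0 = -1 :=
  Int.isUnit_iff.1 (F.2.primitive (F.1 0) fun i ↦ by rw [Subsingleton.elim i 0])

open scoped Pointwise in
lemma exists_facet_eq {ε : ℤ} (hε : ε = 1 ∨ ε = -1) : ∃ F : Δ.Facet, F.1 0 = ε := by
  by_contra! ne
  obtain ⟨R, hR⟩ := Δ.isBounded_carrier.exists_norm_le
  obtain ⟨N, hN⟩ := exists_nat_gt R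
  have mem_cone : ((fun _ ↦ -ε * N : Fin 1 → ℤ), 1) ∈ Δ.cone := by
    refine (Δ.mem_cone_iff _).2 fun F ↦ ?_
    have facet_eq : F.1 0 = -ε := by
      have := Δ.facet_eq_one_or_neg_one F
      have := ne F
      omega
    have pairing_eq : -ε * N * -ε = N := by rcases hε with rfl | rfl <;> ring
    rw [Fin.sum_univ_one, facet_eq, pairing_eq]
    omega
  change latticePt _ ∈ ((1 : ℕ) : ℝ) • Δ.carrier at mem_cone
  rw [Nat.cast_one, one_smul] at mem_cone
  have norm_eq : ‖latticePt (fun _ ↦ -ε * N : Fin 1 → ℤ) 0‖ = N := by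
    rcases hε with rfl | rfl <;> simp [latticePt]
  have norm_le := (norm_le_pi_norm _ 0).trans (hR _ mem_cone)
  rw [norm_eq] at norm_le
  linarith

lemma mem_cone_iff_abs_le (p : (Fin 1 → ℤ) × ℕ) : p ∈ Δ.cone ↔ |p.1 0| ≤ p.2 := by
  rw [mem_cone_iff, abs_le]
  simp only [Fin.sum_univ_one]
  constructor
  · intro h
    obtain ⟨F, hF⟩ := Δ.exists_facet_eq (Or.inl rfl)
    obtain ⟨G, hG⟩ := Δ.exists_facet_eq (Or.inr rfl)
    have le_F := h F
    have le_G := h G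
    rw [hF] at le_F
    rw [hG] at le_G
    omega
  · intro h F
    rcases Δ.facet_eq_one_or_neg_one F with hF | hF <;> rw [hF] <;> omega

/-- The point `(ε, 1)` of the cone. -/
def endPt (ε : ℤ) (hε : |ε| ≤ 1) : Δ.cone :=
  ⟨(fun _ ↦ ε, 1), (Δ.mem_cone_iff_abs_le _).2 (by simpa using hε)⟩

/-- The homogeneous coordinate `χ t`. -/
def xPos : Δ.coordRing := Δ.monomial (Δ.endPt 1 (by norm_num))

/-- The homogeneous coordinate `χ⁻¹ t`. -/
def xNeg : Δ.coordRing := Δ.monomial (Δ.endPt (-1) (by norm_num))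

lemma xPos_mem : Δ.xPos ∈ Δ.grading 1 := Δ.monomial_mem _

lemma xNeg_mem : Δ.xNeg ∈ Δ.grading 1 := Δ.monomial_mem _

variable {Δ} in
lemma cone_ext {p q : Δ.cone} (h₁ : p.1.1 0 = q.1.1 0) (h₂ : p.1.2 = q.1.2) : p = q :=
  Subtype.ext (Prod.ext (funext fun i ↦ by rwa [Subsingleton.elim i 0]) h₂)

lemma xPos_mul_xNeg : Δ.xPos * Δ.xNeg = Δ.t ^ 2 := by
  rw [xPos, xNeg, t, monomial_pow, monomial_mul]
  exact congrArg _ (cone_ext rfl rfl)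

lemma x_eq (v : Δ.vertices) : Δ.x v = Δ.xPos ∨ Δ.x v = Δ.t ∨ Δ.x v = Δ.xNeg := by
  have abs_le_one : |v.1 0| ≤ ((1 : ℕ) : ℤ) := (Δ.mem_cone_iff_abs_le _).1 (Δ.vertexPt v).2
  rw [abs_le] at abs_le_one
  obtain hv | hv | hv : v.1 0 = 1 ∨ v.1 0 = 0 ∨ v.1 0 = -1 := by omega
  · exact Or.inl (congrArg Δ.monomial (cone_ext hv rfl))
  · exact Or.inr (Or.inl (congrArg Δ.monomial (cone_ext hv rfl)))
  · exact Or.inr (Or.inr (congrArg Δ.monomial (cone_ext hv rfl)))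

/-- The section `(t - c xPos)² / xPos` of `𝒪(1)` on the projective line, with a double zero at the
point where `t / xPos = c`. -/
def doubleZero (c : ℂ) : Δ.coordRing := Δ.xNeg - (2 * c) • Δ.t + c ^ 2 • Δ.xPos

lemma doubleZero_mem (c : ℂ) : Δ.doubleZero c ∈ Δ.grading 1 :=
  add_mem (sub_mem Δ.xNeg_mem (Submodule.smul_mem _ _ Δ.t_mem))
    (Submodule.smul_mem _ _ Δ.xPos_mem)

lemma xPos_mul_doubleZero (c : ℂ) : Δ.xPos * Δ.doubleZero c = (Δ.t - c • Δ.xPos) ^ 2 := by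
  rw [doubleZero, mul_add, mul_sub, xPos_mul_xNeg]
  simp only [Algebra.smul_def, map_mul, map_pow, map_ofNat]
  ring

open Polynomial in
/-- Dehomogenization with respect to `xPos`: the homomorphism with `xPos ↦ 1` and `t ↦ X`. -/
def dehomog : Δ.coordRing →ₐ[ℂ] ℂ[X] :=
  AddMonoidAlgebra.lift ℂ ℂ[X] Δ.cone
    { toFun := fun p ↦ X ^ ((p.toAdd.1.2 : ℤ) - p.toAdd.1.1 0).toNat
      map_one' := pow_zero X
      map_mul' := fun p q ↦ by
        have hp := (Δ.mem_cone_iff_abs_le _).1 p.toAdd.2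
        have hq := (Δ.mem_cone_iff_abs_le _).1 q.toAdd.2
        rw [abs_le] at hp hq
        rw [← pow_add, toAdd_mul, AddSubmonoid.coe_add, Prod.fst_add, Prod.snd_add, Pi.add_apply]
        congr 1
        omega }

open Polynomial in
lemma dehomog_monomial (p : Δ.cone) :
    Δ.dehomog (Δ.monomial p) = X ^ ((p.1.2 : ℤ) - p.1.1 0).toNat := by
  simp [dehomog, monomial]

variable {Δ} {k : ℕ} {a : Δ.coordRing}

lemma coeff_dehomog (ha : a ∈ Δ.grading k) {p : Δ.cone} (hp : p.1.2 = k) :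
    (Δ.dehomog a).coeff ((k : ℤ) - p.1.1 0).toNat = a.coeff p := by
  conv_lhs => rw [Δ.eq_sum_monomial a]
  simp only [map_sum, map_smul, dehomog_monomial, Polynomial.finsetSum_coeff,
    Polynomial.coeff_smul, Polynomial.coeff_X_pow]
  rw [Finset.sum_eq_single p]
  · rw [hp, if_pos rfl, smul_eq_mul, mul_one]
  · intro q hq hqp
    have degree_q : q.1.2 = k := ha q hq
    have abs_p := (Δ.mem_cone_iff_abs_le _).1 p.2
    have abs_q := (Δ.mem_cone_iff_abs_le _).1 q.2
    rw [abs_le] at abs_p abs_q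
    rw [if_neg, smul_zero]
    exact fun h ↦ hqp (cone_ext (by omega) (degree_q.trans hp.symm))
  · intro h
    rw [Finsupp.notMem_support_iff.1 h, zero_smul]

lemma dehomog_ne_zero (ha : a ∈ Δ.grading k) (ha₀ : a ≠ 0) : Δ.dehomog a ≠ 0 := by
  contrapose! ha₀
  ext p
  by_contra hp
  have degree_p : p.1.2 = k := ha p (Finsupp.mem_support_iff.2 hp)
  refine hp ?_
  rw [← coeff_dehomog ha degree_p, ha₀, Polynomial.coeff_zero]
  rfl

lemma xPos_pow_mul_monomial_sub_mem (c : ℂ) (p : Δ.cone) :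
    Δ.xPos ^ p.1.2 * Δ.monomial p - (Δ.dehomog (Δ.monomial p)).eval c • Δ.xPos ^ (2 * p.1.2) ∈
      Ideal.span {Δ.t - c • Δ.xPos} := by
  have abs_p := (Δ.mem_cone_iff_abs_le _).1 p.2
  rw [abs_le] at abs_p
  obtain ⟨i, hi⟩ : ∃ i : ℕ, (p.1.2 : ℤ) - p.1.1 0 = i :=
    ⟨_, (Int.toNat_of_nonneg (by omega)).symm⟩
  obtain ⟨j, hj⟩ : ∃ j : ℕ, (p.1.2 : ℤ) + p.1.1 0 = j :=
    ⟨_, (Int.toNat_of_nonneg (by omega)).symm⟩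
  have mul_eq : Δ.xPos ^ p.1.2 * Δ.monomial p = Δ.t ^ i * Δ.xPos ^ j := by
    simp only [xPos, t, monomial_pow, monomial_mul]
    refine congrArg _ (cone_ext ?_ ?_)
    · simp only [endPt, AddSubmonoidClass.mk_nsmul, Prod.smul_mk, nsmul_eq_mul, smul_eq_mul,
        mul_one, AddSubmonoid.coe_add, Fin.isValue, Prod.fst_add, Pi.add_apply, Pi.mul_apply,
        Pi.natCast_apply, tPt, Pi.zero_apply, mul_zero, AddSubmonoid.mk_add_mk, Prod.mk_add_mk]
      omega
    · simp only [endPt, AddSubmonoidClass.mk_nsmul, Prod.smul_mk, nsmul_eq_mul, smul_eq_mul,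
        mul_one, AddSubmonoid.coe_add, Prod.snd_add, tPt, AddSubmonoid.mk_add_mk, Prod.mk_add_mk]
      omega
  have two_mul_eq : 2 * p.1.2 = i + j := by omega
  rw [dehomog_monomial, Polynomial.eval_pow, Polynomial.eval_X, hi, Int.toNat_natCast, mul_eq,
    two_mul_eq, pow_add, ← smul_mul_assoc, ← smul_pow, ← sub_mul]
  exact Ideal.mul_mem_right _ _ (Ideal.mem_span_singleton.2 (sub_dvd_pow_sub_pow _ _ _))

lemma xPos_pow_mul_sub_mem (ha : a ∈ Δ.grading k) (c : ℂ) :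
    Δ.xPos ^ k * a - (Δ.dehomog a).eval c • Δ.xPos ^ (2 * k) ∈
      Ideal.span {Δ.t - c • Δ.xPos} := by
  have eq_sum : Δ.xPos ^ k * a - (Δ.dehomog a).eval c • Δ.xPos ^ (2 * k) =
      ∑ p ∈ a.coeff.support, a.coeff p • (Δ.xPos ^ k * Δ.monomial p -
        (Δ.dehomog (Δ.monomial p)).eval c • Δ.xPos ^ (2 * k)) := by
    conv_lhs => rw [Δ.eq_sum_monomial a]
    simp only [map_sum, map_smul, Polynomial.eval_finsetSum, Polynomial.eval_smul, smul_sub,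
      Finset.sum_sub_distrib, Finset.mul_sum, mul_smul_comm, Finset.sum_smul, smul_assoc]
  rw [eq_sum]
  refine Ideal.sum_mem _ fun p hp ↦ Submodule.smul_of_tower_mem _ _ ?_
  obtain rfl : p.1.2 = k := ha p hp
  exact xPos_pow_mul_monomial_sub_mem c p

lemma xPos_notMem_of_doubleZero_mem {c : ℂ} {y : Proj Δ.grading}
    (hy : Δ.doubleZero c ∈ y.asHomogeneousIdeal) : Δ.xPos ∉ y.asHomogeneousIdeal := by
  intro hx
  have ht : Δ.t ∈ y.asHomogeneousIdeal :=
    y.isPrime.mem_of_pow_mem 2 (Δ.xPos_mul_xNeg ▸ Ideal.mul_mem_right _ _ hx)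
  have smul_mem {a : Δ.coordRing} (c : ℂ) (ha : a ∈ y.asHomogeneousIdeal.toIdeal) :
      c • a ∈ y.asHomogeneousIdeal.toIdeal := Submodule.smul_of_tower_mem _ c ha
  have hxNeg : Δ.xNeg ∈ y.asHomogeneousIdeal.toIdeal := by
    rw [show Δ.xNeg = Δ.doubleZero c + (2 * c) • Δ.t - c ^ 2 • Δ.xPos by rw [doubleZero]; abel]
    exact sub_mem (add_mem hy (smul_mem _ ht)) (smul_mem _ hx)
  obtain ⟨v, hv⟩ := exists_x_notMem y
  obtain h | h | h := Δ.x_eq v <;> rw [h] at hv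
  exacts [hv hx, hv ht, hv hxNeg]

lemma notMem_of_doubleZero_mem (ha : a ∈ Δ.grading k) {c : ℂ} (hc : (Δ.dehomog a).eval c ≠ 0)
    {y : Proj Δ.grading} (hy : Δ.doubleZero c ∈ y.asHomogeneousIdeal) :
    a ∉ y.asHomogeneousIdeal := by
  intro hay
  have hsub : Δ.t - c • Δ.xPos ∈ y.asHomogeneousIdeal :=
    y.isPrime.mem_of_pow_mem 2 (Δ.xPos_mul_doubleZero c ▸ Ideal.mul_mem_left _ _ hy)
  have smul_mem : (Δ.dehomog a).eval c • Δ.xPos ^ (2 * k) ∈ y.asHomogeneousIdeal.toIdeal := by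
    have := sub_mem (Ideal.mul_mem_left _ (Δ.xPos ^ k) hay)
      ((Ideal.span_singleton_le_iff_mem _).2 hsub (xPos_pow_mul_sub_mem ha c))
    rwa [sub_sub_cancel] at this
  have pow_mem := Submodule.smul_of_tower_mem _ ((Δ.dehomog a).eval c)⁻¹ smul_mem
  rw [inv_smul_smul₀ hc] at pow_mem
  exact xPos_notMem_of_doubleZero_mem hy (y.isPrime.mem_of_pow_mem _ pow_mem)

lemma isAffine_subscheme {I : Δ.toricVariety.IdealSheafData} (hI : I ≠ ⊥) :
    IsAffine I.subscheme := by
  obtain ⟨k, b, hb, hb₀, mem⟩ := exists_ne_zero_forall_mem hI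
  obtain ⟨c, hc⟩ : ∃ c : ℂ, (Δ.dehomog b).eval c ≠ 0 := by
    by_contra! eval_eq_zero
    exact dehomog_ne_zero hb hb₀ (Polynomial.zero_of_eval_zero _ eval_eq_zero)
  have preimage_eq_top : I.subschemeι ⁻¹ᵁ Proj.basicOpen Δ.grading (Δ.doubleZero c) = ⊤ :=
    top_le_iff.1 fun y _ hy ↦ notMem_of_doubleZero_mem hb hc hy (mem y)
  have isAffineOpen : IsAffineOpen (X := Δ.toricVariety) (Proj.basicOpen Δ.grading _) :=
    Proj.isAffineOpen_basicOpen Δ.grading _ (Δ.doubleZero_mem c) one_pos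
  have isAffineOpen_top := isAffineOpen.preimage I.subschemeι
  rw [preimage_eq_top] at isAffineOpen_top
  have : IsAffine (⊤ : I.subscheme.Opens).toScheme := isAffineOpen_top
  exact .of_isIso I.subscheme.topIso.inv

end ReflexivePolytope

end ToricCY

end

theorem proposition2p2_general (n : ℕ) (Δ : ToricCY.ReflexivePolytope n)
    (I : Δ.toricVariety.IdealSheafData) (hI : n = 1 → I ≠ ⊥) :
    ∃ hL : ∀ i : ℤ, ToricCY.IsCoherent (ToricCY.tensorPow (Δ.lineBundle I) i),
      ∀ F : ToricCY.DbCoh I.subscheme, ¬ CategoryTheory.Limits.IsZero F →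
        ∃ i₀ r : ℤ, ∀ i : ℤ, i ≤ i₀ →
          Nontrivial (ToricCY.DbExt r
            (ToricCY.sheafObj (ToricCY.tensorPow (Δ.lineBundle I) i) (hL i)) F) := by
  by_cases hn : n = 1
  · subst hn
    have := ToricCY.ReflexivePolytope.isAffine_subscheme (hI rfl)
    have polarization_trivial :
        (ToricCY.Charts.whole Δ.toricVariety).HasWeight Δ.polarization 0 :=
      (ToricCY.Charts.whole Δ.toricVariety).hasWeight_structureModule
    exact ToricCY.exists_forall_nontrivial_dbExt
      ((ToricCY.Charts.whole Δ.toricVariety).pullback I.subschemeι)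
      (fun _ ↦ isAffineOpen_top I.subscheme) (polarization_trivial.pullback I.subschemeι)
      (Or.inr inferInstance)
  · refine ToricCY.exists_forall_nontrivial_dbExt (Δ.charts.pullback I.subschemeι)
      (fun v ↦ (Δ.affineChart v).2.preimage I.subschemeι)
      (Δ.hasWeight_polarization.pullback I.subschemeι) ?_
    obtain rfl | one_le : n = 0 ∨ 1 ≤ (n : ℤ) - 1 := by omega
    · exact Or.inr inferInstance
    · exact Or.inl one_le

theorem proposition2p2 (n : ℕ) (Δ : ToricCY.ReflexivePolytope n)
    (I : Δ.toricVariety.IdealSheafData) (hY : Δ.IsAnticanonical I) :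
    ∃ hL : ∀ i : ℤ, ToricCY.IsCoherent (ToricCY.tensorPow (Δ.lineBundle I) i),
      ∀ F : ToricCY.DbCoh I.subscheme, ¬ CategoryTheory.Limits.IsZero F →
        ∃ i₀ r : ℤ, ∀ i : ℤ, i ≤ i₀ →
          Nontrivial (ToricCY.DbExt r
            (ToricCY.sheafObj (ToricCY.tensorPow (Δ.lineBundle I) i) (hL i)) F) :=
  proposition2p2_general n Δ I fun _ ↦ hY.ne_bot
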